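/- A \emph{cactus graph} is an undirected graph in which each edge lies in at most one simple cycle; a \emph{directed cactus graph} is a directed graph $G=(V,A)$ obtained from a cactus graph by giving each edge one direction. In \textsc{Shortest Path Game} we are given such a graph with $V=\{0,\dots,n-1\}$, costs $c(u,v)\ge 0$ for the arcs $(u,v)\in A$, and vertices $s,t$ such that there is a directed path from $s$ to $t$. Two players start in $s$, move together along arcs and alternate in choosing the next arc; whoever chooses an arc pays its cost, and the game ends as soon as $t$ is reached. A choice is allowed only if afterwards $t$ can still be reached in such a way that the whole walk from $s$ to $t$ contains no closed walk of even length. Each player minimizes the total cost it pays itself; in case of a tie it prefers the lower cost for the other player, and in case of a further tie the next vertex with the lower number. The \emph{SPE-path} is the unique walk from $s$ to $t$ that results from backward induction in the finite game tree. Then the SPE-path on directed cactus graphs can be computed in $O(n)$ time: there are a single program for a unit-cost random access machine and a constant $C$ such that, for every such instance with $n$ vertices, given as $n$, $s$, $t$ and a list of all arcs with their costs in arbitrary order, the program halts after at most $C\,n$ steps and outputs the SPE-path as the sequence of its vertices. (The machine may only copy, increment, decrement and compare natural numbers, copy, add and compare real costs, and access arrays at positions given by natural numbers, each at unit cost.)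 -/

import Mathlib

namespace ShortestPathGame

/-! ### Cactus graphs and directed cactus graphs -/

/-- A cactus graph: every edge is contained in at most one simple cycle, that is, two simple
cycles which share an edge consist of the same edges. -/
def IsCactus {V : Type*} (H : SimpleGraph V) : Prop :=
  ∀ ⦃u v : V⦄ (p : H.Walk u u) (q : H.Walk v v), p.IsCycle → q.IsCycle →
    ∀ e : Sym2 V, e ∈ p.edges → e ∈ q.edges → ∀ f : Sym2 V, f ∈ p.edges ↔ f ∈ q.edges

/-- `G` arises from the undirected graph `H` by giving a direction to each edge
(in particular `G` has no loops and no pair of opposite arcs). -/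
def IsOrientationOf {V : Type*} (G : Digraph V) (H : SimpleGraph V) : Prop :=
  (∀ u v, H.Adj u v ↔ (G.Adj u v ∨ G.Adj v u)) ∧ ∀ u v, G.Adj u v → ¬ G.Adj v u

/-- A directed cactus graph is an orientation of an undirected cactus graph. -/
def IsDirectedCactus {V : Type*} (G : Digraph V) : Prop :=
  ∃ H : SimpleGraph V, IsCactus H ∧ IsOrientationOf G H

/-! ### The Shortest Path Game and its subgame perfect equilibrium path -/

/-- An instance of the game on the vertices `0, …, n - 1`; only the costs of arcs matter. -/
structure Game (n : ℕ) where
  graph : Digraph (Fin n)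
  cost : Fin n → Fin n → ℝ
  s : Fin n
  t : Fin n

namespace Game

variable {n : ℕ}

/-- A complete play: a walk along arcs from `s` to `t` which stops as soon as `t` is reached and
contains no closed walk of even length (a vertex seen at times `i < j` has `j - i` odd). -/
structure IsPlay (I : Game n) (p : List (Fin n)) : Prop where
  head : p.head? = some I.s
  last : p.getLast? = some I.t
  arcs : p.IsChain I.graph.Adj
  ends : I.t ∉ p.dropLast
  noEvenCycle : ∀ i j (hij : i < j) (hj : j < p.length), p[i] = p[j] → Odd (j - i)

/-- A position of the game (a node of the game tree), given by the vertices visited so far: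
it can still be completed to a play. -/
def IsPosition (I : Game n) (h : List (Fin n)) : Prop :=
  h ≠ [] ∧ ∃ p, I.IsPlay p ∧ h <+: p

/-- The move from the last vertex of `h` to `w` is permitted: after it the destination can still
be reached without ever creating a cycle of even length. -/
def IsLegalMove (I : Game n) (h : List (Fin n)) (w : Fin n) : Prop :=
  I.IsPosition (h ++ [w])

/-- Costs of going from `v` along the vertices of the list, the two players alternating:
the total paid by the player deciding in `v`, and the total paid by the other player. -/
def costs (I : Game n) : Fin n → List (Fin n) → ℝ × ℝ
  | _, [] => (0, 0)
  | v, w :: q => (I.cost v w + (I.costs w q).2, (I.costs w q).1)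

/-- What the player deciding in `v` minimizes lexicographically when choosing a move to `u` which
will be continued along `q`: first the own cost, then the cost of the other player, then the
number of `u`. -/
noncomputable def preference (I : Game n) (v u : Fin n) (q : List (Fin n)) :
    ℝ ×ₗ (ℝ ×ₗ Fin n) :=
  toLex ((I.costs v (u :: q)).1, toLex ((I.costs v (u :: q)).2, u))

/-- Backward induction in the game tree: `I.Outcome h q` says that from the position `h` the
players continue along the vertices `q` until they reach `t`. Here `out u` is the outcome of the
subgame which follows the move to `u`. -/
inductive Outcome (I : Game n) : List (Fin n) → List (Fin n) → Prop
  | finish (h : List (Fin n)) (hlast : h.getLast? = some I.t) : Outcome I h []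
  | move (h : List (Fin n)) (v w : Fin n) (out : Fin n → List (Fin n))
      (hlast : h.getLast? = some v) (hv : v ≠ I.t)
      (hout : ∀ u, I.IsLegalMove h u → Outcome I (h ++ [u]) (out u))
      (hw : I.IsLegalMove h w)
      (hbest : ∀ u, I.IsLegalMove h u → I.preference v w (out w) ≤ I.preference v u (out u)) :
      Outcome I h (w :: out w)

/-- The outcome of backward induction is unique. -/
theorem Outcome.unique {I : Game n} {h q q' : List (Fin n)}
    (H : I.Outcome h q) (H' : I.Outcome h q') : q = q' := by
  induction H generalizing q' with
  | finish h hlast =>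
    cases H' with
    | finish => rfl
    | move _ v w out hl hv => rw [hl] at hlast; exact absurd (Option.some.inj hlast) hv
  | move h v w out hl hv hout hw hbest ih =>
    cases H' with
    | finish _ hl' => rw [hl] at hl'; exact absurd (Option.some.inj hl') hv
    | move _ v' w' out' hl' hv' hout' hw' hbest' =>
      rw [hl] at hl'
      obtain rfl := Option.some.inj hl'
      have e : ∀ u, I.IsLegalMove h u → out u = out' u := fun u hu => ih u hu (hout' u hu)
      have h1 := hbest w' hw'
      have h2 := hbest' w hw
      rw [← e w hw, ← e w' hw'] at h2
      have h3 := le_antisymm h1 h2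
      have h4 : w = w' := congrArg (fun x => (ofLex (ofLex x).2).2) h3
      subst h4
      rw [e w hw]

/-- The path of the subgame perfect equilibrium, from `s` to `t`. -/
def IsSPEPath (I : Game n) (p : List (Fin n)) : Prop :=
  ∃ q, I.Outcome [I.s] q ∧ p = I.s :: q

end Game

/-! ### A random access machine with unit costs

The memory consists of registers and arrays for natural numbers (vertices, indices, counters),
and of registers and arrays for real numbers (costs). A program refers to finitely many registers
and arrays. Naturals can only be copied, incremented, decremented and compared, so that after `k`
steps no word exceeds the largest input word or program constant by more than `k`; reals can only
be copied, added and compared. -/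

/-- A memory configuration. -/
structure Memory where
  reg : ℕ → ℕ
  arr : ℕ → ℕ → ℕ
  num : ℕ → ℝ
  numArr : ℕ → ℕ → ℝ

/-- Elementary instructions. -/
inductive Instr
  /-- `reg i := k` -/
  | const (i k : ℕ)
  /-- `reg i := reg j` -/
  | copy (i j : ℕ)
  /-- `reg i := reg j + 1` -/
  | succ (i j : ℕ)
  /-- `reg i := reg j - 1`, and `0` if `reg j = 0` -/
  | pred (i j : ℕ)
  /-- `reg i := arr a (reg j)` -/
  | load (i a j : ℕ)
  /-- `arr a (reg j) := reg i` -/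
  | store (a j i : ℕ)
  /-- `num x := 0` -/
  | numZero (x : ℕ)
  /-- `num x := num y` -/
  | numCopy (x y : ℕ)
  /-- `num x := num y + num z` -/
  | numAdd (x y z : ℕ)
  /-- `num x := numArr a (reg j)` -/
  | numLoad (x a j : ℕ)
  /-- `numArr a (reg j) := num x` -/
  | numStore (a j x : ℕ)

/-- Elementary tests. -/
inductive Test
  /-- `reg i = reg j` -/
  | eq (i j : ℕ)
  /-- `reg i < reg j` -/
  | lt (i j : ℕ)
  /-- `num x < num y` -/
  | numLt (x y : ℕ)

/-- The effect of an instruction. -/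
noncomputable def Instr.apply (σ : Memory) : Instr → Memory
  | const i k => { σ with reg := Function.update σ.reg i k }
  | copy i j => { σ with reg := Function.update σ.reg i (σ.reg j) }
  | succ i j => { σ with reg := Function.update σ.reg i (σ.reg j + 1) }
  | pred i j => { σ with reg := Function.update σ.reg i (σ.reg j - 1) }
  | load i a j => { σ with reg := Function.update σ.reg i (σ.arr a (σ.reg j)) }
  | store a j i =>
      { σ with arr := Function.update σ.arr a (Function.update (σ.arr a) (σ.reg j) (σ.reg i)) }
  | numZero x => { σ with num := Function.update σ.num x 0 }
  | numCopy x y => { σ with num := Function.update σ.num x (σ.num y) }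
  | numAdd x y z => { σ with num := Function.update σ.num x (σ.num y + σ.num z) }
  | numLoad x a j => { σ with num := Function.update σ.num x (σ.numArr a (σ.reg j)) }
  | numStore a j x =>
      { σ with
        numArr := Function.update σ.numArr a (Function.update (σ.numArr a) (σ.reg j) (σ.num x)) }

/-- The test succeeds. -/
def Test.Holds (σ : Memory) : Test → Prop
  | eq i j => σ.reg i = σ.reg j
  | lt i j => σ.reg i < σ.reg j
  | numLt x y => σ.num x < σ.num y

/-- Programs: instructions, sequences, conditionals and while loops. -/
inductive Prog
  | skip
  | instr (c : Instr)
  | seq (P Q : Prog)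
  | cond (b : Test) (P Q : Prog)
  | loop (b : Test) (P : Prog)

/-- `Exec P σ τ k`: the program `P`, started in the memory `σ`, halts after `k` steps in the
memory `τ`. Each executed instruction and each evaluated test is one step. -/
inductive Exec : Prog → Memory → Memory → ℕ → Prop
  | skip (σ : Memory) : Exec Prog.skip σ σ 1
  | instr (c : Instr) (σ : Memory) : Exec (Prog.instr c) σ (c.apply σ) 1
  | seq {P Q : Prog} {σ τ ρ : Memory} {k l : ℕ} (h₁ : Exec P σ τ k) (h₂ : Exec Q τ ρ l) :
      Exec (Prog.seq P Q) σ ρ (k + l)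
  | condTrue {b : Test} {P Q : Prog} {σ τ : Memory} {k : ℕ} (hb : b.Holds σ)
      (h : Exec P σ τ k) : Exec (Prog.cond b P Q) σ τ (k + 1)
  | condFalse {b : Test} {P Q : Prog} {σ τ : Memory} {k : ℕ} (hb : ¬ b.Holds σ)
      (h : Exec Q σ τ k) : Exec (Prog.cond b P Q) σ τ (k + 1)
  | loopFalse {b : Test} {P : Prog} {σ : Memory} (hb : ¬ b.Holds σ) :
      Exec (Prog.loop b P) σ σ 1
  | loopTrue {b : Test} {P : Prog} {σ τ ρ : Memory} {k l : ℕ} (hb : b.Holds σ)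
      (h₁ : Exec P σ τ k) (h₂ : Exec (Prog.loop b P) τ ρ l) :
      Exec (Prog.loop b P) σ ρ (k + l + 1)

/-- Execution is deterministic. -/
theorem Exec.unique {P : Prog} {σ τ τ' : Memory} {k k' : ℕ}
    (H : Exec P σ τ k) (H' : Exec P σ τ' k') : τ = τ' ∧ k = k' := by
  induction H generalizing τ' k' with
  | skip => cases H'; exact ⟨rfl, rfl⟩
  | instr => cases H'; exact ⟨rfl, rfl⟩
  | seq _ _ ih₁ ih₂ =>
    cases H' with
    | seq g₁ g₂ =>
      obtain ⟨rfl, rfl⟩ := ih₁ g₁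
      obtain ⟨rfl, rfl⟩ := ih₂ g₂
      exact ⟨rfl, rfl⟩
  | condTrue hb _ ih =>
    cases H' with
    | condTrue _ g => obtain ⟨rfl, rfl⟩ := ih g; exact ⟨rfl, rfl⟩
    | condFalse hb' _ => exact absurd hb hb'
  | condFalse hb _ ih =>
    cases H' with
    | condTrue hb' _ => exact absurd hb' hb
    | condFalse _ g => obtain ⟨rfl, rfl⟩ := ih g; exact ⟨rfl, rfl⟩
  | loopFalse hb =>
    cases H' with
    | loopFalse => exact ⟨rfl, rfl⟩
    | loopTrue hb' _ _ => exact absurd hb' hb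
  | loopTrue hb _ _ ih₁ ih₂ =>
    cases H' with
    | loopFalse hb' => exact absurd hb hb'
    | loopTrue _ g₁ g₂ =>
      obtain ⟨rfl, rfl⟩ := ih₁ g₁
      obtain ⟨rfl, rfl⟩ := ih₂ g₂
      exact ⟨rfl, rfl⟩

/-! ### Input and output -/

/-- The list contains every arc of the graph exactly once, in an arbitrary order. -/
def ListsArcs {n : ℕ} (G : Digraph (Fin n)) (L : List (Fin n × Fin n)) : Prop :=
  L.Nodup ∧ ∀ a : Fin n × Fin n, a ∈ L ↔ G.Adj a.1 a.2

/-- The initial memory: registers `0` to `3` hold the number of vertices, `s`, `t` and the number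
of arcs; the `i`-th arc of the list has its tail in cell `i` of array `0`, its head in cell `i` of
array `1`, and its cost in cell `i` of real array `0`. All other cells are zero. -/
def input {n : ℕ} (I : Game n) (L : List (Fin n × Fin n)) : Memory where
  reg r := if r = 0 then n else if r = 1 then I.s else if r = 2 then I.t
    else if r = 3 then L.length else 0
  arr a i := if a = 0 then (L[i]?).elim 0 (fun e => (e.1 : ℕ))
    else if a = 1 then (L[i]?).elim 0 (fun e => (e.2 : ℕ)) else 0
  num _ := 0
  numArr a i := if a = 0 then (L[i]?).elim 0 (fun e => I.cost e.1 e.2) else 0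

/-- The output: a list of numbers whose length is in register `4` and whose entries are in the
first cells of array `2`. -/
def output (σ : Memory) : List ℕ :=
  (List.range (σ.reg 4)).map (σ.arr 2)

end ShortestPathGame

/-! A depth-first search from `s` ranks the vertices by finishing time. In a directed cactus an arc
which does not descend closes a directed cycle: the cycle descends from its top and returns to it by
this arc. The cactus property enters through `IsCactus.not_reachable`: two vertices of a cycle are
disconnected once the edges of the cycle are removed. Consequently every reachable vertex lies below
the top of at most one directed cycle, a cycle is entered only at its top, and where the descents to
`t` branch, none of the branches starts on a directed cycle below its top. These facts are collected
in `Layout` and proved in `Ranking.layout`.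

Without even closed walks no vertex is visited three times, since two odd gaps add up to an even one
(`not_noEven_three`). Call a vertex low if it descends to `t`. A play descends along low vertices,
interrupted by odd excursions of two kinds. A detour from `u` runs round a cycle with top `u` whose
first vertex is not low, and its vertices may have such detours themselves. Or the play goes round
the cycle on which `u` lies below the top `v`: it returns to `v` and is then forced to repeat its
way from `v` down to `u`. After a second visit of `u` only the descent remains. What matters about
the history is therefore bounded information: whether the current vertex is visited for the first or
the second time, whether its cycle may still be gone round, and the parity needed to come back to a
top. So finitely many table entries per vertex suffice, each a minimum over outgoing arcs of entries
computed before. Entries are lexicographic triples (own total, other total, next vertex), with `⊤`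
for an impossible continuation. Adding the totals of a fixed continuation preserves their order
(`Entry.after_mono`), so a way back to a top can be optimized without knowing what follows it.
Backward induction for a single position is `Tables.val_step`; `val_R`, `val_S`, `val_loop`,
`val_EU` and `val_EC` identify the values of all kinds of positions with table entries, and
`exists_outcome` shows that following the stored vertices, together with a mode remembered for each
visited vertex, produces the SPE-path.

For the running time, a cactus graph has at most `2 * n` edges (`IsCactus.ncard_edgeSet_le`), so the
search has at most `4 * n` events. Their order is a schedule (`Search.Inv.exists_schedule`) in which
every arc is scanned after its head is finished, except for the closing arcs of cycles. A pass in
this order computes the cycles and the tables for returns and detours, a pass in reverse order the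
totals on the ways down from the tops, and a third pass the remaining tables
(`Tables.valid_ofStore`). The final simulation (`simProg_triple`) makes fewer than `2 * n` moves by
`NoEven.length_le`. Every event and every move takes a bounded number of steps. The programs are
verified on a more abstract memory, in which an entry is a single value. -/

namespace ShortestPathGame

/-! ### Entries of the tables -/

/-- A table entry: `⊤` if there is no continuation, otherwise the total of the player to move,
the total of the other player, and the number of the next vertex, compared lexicographically. -/
abbrev Entry := WithTop (ℝ ×ₗ (ℝ ×ₗ ℕ))

namespace Entry

/-- The entry with the given components. -/
def mk (a b : ℝ) (v : ℕ) : Entry := ((toLex (a, toLex (b, v)) : ℝ ×ₗ (ℝ ×ₗ ℕ)) : WithTop _)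

theorem cases (e : Entry) : e = ⊤ ∨ ∃ a b v, e = mk a b v := by
  induction e using WithTop.recTopCoe with
  | top => exact Or.inl rfl
  | coe p => exact Or.inr ⟨(ofLex p).1, (ofLex (ofLex p).2).1, (ofLex (ofLex p).2).2, rfl⟩

/-- The two totals of an entry. -/
noncomputable def pay (e : Entry) : Option (ℝ × ℝ) :=
  WithTop.recTopCoe none (fun p => some ((ofLex p).1, (ofLex (ofLex p).2).1)) e

/-- The vertex of an entry, `0` if there is none. -/
noncomputable def vert (e : Entry) : ℕ :=
  WithTop.recTopCoe 0 (fun p => (ofLex (ofLex p).2).2) e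

@[simp] theorem pay_top : pay ⊤ = none := rfl
@[simp] theorem pay_mk (a b : ℝ) (v : ℕ) : pay (mk a b v) = some (a, b) := rfl
@[simp] theorem vert_top : vert ⊤ = 0 := rfl
@[simp] theorem vert_mk (a b : ℝ) (v : ℕ) : vert (mk a b v) = v := rfl
@[simp] theorem mk_ne_top (a b : ℝ) (v : ℕ) : mk a b v ≠ ⊤ := WithTop.coe_ne_top

theorem mk_le_mk {a b a' b' : ℝ} {v v' : ℕ} :
    mk a b v ≤ mk a' b' v' ↔ a < a' ∨ a = a' ∧ (b < b' ∨ b = b' ∧ v ≤ v') := by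
  unfold mk
  rw [WithTop.coe_le_coe, Prod.Lex.toLex_le_toLex, Prod.Lex.toLex_le_toLex]

theorem pay_eq_none {e : Entry} : e.pay = none ↔ e = ⊤ := by
  rcases cases e with rfl | ⟨a, b, v, rfl⟩ <;> simp

/-- Moving to `v` at cost `c`, where the other player then has the totals `o`. -/
noncomputable def go (c : ℝ) (v : ℕ) (o : Option (ℝ × ℝ)) : Entry :=
  o.elim ⊤ fun p => mk (c + p.2) p.1 v

@[simp] theorem go_none (c : ℝ) (v : ℕ) : go c v none = ⊤ := rfl
@[simp] theorem go_some (c : ℝ) (v : ℕ) (p : ℝ × ℝ) : go c v (some p) = mk (c + p.2) p.1 v := rfl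

theorem go_eq_top {c : ℝ} {v : ℕ} {o : Option (ℝ × ℝ)} : go c v o = ⊤ ↔ o = none := by
  cases o <;> simp

/-- The entry `e` followed by totals `y`, where the players have changed roles if `b`. -/
noncomputable def after (b : Bool) (e : Entry) (y : Option (ℝ × ℝ)) : Entry :=
  WithTop.recTopCoe ⊤ (fun p => y.elim ⊤ fun q =>
    mk ((ofLex p).1 + if b then q.2 else q.1)
      ((ofLex (ofLex p).2).1 + if b then q.1 else q.2) (ofLex (ofLex p).2).2) e

@[simp] theorem after_top (b : Bool) (y : Option (ℝ × ℝ)) : after b ⊤ y = ⊤ := rfl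
@[simp] theorem after_none (b : Bool) (e : Entry) : after b e none = ⊤ := by
  rcases cases e with rfl | ⟨a, b, v, rfl⟩ <;> rfl
@[simp] theorem after_mk (b : Bool) (x z : ℝ) (v : ℕ) (q : ℝ × ℝ) :
    after b (mk x z v) (some q) =
      mk (x + if b then q.2 else q.1) (z + if b then q.1 else q.2) v := rfl

/-- The move to `v` hands the decision to the other player, so the roles in what follows are
exchanged once more. -/
theorem go_after (c : ℝ) (v : ℕ) (b : Bool) (e : Entry) (y : Option (ℝ × ℝ)) :
    go c v (after b e y).pay = after (!b) (go c v e.pay) y := by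
  rcases cases e with rfl | ⟨a, d, w, rfl⟩
  · simp
  · cases y with
    | none => simp
    | some q => cases b <;> simp [add_assoc]

theorem after_after (b₁ b₂ : Bool) (d g : Entry) (y : Option (ℝ × ℝ)) :
    after b₁ d (after b₂ g y).pay = after (xor b₁ b₂) (after b₁ d g.pay) y := by
  rcases cases d with rfl | ⟨a, a', w, rfl⟩
  · simp
  rcases cases g with rfl | ⟨c, c', w', rfl⟩
  · simp
  cases y with
  | none => simp
  | some q => cases b₁ <;> cases b₂ <;> simp [add_assoc]

/-- The continuation adds the same two numbers to every alternative, which keeps the lexicographic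
order. This is why the best way back to a top does not depend on what follows it. -/
theorem after_mono {e e' : Entry} (b : Bool) (y : Option (ℝ × ℝ)) (h : e ≤ e') :
    after b e y ≤ after b e' y := by
  rcases cases e' with rfl | ⟨a', b', v', rfl⟩
  · simp
  rcases cases e with rfl | ⟨a, d, v, rfl⟩
  · simp at h
  cases y with
  | none => simp
  | some q =>
    rw [mk_le_mk] at h
    rw [after_mk, after_mk, mk_le_mk]
    rcases h with h | ⟨rfl, h | ⟨rfl, h⟩⟩
    · exact Or.inl (by linarith)
    · exact Or.inr ⟨rfl, Or.inl (by linarith)⟩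
    · exact Or.inr ⟨rfl, Or.inr ⟨rfl, h⟩⟩

theorem after_min (b : Bool) (e e' : Entry) (y : Option (ℝ × ℝ)) :
    after b (min e e') y = min (after b e y) (after b e' y) :=
  Monotone.map_min (f := fun x => after b x y) fun _ _ h => after_mono b y h

theorem pay_after_zero (v : ℕ) (y : Option (ℝ × ℝ)) : (after false (mk 0 0 v) y).pay = y := by
  cases y <;> simp

/-- What follows an excursion changes the totals but never the chosen vertex, so the simulation may
read the choice from the table. -/
theorem vert_after {b : Bool} {e : Entry} {y : Option (ℝ × ℝ)} (h : after b e y ≠ ⊤) :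
    (after b e y).vert = e.vert := by
  rcases cases e with rfl | ⟨a, d, v, rfl⟩
  · simp at h
  · cases y with
    | none => simp at h
    | some q => simp

theorem vert_go {c : ℝ} {v : ℕ} {o : Option (ℝ × ℝ)} (h : go c v o ≠ ⊤) : (go c v o).vert = v := by
  cases o <;> simp_all

end Entry

end ShortestPathGame

/-! ### Walks to the target in a ranked directed cactus graph -/

namespace ShortestPathGame

/-! ### Layouts of directed cactus graphs -/

/-- The vertices which can be reached from the start. -/
def Game.Reach {n : ℕ} (I : Game n) (u : Fin n) : Prop := Relation.ReflTransGen I.graph.Adj I.s u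

/-- A ranking of the vertices together with the directed cycles: along each directed cycle the
ranks decrease from its top, `top u` is the top of the cycle which contains `u` as another vertex,
and `suc u` the successor of `u` on this cycle. The vertices with `low u` can reach `t` along
decreasing ranks. -/
structure Layout {n : ℕ} (I : Game n) where
  rank : Fin n → ℕ
  top : Fin n → Option (Fin n)
  suc : Fin n → Fin n
  low : Fin n → Prop
  suc_spec : ∀ {u v}, top u = some v → rank u < rank v ∧ I.graph.Adj u (suc u) ∧
    (suc u = v ∨ (rank (suc u) < rank u ∧ top (suc u) = some v))
  arc : ∀ {u w}, I.Reach u → I.graph.Adj u w → (top u ≠ none ∧ w = suc u) ∨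
    (rank w < rank u ∧ top w = some u) ∨ (rank w < rank u ∧ top w = none)
  arc_in : ∀ {x p q}, top x ≠ none → I.Reach p → I.Reach q → I.graph.Adj p x → I.graph.Adj q x →
    rank x < rank p → rank x < rank q → p = q
  exists_in : ∀ {x}, I.Reach x → x ≠ I.s → ∃ p, I.Reach p ∧ I.graph.Adj p x ∧ rank x < rank p
  -- By symmetry neither `w` nor `w'` has a top: where routes to `t` branch, none of them starts on
  -- a cycle below its top.
  route : ∀ {u w w'}, I.Reach u → I.graph.Adj u w → I.graph.Adj u w' → w ≠ w' →
    rank w < rank u → rank w' < rank u → low w → low w' → top w = none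
  low_iff : ∀ {u}, I.Reach u →
    (low u ↔ u = I.t ∨ ∃ w, I.graph.Adj u w ∧ rank w < rank u ∧ low w)
  top_reach : ∀ {u v}, I.Reach u → top u = some v → I.Reach v

namespace Layout

variable {n : ℕ} {I : Game n} (F : Layout I)

theorem _root_.ShortestPathGame.Game.Reach.tail {u w : Fin n} (h : I.Reach u)
    (a : I.graph.Adj u w) : I.Reach w := Relation.ReflTransGen.tail h a

/-- A reachable vertex of maximal rank above `s` would have, by `exists_in`, a predecessor of still
larger rank. -/
theorem rank_le_start {u : Fin n} (hu : I.Reach u) : F.rank u ≤ F.rank I.s := by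
  by_contra hlt
  push Not at hlt
  obtain ⟨m, hm, hmax⟩ : ∃ m, (I.Reach m ∧ F.rank I.s < F.rank m) ∧
      ∀ x, I.Reach x ∧ F.rank I.s < F.rank x → F.rank x ≤ F.rank m := by
    classical
    obtain ⟨m, hm, hmax⟩ := Finset.exists_max_image
      (Finset.univ.filter fun x => I.Reach x ∧ F.rank I.s < F.rank x) F.rank ⟨u, by simp [hu, hlt]⟩
    exact ⟨m, by simpa using hm, fun x hx => hmax x (by simpa using hx)⟩
  obtain ⟨p, hp, -, hr⟩ := F.exists_in hm.1 (by rintro rfl; exact absurd hm.2 (lt_irrefl _))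
  have := hmax p ⟨hp, hm.2.trans hr⟩
  omega

theorem top_start : F.top I.s = none := by
  cases h : F.top I.s with
  | none => rfl
  | some v =>
    have h1 := F.rank_le_start (F.top_reach Relation.ReflTransGen.refl h)
    have h2 := (F.suc_spec h).1
    omega

theorem ne_start {u v : Fin n} (h : F.top u = some v) : u ≠ I.s := by
  rintro rfl
  rw [F.top_start] at h
  cases h

/-- Descending from a low vertex ends in `t`, so no low vertex has smaller rank than `t`. In
particular no route starts at `t`. -/
theorem rank_target {u w : Fin n} (hr : F.rank w < F.rank u) (hw : I.Reach w) (h : F.low w) :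
    u ≠ I.t := by
  have key : ∀ k w, F.rank w = k → I.Reach w → F.low w → F.rank I.t ≤ k := by
    intro k
    induction k using Nat.strong_induction_on with
    | _ k ih =>
      intro w hk hw h
      rcases (F.low_iff hw).1 h with rfl | ⟨x, ha, hx, hl⟩
      · exact hk.le
      · have := ih _ (hk ▸ hx) x rfl (hw.tail ha) hl
        omega
  rintro rfl
  have := key _ w rfl hw h
  omega

/-- A walk to the target either descends, or passes through the top. -/
theorem low_or_top : ∀ (q : List (Fin n)) (w : Fin n), I.Reach w → (w :: q).IsChain I.graph.Adj →
    (w :: q).getLast? = some I.t → F.low w ∨ ∃ v, F.top w = some v ∧ v ∈ q := by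
  intro q
  induction hk : q.length using Nat.strong_induction_on generalizing q with
  | _ k ih =>
    subst hk
    intro w hw hc hl
    match q with
    | [] =>
      left
      simp at hl
      exact (F.low_iff hw).2 (Or.inl hl)
    | x :: q =>
      rw [List.isChain_cons_cons] at hc
      rw [List.getLast?_cons_cons] at hl
      have hx : I.Reach x := hw.tail hc.1
      have IH := ih q.length (by simp) q rfl x hx hc.2 hl
      rcases F.arc hw hc.1 with ⟨ht, rfl⟩ | ⟨hr, ht⟩ | ⟨hr, ht⟩
      · obtain ⟨v, hv⟩ := Option.ne_none_iff_exists'.1 ht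
        rcases F.suc_spec hv with ⟨-, -, h | ⟨h1, h2⟩⟩
        · exact Or.inr ⟨v, hv, by simp [h]⟩
        · rcases IH with h | ⟨v', h, h'⟩
          · exact Or.inl ((F.low_iff hw).2 (Or.inr ⟨_, hc.1, h1, h⟩))
          · rw [h2] at h
            cases h
            exact Or.inr ⟨v, hv, by simp [h']⟩
      · rcases IH with h | ⟨v', h, h'⟩
        · exact Or.inl ((F.low_iff hw).2 (Or.inr ⟨_, hc.1, hr, h⟩))
        · rw [ht] at h
          cases h
          -- The walk comes back to `w` from a cycle with top `w`; the induction hypothesis applies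
          -- to the part after this visit.
          obtain ⟨a, b, rfl⟩ := List.append_of_mem h'
          have hc' : (w :: b).IsChain I.graph.Adj :=
            hc.2.suffix ⟨x :: a, by simp⟩
          have hl' : (w :: b).getLast? = some I.t := by
            rw [← hl, ← List.cons_append, List.getLast?_append]
            simp [List.getLast?_cons]
          rcases ih b.length (by simp; omega) b rfl w hw hc' hl' with h | ⟨v, h, h''⟩
          · exact Or.inl h
          · exact Or.inr ⟨v, h, by simp [h'']⟩
      · rcases IH with h | ⟨v', h, h'⟩
        · exact Or.inl ((F.low_iff hw).2 (Or.inr ⟨_, hc.1, hr, h⟩))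
        · rw [ht] at h
          cases h

/-- A walk to a vertex of higher rank starts on a cycle, not at its top. -/
theorem top_of_rank_lt : ∀ (q : List (Fin n)) (w z : Fin n), I.Reach w →
    (w :: q).IsChain I.graph.Adj → z ∈ q → F.rank w < F.rank z →
    ∃ v, F.top w = some v := by
  -- For the induction `z` is the last vertex and the top is found on the walk. The rank grows only
  -- along the closing arc of a cycle, which leads to the top.
  have key : ∀ (q : List (Fin n)) (w z : Fin n), I.Reach w →
    (w :: q).IsChain I.graph.Adj → (w :: q).getLast? = some z → F.rank w < F.rank z →
    ∃ v, F.top w = some v ∧ v ∈ q := by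
    intro q
    induction hk : q.length using Nat.strong_induction_on generalizing q with
    | _ k ih =>
      subst hk
      intro w z hw hc hl hz
      match q with
      | [] => simp at hl; subst hl; exact absurd hz (lt_irrefl _)
      | x :: q =>
        rw [List.isChain_cons_cons] at hc
        rw [List.getLast?_cons_cons] at hl
        have hx : I.Reach x := hw.tail hc.1
        have IH := ih q.length (by simp) q rfl x z hx hc.2 hl
        rcases F.arc hw hc.1 with ⟨ht, rfl⟩ | ⟨hr, ht⟩ | ⟨hr, ht⟩
        · obtain ⟨v, hv⟩ := Option.ne_none_iff_exists'.1 ht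
          rcases F.suc_spec hv with ⟨-, -, h | ⟨h1, h2⟩⟩
          · exact ⟨v, hv, by simp [h]⟩
          · obtain ⟨v', h, h'⟩ := IH (by omega)
            rw [h2] at h
            cases h
            exact ⟨v, hv, by simp [h']⟩
        · obtain ⟨v', h, h'⟩ := IH (by omega)
          rw [ht] at h
          cases h
          obtain ⟨a, b, rfl⟩ := List.append_of_mem h'
          have hc' : (w :: b).IsChain I.graph.Adj :=
            hc.2.suffix ⟨x :: a, by simp⟩
          have hl' : (w :: b).getLast? = some z := by
            rw [← hl, ← List.cons_append, List.getLast?_append]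
            simp [List.getLast?_cons]
          obtain ⟨v, h, h''⟩ := ih b.length (by simp; omega) b rfl w z hw hc' hl' hz
          exact ⟨v, h, by simp [h'']⟩
        · obtain ⟨v', h, h'⟩ := IH (by omega)
          rw [ht] at h
          cases h
  intro q w z hw hc hz hr
  obtain ⟨a, b, rfl⟩ := List.append_of_mem hz
  obtain ⟨v, h, -⟩ := key (a ++ [z]) w z hw (hc.prefix ⟨b, by simp⟩)
    (by rw [← List.cons_append, List.getLast?_append]; simp) hr
  exact ⟨v, h⟩

theorem reach_of_chain : ∀ (q : List (Fin n)) (w : Fin n), I.Reach w →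
    (w :: q).IsChain I.graph.Adj → ∀ x ∈ w :: q, I.Reach x := by
  intro q
  induction q with
  | nil => intro w hw _ x hx; simp at hx; exact hx ▸ hw
  | cons y q ih =>
    intro w hw hc x hx
    rw [List.isChain_cons_cons] at hc
    rcases List.mem_cons.1 hx with rfl | hx
    · exact hw
    · exact ih y (hw.tail hc.1) hc.2 x hx

theorem reach_of_mem {g : List (Fin n)} (hh : g.head? = some I.s) (hc : g.IsChain I.graph.Adj)
    {x : Fin n} (hx : x ∈ g) : I.Reach x := by
  match g with
  | [] => simp at hx
  | y :: g =>
    simp at hh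
    subst hh
    exact reach_of_chain g I.s Relation.ReflTransGen.refl hc x hx

/-- Each cycle is entered at its top. -/
theorem top_mem : ∀ (g : List (Fin n)) (q x : Fin n), g.head? = some I.s →
    g.IsChain I.graph.Adj → g.getLast? = some q → F.top q = some x → x ∈ g := by
  intro g
  induction hk : g.length using Nat.strong_induction_on generalizing g with
  | _ k ih =>
    subst hk
    intro q x hh hc hl ht
    rcases List.eq_nil_or_concat g with rfl | ⟨g', q', rfl⟩
    · simp at hh
    simp at hl
    subst hl
    rcases List.eq_nil_or_concat g' with rfl | ⟨g'', r, rfl⟩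
    · simp at hh
      subst hh
      rw [F.top_start] at ht
      cases ht
    have hc' : (g'' ++ [r]).IsChain I.graph.Adj := hc.prefix ⟨[q'], by simp⟩
    have hh' : (g'' ++ [r]).head? = some I.s := by
      rw [← hh]; cases g'' <;> simp
    have ha : I.graph.Adj r q' := by
      have : ([r, q']).IsChain I.graph.Adj := hc.suffix ⟨g'', by simp⟩
      simpa using this
    have hr : I.Reach r := reach_of_mem hh' hc' (by simp)
    rcases F.arc hr ha with ⟨htr, rfl⟩ | ⟨-, h⟩ | ⟨-, h⟩
    · obtain ⟨v, hv⟩ := Option.ne_none_iff_exists'.1 htr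
      have hmem := ih _ (by simp) (g'' ++ [r]) rfl r v hh' hc' (by simp) hv
      rcases F.suc_spec hv with ⟨h1, -, h | ⟨h2, h3⟩⟩
      · rw [h] at ht
        -- The walk closes a cycle at its top `v`, which it has met before; the top `x` of `v` lies
        -- already on the walk up to that earlier visit.
        obtain ⟨a, b, hab⟩ := List.append_of_mem hmem
        have := ih (a ++ [v]).length (by
            have := congrArg List.length hab
            simp at this ⊢; omega) (a ++ [v]) rfl v x
          (by rw [← hh', hab]; cases a <;> simp)
          (hc'.prefix ⟨b, by simp [hab]⟩) (by simp) ht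
        have h4 : x ∈ g'' ++ [r] := by
          rw [hab]
          simp at this ⊢
          tauto
        simp at h4 ⊢
        tauto
      · rw [h3] at ht
        cases ht
        simp at hmem ⊢
        tauto
    · rw [h] at ht
      cases ht
      simp
    · rw [h] at ht
      cases ht

/-- The first visit of a vertex on a cycle, other than the top, is along the cycle. -/
theorem first_visit {h : List (Fin n)} (hh : h.head? = some I.s) (hc : h.IsChain I.graph.Adj)
    {u w : Fin n} (hw : w ∈ h) (hu : I.Reach u) (ha : I.graph.Adj u w) (hr : F.rank w < F.rank u)
    (ht : F.top w ≠ none) : ∃ g g', h = g ++ u :: w :: g' := by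
  obtain ⟨g₁, g', rfl, hn⟩ := List.eq_append_cons_of_mem hw
  rcases List.eq_nil_or_concat g₁ with rfl | ⟨g, q, rfl⟩
  · simp at hh
    obtain ⟨v, hv⟩ := Option.ne_none_iff_exists'.1 ht
    exact absurd hh (F.ne_start hv)
  have hc' : (g ++ [q]).IsChain I.graph.Adj := hc.prefix ⟨w :: g', by simp⟩
  have hh' : (g ++ [q]).head? = some I.s := by
    rw [← hh]; cases g <;> simp
  have hq : I.Reach q := reach_of_mem hh' hc' (by simp)
  have haq : I.graph.Adj q w := by
    have : ([q, w]).IsChain I.graph.Adj := hc.infix ⟨g, g', by simp⟩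
    simpa using this
  -- An ascending arc into `w` would close a cycle with top `w`. By `top_mem` the walk would have
  -- met `w` before, contrary to the choice of the first occurrence.
  have hqu : F.rank w < F.rank q := by
    rcases F.arc hq haq with ⟨htr, h⟩ | ⟨h, -⟩ | ⟨h, -⟩
    · obtain ⟨v, hv⟩ := Option.ne_none_iff_exists'.1 htr
      rcases F.suc_spec hv with ⟨h1, -, h' | ⟨h2, h3⟩⟩
      · have := F.top_mem _ q v hh' hc' (by simp) hv
        rw [← h', ← h] at this
        exact absurd (by simpa using this) hn
      · rw [h]; exact h2
    · exact h
    · exact h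
  have := F.arc_in ht hq hu haq ha hqu hr
  subst this
  exact ⟨g, g', by simp⟩

/-- One step along the part of a cycle with top `v` through which plays have to pass. -/
def Step (v a b : Fin n) : Prop :=
  I.graph.Adj a b ∧ F.rank b < F.rank a ∧ F.low b ∧ F.top b = some v

/-- Going backwards from `u` along descending arcs: the predecessor is low because it descends
through `u`, and it is the top or lies on the same cycle. The ranks increase and are bounded by the
rank of `s`. -/
theorem steps_of_top {u v : Fin n} (hu : I.Reach u) (hl : F.low u) (ht : F.top u = some v) :
    Relation.ReflTransGen (F.Step v) v u := by
  induction hk : F.rank I.s - F.rank u using Nat.strong_induction_on generalizing u with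
  | _ k ih =>
    obtain ⟨p, hp, ha, hr⟩ := F.exists_in hu (F.ne_start ht)
    have hs : F.Step v p u := ⟨ha, hr, hl, ht⟩
    have hps := F.rank_le_start hp
    rcases F.arc hp ha with ⟨htr, h⟩ | ⟨-, h⟩ | ⟨-, h⟩
    · obtain ⟨v', hv⟩ := Option.ne_none_iff_exists'.1 htr
      rcases F.suc_spec hv with ⟨h1, -, h' | ⟨h2, h3⟩⟩
      · rw [← h', ← h] at h1; omega
      · rw [← h, ht] at h3
        cases h3
        exact (ih _ (by omega) hp ((F.low_iff hp).2 (Or.inr ⟨u, ha, hr, hl⟩)) hv rfl).tail hs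
    · rw [ht] at h
      cases h
      exact Relation.ReflTransGen.single hs
    · rw [ht] at h; cases h

/-- At `y` the next vertex `y₁` of the chain is the only low vertex to which `y` descends. If the
walk goes elsewhere, it has to come back to `y`, either from a cycle with top `y` or through the top
of the cycle of `y`. Induction on the rest of the walk applies in both cases. -/
theorem mem_of_steps : ∀ (q : List (Fin n)) (v y u : Fin n), I.Reach y → I.Reach v →
    (y :: q).IsChain I.graph.Adj → (y :: q).getLast? = some I.t →
    (y = v ∨ F.top y = some v) → Relation.ReflTransGen (F.Step v) y u → F.low u →
    u ∈ y :: q := by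
  intro q
  induction hk : q.length using Nat.strong_induction_on generalizing q with
  | _ k ih =>
    subst hk
    intro v y u hy hvr hc hl hyv hs hlu
    rcases Relation.ReflTransGen.cases_head hs with rfl | ⟨y₁, hs₁, hs₂⟩
    · simp
    have hrec : ∀ v y u : Fin n, I.Reach y → I.Reach v → y ∈ q →
        (y = v ∨ F.top y = some v) → Relation.ReflTransGen (F.Step v) y u → F.low u → u ∈ q := by
      intro v' y' u' hy' hv' hm h1 h2 h3
      obtain ⟨a, b, rfl⟩ := List.append_of_mem hm
      have := ih b.length (by simp; omega) b rfl v' y' u' hy' hv' (hc.suffix ⟨y :: a, by simp⟩)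
        (by
          rw [← hl, ← List.cons_append, List.getLast?_append]
          simp [List.getLast?_cons]) h1 h2 h3
      simp at this ⊢
      tauto
    match q, hrec with
    | [], _ =>
      simp at hl
      subst hl
      exact absurd rfl (F.rank_target hs₁.2.1 (hy.tail hs₁.1) hs₁.2.2.1)
    | x :: q, hrec =>
      rw [List.isChain_cons_cons] at hc
      rw [List.getLast?_cons_cons] at hl
      have hx : I.Reach x := hy.tail hc.1
      by_cases hxy : x = y₁
      · subst hxy
        exact List.mem_cons_of_mem _ (hrec v x u hx hvr (by simp) (Or.inr hs₁.2.2.2) hs₂ hlu)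
      have hnl : F.rank x < F.rank y → ¬ F.low x := by
        intro hr hlx
        have := F.route hy hs₁.1 hc.1 (Ne.symm hxy) hs₁.2.1 hr hs₁.2.2.1 hlx
        rw [hs₁.2.2.2] at this
        cases this
      have hback := F.low_or_top q x hx hc.2 hl
      have hy₁ : I.Reach y₁ := hy.tail hs₁.1
      have hly : F.low y := (F.low_iff hy).2 (Or.inr ⟨_, hs₁.1, hs₁.2.1, hs₁.2.2.1⟩)
      rcases F.arc hy hc.1 with ⟨htr, h⟩ | ⟨hr, ht⟩ | ⟨hr, ht⟩
      · obtain ⟨z, hz⟩ := Option.ne_none_iff_exists'.1 htr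
        have hzr := F.top_reach hy hz
        have hzq : z ∈ x :: q := by
          rcases F.suc_spec hz with ⟨-, -, h1 | ⟨h1, h2⟩⟩
          · rw [← h] at h1; simp [h1]
          · rw [← h] at h1 h2
            rcases hback with h3 | ⟨v', h3, h4⟩
            · exact absurd h3 (hnl h1)
            · rw [h2] at h3; cases h3; simp [h4]
        -- The walk has climbed to the top `z` of the cycle of `y`; from there it must pass the low
        -- vertex `y` again.
        have hyq : y ∈ x :: q := hrec z z y hzr hzr hzq (Or.inl rfl) (F.steps_of_top hy hly hz) hly
        exact List.mem_cons_of_mem _ (hrec v y u hy hvr hyq hyv hs hlu)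
      · rcases hback with h3 | ⟨v', h3, h4⟩
        · exact absurd h3 (hnl hr)
        · rw [ht] at h3
          cases h3
          exact List.mem_cons_of_mem _ (hrec v y u hy hvr (by simp [h4]) hyv hs hlu)
      · rcases hback with h3 | ⟨v', h3, h4⟩
        · exact absurd h3 (hnl hr)
        · rw [ht] at h3; cases h3

/-- A walk from the top of a cycle to the target visits all vertices `u` of the cycle with
`F.low u`. -/
theorem low_mem {q : List (Fin n)} {u v : Fin n} (hv : I.Reach v) (hu : I.Reach u)
    (hc : (v :: q).IsChain I.graph.Adj)
    (hl : (v :: q).getLast? = some I.t) (ht : F.top u = some v) (hlu : F.low u) : u ∈ q := by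
  have h1 := F.mem_of_steps q v v u hv hv hc hl (Or.inl rfl) (F.steps_of_top hu hlu ht) hlu
  rcases List.mem_cons.1 h1 with h2 | h2
  · subst h2
    have := (F.suc_spec ht).1
    omega
  · exact h2

end Layout
end ShortestPathGame

/-! ### Odd returns, the equations of the tables, and backward induction -/

namespace ShortestPathGame

/-! ### Walks without even closed subwalks -/

/-- Between two visits of a vertex there is an odd number of steps. -/
def NoEven {α : Type*} (p : List α) : Prop :=
  ∀ i j (hij : i < j) (hj : j < p.length), p[i] = p[j] → Odd (j - i)

section NoEven

variable {α : Type*}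

theorem NoEven.prefix {p q : List α} (h : NoEven (p ++ q)) : NoEven p := by
  intro i j hij hj he
  refine h i j hij (by simp; omega) ?_
  rw [List.getElem_append_left (by omega), List.getElem_append_left (by omega)]
  exact he

theorem NoEven.append_new {p : List α} {w : α} (h : NoEven p) (hw : w ∉ p) : NoEven (p ++ [w]) := by
  intro i j hij hj he
  simp at hj
  rw [List.getElem_append_left (by omega)] at he
  by_cases hjp : j < p.length
  · rw [List.getElem_append_left (by omega)] at he
    exact h i j hij hjp he
  · rw [List.getElem_append_right (by omega)] at he
    simp at he
    exact absurd (he ▸ List.getElem_mem _) hw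

theorem NoEven.odd {a b c : List α} {v : α} (h : NoEven (a ++ v :: (b ++ v :: c))) :
    Odd (b.length + 1) := by
  have := h a.length (a.length + 1 + b.length) (by omega) (by simp; omega) (by
    rw [List.getElem_append_right (by omega), List.getElem_append_right (by omega)]
    simp
    simp only [Nat.add_assoc, Nat.add_sub_cancel_left, Nat.add_comm 1]
    simp)
  rwa [show a.length + 1 + b.length - a.length = b.length + 1 by omega] at this

theorem NoEven.append_old {g g' : List α} {v : α} (h : NoEven (g ++ v :: g')) (h1 : v ∉ g)
    (h2 : v ∉ g') (ho : Odd (g'.length + 1)) : NoEven (g ++ v :: g' ++ [v]) := by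
  intro i j hij hj he
  have hj₁ : j < g.length + (g'.length + 1) + 1 := by simpa [Nat.add_assoc] using hj
  have hi₁ : i < (g ++ v :: g').length := by simp; omega
  rw [List.getElem_append_left (as := g ++ v :: g') (bs := [v]) hi₁] at he
  by_cases hjp : j < (g ++ v :: g').length
  · rw [List.getElem_append_left (as := g ++ v :: g') (bs := [v]) hjp] at he
    exact h i j hij hjp he
  · have hj' : j = g.length + (g'.length + 1) := by simp at hjp; omega
    rw [List.getElem_append_right (as := g ++ v :: g') (bs := [v]) (by omega)] at he
    simp only [List.getElem_singleton] at he
    have hi : i = g.length := by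
      rcases lt_trichotomy i g.length with hi | hi | hi
      · rw [List.getElem_append_left hi] at he
        exact absurd (he ▸ List.getElem_mem _) h1
      · exact hi
      · obtain ⟨k, hk⟩ : ∃ k, i - g.length = k + 1 := ⟨i - g.length - 1, by omega⟩
        rw [List.getElem_append_right (by omega)] at he
        simp only [hk, List.getElem_cons_succ] at he
        exact absurd (he ▸ List.getElem_mem _) h2
    subst hi hj'
    rwa [Nat.add_sub_cancel_left]

/-- The two odd gaps between three visits of `v` add up to an even one. -/
theorem not_noEven_three {a b c d : List α} {v : α} :
    ¬ NoEven (a ++ v :: (b ++ v :: (c ++ v :: d))) := by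
  intro h
  have h1 := h.odd
  have h2 : Odd (c.length + 1) := NoEven.odd (a := a ++ v :: b) (b := c) (c := d) (v := v)
    (by simpa using h)
  have h3 : Odd ((b ++ v :: c).length + 1) :=
    NoEven.odd (a := a) (b := b ++ v :: c) (c := d) (v := v) (by simpa using h)
  simp at h3
  grind

/-- The pair of a vertex and the parity of the time of its visit never repeats. -/
theorem NoEven.length_le [Fintype α] {p : List α} (h : NoEven p) :
    p.length ≤ 2 * Fintype.card α := by
  have hinj : Function.Injective (fun i : Fin p.length => (p[i], decide (Even (i : ℕ)))) := by
    have key : ∀ i j : Fin p.length, i < j → p[i] = p[j] →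
        decide (Even (i : ℕ)) ≠ decide (Even (j : ℕ)) := by
      intro i j hij he hd
      have := h i j hij j.2 he
      simp at hd
      have hij' : (i : ℕ) < j := hij
      have : (j : ℕ) = i + (j - i) := by omega
      grind
    intro i j he
    simp only [Prod.mk.injEq] at he
    rcases lt_trichotomy i j with hij | hij | hij
    · exact absurd he.2 (key i j hij he.1)
    · exact hij
    · exact absurd he.2.symm (key j i hij he.1.symm)
  have := Fintype.card_le_of_injective _ hinj
  simpa [mul_comm] using this

end NoEven

/-! ### Tables and the simulation of the players -/

/-- `e` is the least of the entries `c w` with `P w`, and `⊤` if there are none. -/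
def IsMin {n : ℕ} (P : Fin n → Prop) (c : Fin n → Entry) (e : Entry) : Prop :=
  (∀ w, P w → e ≤ c w) ∧ (e = ⊤ ∨ ∃ w, P w ∧ e = c w)

namespace Layout

variable {n : ℕ} {I : Game n} (F : Layout I)

/-- The arcs from the tops of the cycles which do not lead to the target in another way. -/
def Side (u w : Fin n) : Prop := I.graph.Adj u w ∧ F.top w = some u ∧ ¬ F.low w

/-- The arcs which lead downwards to the target. -/
def Route (u w : Fin n) : Prop := I.graph.Adj u w ∧ F.rank w < F.rank u ∧ F.low w

end Layout

/-- The tables with the optimal totals. For `R b u`, the walk returns to the top of the cycle of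
`u` after a number of steps which is odd if `b`; `det u` is for a detour from `u` back to `u`;
`S u` when `u` has been visited before; `EC u` and `EU u` at the first visit of `u`, where the walk
has come directly from the top of the cycle of `u` for `EC`, and where it cannot
go round this cycle for `EU`. The walk from this top directly to `u` has the totals `pa`, `pb` and
an odd length if `par`. -/
structure Tables {n : ℕ} (I : Game n) (F : Layout I) where
  R : Bool → Fin n → Entry
  det : Fin n → Entry
  S : Fin n → Entry
  EC : Fin n → Entry
  EU : Fin n → Entry
  rtC : Fin n → Entry
  rtU : Fin n → Entry
  loop : Fin n → Entry
  par : Fin n → Bool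
  pa : Fin n → ℝ
  pb : Fin n → ℝ

namespace Tables

variable {n : ℕ} {I : Game n} {F : Layout I} (T : Tables I F)

/-- The entry at the successor of `u`, to be reached with the parity `b` before the top. -/
noncomputable def next (b : Bool) (u : Fin n) : Entry :=
  if F.top u = some (F.suc u) then (if b then ⊤ else Entry.mk 0 0 0) else T.R b (F.suc u)

open Classical in
/-- The equations of the tables. -/
structure Valid : Prop where
  det : ∀ u, I.Reach u →
    IsMin (F.Side u) (fun w => Entry.go (I.cost u w) w (T.R false w).pay) (T.det u)
  -- The arc to the successor changes the parity still needed to `!b`. A detour before it is odd, so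
  -- together they leave the parity `b`; the detour also exchanges the players.
  R : ∀ u b, I.Reach u → F.top u ≠ none → T.R b u =
    min (Entry.go (I.cost u (F.suc u)) (F.suc u) (T.next (!b) u).pay)
      (Entry.after true (T.det u) (Entry.go (I.cost u (F.suc u)) (F.suc u) (T.next b u).pay).pay)
  S : ∀ u, I.Reach u → IsMin (F.Route u) (fun w => Entry.go (I.cost u w) w (T.EU w).pay) (T.S u)
  rtC : ∀ u, I.Reach u →
    IsMin (F.Route u) (fun w => Entry.go (I.cost u w) w (T.EC w).pay) (T.rtC u)
  rtU : ∀ u, I.Reach u → IsMin (F.Route u) (fun w => Entry.go (I.cost u w) w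
    (if F.top w = some u then T.EC w else T.EU w).pay) (T.rtU u)
  -- If `P` is the way from the top down to `u` and `r` the number of steps from the successor back
  -- to the top, then the closed walk has length `P.length + 1 + r`. It must be odd, so `r` has the
  -- parity `T.par u`. Then `P` is walked once more, which costs `pa` and `pb`.
  loop : ∀ u, I.Reach u → F.top u ≠ none → ¬ F.Route u (F.suc u) → T.loop u =
    Entry.go (I.cost u (F.suc u)) (F.suc u)
      (Entry.after (T.par u) (T.next (T.par u) u) (some (T.pa u, T.pb u))).pay
  loop_top : ∀ u, I.Reach u → (F.top u = none ∨ F.Route u (F.suc u)) → T.loop u = ⊤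
  EC : ∀ u, I.Reach u → T.EC u = min (min (T.rtC u) (Entry.after true (T.det u) (T.S u).pay))
    (min (Entry.after true (T.loop u) (T.S u).pay) (if u = I.t then Entry.mk 0 0 0 else ⊤))
  EU : ∀ u, I.Reach u → T.EU u = min (min (T.rtU u) (Entry.after true (T.det u) (T.S u).pay))
    (if u = I.t then Entry.mk 0 0 0 else ⊤)
  par_side : ∀ u w, I.Reach u → I.graph.Adj u w → F.rank w < F.rank u → F.top w = some u →
    T.par w = true ∧ T.pa w = I.cost u w ∧ T.pb w = 0
  par_step : ∀ u w v, I.Reach u → I.graph.Adj u w → F.rank w < F.rank u → F.top w = some v →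
    F.top u = some v → T.par w = !T.par u ∧
      T.pa w = (if T.par u then T.pa u else T.pa u + I.cost u w) ∧
      T.pb w = (if T.par u then T.pb u + I.cost u w else T.pb u)

/-- The state of the simulation: the mode in which each vertex was visited first (`0` if it has
not been visited), the current vertex, and whether it was visited before. -/
structure State (n : ℕ) where
  mode : Fin n → ℕ
  cur : Fin n
  sat : Bool

open Classical in
/-- The mode for a first visit of `x`. -/
noncomputable def newMode (σ : State n) (x : Fin n) : ℕ :=
  -- The modes 1, 2, 3 and 4 mean that the tables `EC`, `EU`, `R false` and `R true` govern the
  -- first visit.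
  if σ.sat then (if σ.mode σ.cur ≤ 2 then 2 else σ.mode σ.cur)
  else if σ.mode σ.cur = 1 then
    (if F.low x then 1 else if F.top x = some σ.cur then 3 else if T.par σ.cur then 4 else 3)
  else if σ.mode σ.cur = 2 then
    (if F.low x then (if F.top x = some σ.cur then 1 else 2) else 3)
  else if σ.mode σ.cur = 3 then (if F.top x = some σ.cur then 3 else 4)
  else 3

/-- The number of the vertex to which the players move. -/
noncomputable def decision (σ : State n) : ℕ :=
  if σ.sat then (if σ.mode σ.cur ≤ 2 then (T.S σ.cur).vert else F.suc σ.cur)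
  else if σ.mode σ.cur = 1 then (T.EC σ.cur).vert
  else if σ.mode σ.cur = 2 then (T.EU σ.cur).vert
  else if σ.mode σ.cur = 3 then (T.R false σ.cur).vert
  else (T.R true σ.cur).vert

/-- The state after a move to `x`. -/
noncomputable def step (σ : State n) (x : Fin n) : State n where
  mode := if σ.mode x = 0 then Function.update σ.mode x (T.newMode σ x) else σ.mode
  cur := x
  sat := σ.mode x ≠ 0

/-- The state at the start. -/
def start (I : Game n) : State n := ⟨Function.update 0 I.s 1, I.s, false⟩

/-- The state after a history. -/
noncomputable def state (h : List (Fin n)) : State n := h.tail.foldl T.step (start I)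

/-- From `σ` the simulation continues along `q` and ends in the target. -/
def Sim : State n → List (Fin n) → Prop
  | σ, [] => σ.cur = I.t
  | σ, x :: q => σ.cur ≠ I.t ∧ T.decision σ = x ∧ Sim (T.step σ x) q

theorem state_append {h : List (Fin n)} (hh : h ≠ []) (w : Fin n) :
    T.state (h ++ [w]) = T.step (T.state h) w := by
  unfold state
  rw [List.tail_append_of_ne_nil hh, List.foldl_append]
  rfl

theorem newMode_ne_zero {σ : State n} (x : Fin n) (h : σ.mode σ.cur ≠ 0) : T.newMode σ x ≠ 0 := by
  unfold newMode
  split_ifs <;> omega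

theorem state_spec : ∀ (h : List (Fin n)), h.head? = some I.s →
    (∀ x, (T.state h).mode x ≠ 0 ↔ x ∈ h) ∧ h.getLast? = some (T.state h).cur ∧
      ((T.state h).sat = true ↔ (T.state h).cur ∈ h.dropLast) := by
  intro h
  induction h using List.reverseRecOn with
  | nil => intro hh; simp at hh
  | append_singleton h w ih =>
    intro hh
    by_cases hn : h = []
    · subst hn
      simp at hh
      subst hh
      simp [state, start, Function.update_apply]
    · have hh' : h.head? = some I.s := by
        rw [← hh]; cases h <;> simp_all
      obtain ⟨h1, h2, h3⟩ := ih hh'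
      rw [T.state_append hn]
      have hcur : (T.state h).mode (T.state h).cur ≠ 0 :=
        (h1 _).2 (List.mem_of_getLast? h2)
      refine ⟨fun x => ?_, by simp [step], by simp [step, ← h1]⟩
      simp only [step, List.mem_append, List.mem_singleton]
      by_cases hw : (T.state h).mode w = 0
      · simp only [hw, if_true, Function.update_apply]
        by_cases hx : x = w
        · subst hx; simp [T.newMode_ne_zero x hcur]
        · simp [hx, h1]
      · simp only [hw, if_false]
        rw [h1]
        have := (h1 w).1 hw
        constructor
        · exact Or.inl
        · rintro (h | rfl) <;> assumption

theorem mode_append {h : List (Fin n)} (hh : h.head? = some I.s) (r : List (Fin n)) {x : Fin n}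
    (hx : x ∈ h) : (T.state (h ++ r)).mode x = (T.state h).mode x := by
  induction r using List.reverseRecOn with
  | nil => simp
  | append_singleton r w ih =>
    have hne : h ++ r ≠ [] := by
      rintro h'; simp at h'; simp [h'.1] at hx
    have hh' : (h ++ r).head? = some I.s := by
      cases h <;> simp_all
    rw [← List.append_assoc, T.state_append hne]
    have hm := (T.state_spec (h ++ r) hh').1
    simp only [step]
    split_ifs with h0
    · rw [Function.update_of_ne, ih]
      rintro rfl
      exact (hm x).2 (by simp [hx]) h0
    · exact ih

theorem mode_new {h : List (Fin n)} (hh : h.head? = some I.s) {w : Fin n} (hw : w ∉ h) :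
    (T.state (h ++ [w])).mode w = T.newMode (T.state h) w := by
  have hne : h ≠ [] := by rintro rfl; simp at hh
  rw [T.state_append hne]
  have : (T.state h).mode w = 0 := by
    by_contra h0
    exact hw (((T.state_spec h hh).1 w).1 h0)
  simp [step, this]

end Tables

/-! ### Values of positions -/

namespace Tables

variable {n : ℕ} {I : Game n} {F : Layout I} (T : Tables I F)

/-- The totals in the position `h`, for the player to move and for the other player; `none` if `h`
is not a position. -/
def Val (h : List (Fin n)) : Option (ℝ × ℝ) → Prop
  | none => ∀ q, ¬ I.IsPlay (h ++ q)
  | some p => ∃ q u, I.IsPlay (h ++ q) ∧ I.Outcome h q ∧ h.getLast? = some u ∧ I.costs u q = p ∧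
      T.Sim (T.state h) q

theorem Val.unique {h : List (Fin n)} {o o' : Option (ℝ × ℝ)} (H : T.Val h o) (H' : T.Val h o') :
    o = o' := by
  cases o with
  | none =>
    cases o' with
    | none => rfl
    | some p => obtain ⟨q, u, h1, -⟩ := H'; exact absurd h1 (H q)
  | some p =>
    obtain ⟨q, u, h1, h2, h3, h4, -⟩ := H
    cases o' with
    | none => exact absurd h1 (H' q)
    | some p' =>
      obtain ⟨q', u', -, h2', h3', h4', -⟩ := H'
      rw [h3] at h3'
      cases h3'
      rw [h2.unique h2', h4'] at h4
      rw [h4]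

theorem last_adj {h q : List (Fin n)} {u w : Fin n} (hl : h.getLast? = some u)
    (hp : I.IsPlay (h ++ w :: q)) : I.graph.Adj u w := by
  have hc := hp.arcs
  obtain ⟨h', rfl⟩ := List.getLast?_eq_some_iff.1 hl
  have : [u, w].IsChain I.graph.Adj := hc.infix ⟨h', q, by simp⟩
  simpa using this

/-- One step of backward induction. All arcs from `u` may be taken into account instead of the legal
moves only, because an illegal move has the entry `⊤`. If `B` is not `⊤`, its third component is the
vertex which the tie-breaking rule selects. -/
theorem val_step {h : List (Fin n)} {u : Fin n} (hh : h.head? = some I.s)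
    (hl : h.getLast? = some u) (hu : u ≠ I.t)
    {B : Entry} (hB : ∀ w, I.graph.Adj u w → ∃ y, T.Val (h ++ [w]) y ∧
      B ≤ Entry.go (I.cost u w) w y)
    (hB' : B = ⊤ ∨ ∃ w y, I.graph.Adj u w ∧ T.Val (h ++ [w]) y ∧ B = Entry.go (I.cost u w) w y)
    (hd : B ≠ ⊤ → T.decision (T.state h) = B.vert) : T.Val h B.pay := by
  have hne : h ≠ [] := by rintro rfl; simp at hh
  have hcur : (T.state h).cur = u := by
    have := (T.state_spec h hh).2.1
    rw [hl] at this
    exact (Option.some.inj this).symm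
  by_cases hBt : B = ⊤
  · subst hBt
    intro q hp
    cases q with
    | nil =>
      have := hp.last
      simp [hl] at this
      exact hu this
    | cons w q =>
      have ha := last_adj hl hp
      obtain ⟨y, hv, hle⟩ := hB w ha
      rw [top_le_iff, Entry.go_eq_top] at hle
      subst hle
      exact hv q (by simpa using hp)
  · obtain ⟨w, y, ha, hv, rfl⟩ := hB'.resolve_left hBt
    cases y with
    | none => exact absurd rfl hBt
    | some p =>
      have hlegal : ∀ x, I.IsLegalMove h x → ∃ q, I.graph.Adj u x ∧ I.Outcome (h ++ [x]) q ∧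
          T.Val (h ++ [x]) (some (I.costs x q)) := by
        rintro x ⟨-, p', hp', q', rfl⟩
        have ha := last_adj hl (q := q') (w := x) (by simpa using hp')
        obtain ⟨y, hv, -⟩ := hB x ha
        cases y with
        | none => exact absurd hp' (hv q')
        | some p'' =>
          obtain ⟨q, u', h1, h2, h3, h4, h5⟩ := hv
          simp at h3
          subst h3
          exact ⟨q, ha, h2, q, x, h1, h2, by simp, rfl, h5⟩
      choose! out hout using hlegal
      have hlw : I.IsLegalMove h w := by
        obtain ⟨q, u', h1, -⟩ := hv
        exact ⟨by simp, _, h1, List.prefix_append _ _⟩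
      have hv' := hout w hlw
      have hp : p = I.costs w (out w) := by
        have := Val.unique T hv hv'.2.2
        exact Option.some.inj this
      obtain ⟨q, u', h1, h2, h3, h4, h5⟩ := hv'.2.2
      have hq : q = out w := h2.unique hv'.2.1
      subst hq
      refine ⟨w :: out w, u, by simpa using h1, ?_, hl, ?_, ?_⟩
      · refine Game.Outcome.move h u w out hl hu (fun x hx => (hout x hx).2.1) hlw ?_
        intro x hx
        obtain ⟨hax, -, hvx⟩ := hout x hx
        obtain ⟨y, hvy, hle⟩ := hB x hax
        rw [Val.unique T hvy hvx, hp, Entry.go_some, Entry.go_some, Entry.mk_le_mk] at hle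
        unfold Game.preference
        rw [Prod.Lex.toLex_le_toLex, Prod.Lex.toLex_le_toLex]
        simpa [Game.costs] using hle
      · simp [Game.costs, hp]
      · refine ⟨by rw [hcur]; exact hu, ?_, ?_⟩
        · rw [hd hBt]; simp
        · rw [T.state_append hne] at h5
          exact h5

theorem val_target {h : List (Fin n)} (hh : h.head? = some I.s) (hc : h.IsChain I.graph.Adj)
    (hn : NoEven h) (hd : I.t ∉ h.dropLast) (hl : h.getLast? = some I.t) :
    T.Val h (some (0, 0)) := by
  refine ⟨[], I.t, ?_, .finish h hl, hl, rfl, ?_⟩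
  · rw [List.append_nil]
    exact ⟨hh, hl, hc, hd, hn⟩
  · have := (T.state_spec h hh).2.1
    rw [hl] at this
    exact (Option.some.inj this).symm

end Tables
end ShortestPathGame

namespace ShortestPathGame

/-! ### The tables give the values of the positions -/

/-- A walk from the start without even closed subwalks, which has not passed the target. -/
structure Good {n : ℕ} (I : Game n) (h : List (Fin n)) : Prop where
  head : h.head? = some I.s
  arcs : h.IsChain I.graph.Adj
  noEven : NoEven h
  ends : I.t ∉ h.dropLast

section Good

variable {n : ℕ} {I : Game n}

theorem Good.snoc {h : List (Fin n)} {u w : Fin n} (H : Good I h) (hl : h.getLast? = some u)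
    (hu : u ≠ I.t) (ha : I.graph.Adj u w) (hn : NoEven (h ++ [w])) : Good I (h ++ [w]) := by
  obtain ⟨h', rfl⟩ := List.getLast?_eq_some_iff.1 hl
  refine ⟨?_, ?_, hn, ?_⟩
  · rw [← H.head]; cases h' <;> simp
  · rw [List.isChain_append]
    refine ⟨H.arcs, by simp, ?_⟩
    simpa using ha
  · have := H.ends
    simp at this ⊢
    exact ⟨this, fun h => hu h.symm⟩

theorem Good.reach {h : List (Fin n)} (H : Good I h) {x : Fin n} (hx : x ∈ h) : I.Reach x :=
  Layout.reach_of_mem H.head H.arcs hx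

theorem play_suffix {h q : List (Fin n)} {x : Fin n} (hp : I.IsPlay (h ++ x :: q)) :
    I.Reach x ∧ (x :: q).IsChain I.graph.Adj ∧ (x :: q).getLast? = some I.t := by
  refine ⟨Layout.reach_of_mem hp.head hp.arcs (by simp), hp.arcs.suffix ⟨h, rfl⟩, ?_⟩
  have := hp.last
  rw [List.getLast?_append] at this
  simpa [List.getLast?_cons] using this

theorem play_third {a b r : List (Fin n)} {u : Fin n} (hp : I.IsPlay (a ++ u :: (b ++ [u]) ++ r)) :
    u ∉ r := by
  intro hm
  obtain ⟨c, d, rfl⟩ := List.append_of_mem hm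
  have h : NoEven (a ++ u :: (b ++ [u]) ++ (c ++ u :: d)) := hp.noEvenCycle
  refine not_noEven_three (a := a) (b := b) (c := c) (d := d) (v := u) ?_
  simpa using h

theorem play_third' {a b c r : List (Fin n)} {u : Fin n}
    (hp : I.IsPlay (a ++ u :: (b ++ u :: c) ++ r)) : u ∉ r := by
  intro hm
  obtain ⟨d, e, rfl⟩ := List.append_of_mem hm
  have h : NoEven (a ++ u :: (b ++ u :: c) ++ (d ++ u :: e)) := hp.noEvenCycle
  refine not_noEven_three (a := a) (b := b) (c := c ++ d) (d := e) (v := u) ?_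
  simpa using h

end Good

/-! ### Dead moves, and the ways back to the top of a cycle -/

namespace Tables

variable {n : ℕ} {I : Game n} {F : Layout I} (T : Tables I F)

/-- By `low_or_top` a vertex which is not low reaches `t` only through its top, and `x` has none. -/
theorem dead_exit {h : List (Fin n)} {x : Fin n} (ht : F.top x = none) (hl : ¬ F.low x) :
    T.Val (h ++ [x]) none := by
  intro q hp
  obtain ⟨h1, h2, h3⟩ := play_suffix (h := h) (q := q) (x := x) (by simpa using hp)
  rcases F.low_or_top q x h1 h2 h3 with h | ⟨v, h, -⟩
  · exact hl h
  · rw [ht] at h; cases h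

/-- Reaching `t` from `x` would require passing `u` a third time. -/
theorem dead_side {a b : List (Fin n)} {u x : Fin n} (ht : F.top x = some u) (hl : ¬ F.low x) :
    T.Val (a ++ u :: (b ++ [u]) ++ [x]) none := by
  intro q hp
  have hp' : I.IsPlay (a ++ u :: (b ++ [u]) ++ x :: q) := by simpa using hp
  obtain ⟨h1, h2, h3⟩ := play_suffix hp'
  rcases F.low_or_top q x h1 h2 h3 with h | ⟨v, h, hv⟩
  · exact hl h
  · rw [ht] at h
    cases h
    exact play_third hp' (List.mem_cons_of_mem _ hv)

/-- A walk on which the successor of `u` is chosen, although it does not lead to the target in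
another way, returns to the top of the cycle. -/
theorem top_mem_of_suc {h q : List (Fin n)} {u v : Fin n}
    (hp : I.IsPlay (h ++ F.suc u :: q)) (hv : F.top u = some v) (hr : ¬ F.Route u (F.suc u)) :
    v ∈ F.suc u :: q := by
  obtain ⟨h1, h2, h3⟩ := play_suffix hp
  obtain ⟨-, ha, h4 | ⟨h4, h5⟩⟩ := F.suc_spec hv
  · simp [h4]
  · rcases F.low_or_top q _ h1 h2 h3 with h | ⟨v', h, hv'⟩
    · exact absurd ⟨ha, h4, h⟩ hr
    · rw [h5] at h
      cases h
      simp [hv']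

theorem low_mem_of_mem {h r : List (Fin n)} {u v : Fin n} (hv : I.Reach v) (hu : I.Reach u)
    (hp : I.IsPlay (h ++ r)) (hm : v ∈ r) (ht : F.top u = some v) (hl : F.low u) : u ∈ r := by
  obtain ⟨c, d, rfl⟩ := List.append_of_mem hm
  obtain ⟨h1, h2, h3⟩ := play_suffix (h := h ++ c) (q := d) (x := v) (by simpa using hp)
  have := F.low_mem hv hu h2 h3 ht hl
  simp [this]

/-- At a second visit of a low vertex only the descents to low vertices are alive. Going round the
cycle leads to its top and from there, by `low_mem`, to a third visit of `u`. -/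
theorem dead_sat {a b : List (Fin n)} {u x : Fin n} (hu : I.Reach u) (hl : F.low u)
    (hx : I.graph.Adj u x) (hr : ¬ F.Route u x) : T.Val (a ++ u :: (b ++ [u]) ++ [x]) none := by
  rcases F.arc hu hx with ⟨ht, rfl⟩ | ⟨h1, ht⟩ | ⟨h1, ht⟩
  · intro q hp
    have hp' : I.IsPlay (a ++ u :: (b ++ [u]) ++ F.suc u :: q) := by simpa using hp
    obtain ⟨v, hv⟩ := Option.ne_none_iff_exists'.1 ht
    have hm := top_mem_of_suc hp' hv hr
    exact play_third hp' (low_mem_of_mem (F.top_reach hu hv) hu hp' hm hv hl)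
  · exact T.dead_side ht fun h => hr ⟨hx, h1, h⟩
  · exact T.dead_exit ht fun h => hr ⟨hx, h1, h⟩

/-- The second occurrence of `u` is the last vertex, so a vertex following `u` follows the first
occurrence. -/
theorem next_eq {a b m h₀ : List (Fin n)} {u x : Fin n} (h : h₀ ++ u :: (m ++ [u]) = a ++ u :: x :: b)
    (h₁ : u ∉ h₀) (h₂ : u ∉ m) (hxu : x ≠ u) : m.head? = some x := by
  rcases List.append_eq_append_iff.1 h with ⟨c, rfl, hc⟩ | ⟨c, rfl, hc⟩
  · cases c with
    | nil =>
      simp at hc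
      cases m with
      | nil => simp at hc; exact absurd hc.1.symm hxu
      | cons y m => simp at hc; simp [hc.1]
    | cons y c =>
      simp at hc
      obtain ⟨-, hc⟩ := hc
      have := congrArg List.dropLast hc
      rw [List.dropLast_concat, List.dropLast_append_of_ne_nil (by simp)] at this
      rw [this] at h₂
      simp at h₂
  · cases c with
    | nil =>
      simp at hc
      cases m with
      | nil => simp at hc; exact absurd hc.1 hxu
      | cons y m => simp at hc; simp [hc.1]
    | cons y c =>
      simp at hc
      simp [← hc.1] at h₁

/-- A lower vertex has not been visited at the first visit of `u`. -/
theorem fresh_of_fresh {h₀ : List (Fin n)} {u x : Fin n} (hg : Good I (h₀ ++ [u])) (hu : u ∉ h₀)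
    (F : Layout I) (ha : I.graph.Adj u x) (hr : F.rank x < F.rank u) : x ∉ h₀ ++ [u] := by
  intro hx
  have hxu : x ≠ u := by rintro rfl; exact lt_irrefl _ hr
  have hx₀ : x ∈ h₀ := by simpa [hxu] using hx
  cases ht : F.top x with
  | none =>
    obtain ⟨c, d, rfl⟩ := List.append_of_mem hx₀
    obtain ⟨v, hv⟩ := F.top_of_rank_lt (d ++ [u]) x u (hg.reach (by simp))
      (hg.arcs.suffix ⟨c, by simp⟩) (by simp) hr
    rw [ht] at hv; cases hv
  | some v =>
    obtain ⟨a, b, hab⟩ := F.first_visit hg.head hg.arcs hx (hg.reach (by simp)) ha hr (by simp [ht])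
    have := congrArg List.dropLast hab
    rw [List.dropLast_concat, List.dropLast_append_of_ne_nil (by simp)] at this
    rw [this] at hu
    simp at hu

/-- A lower vertex has not been visited at the second visit of `u`, unless it came directly after
the first visit. -/
theorem fresh_of_sat {h₀ m : List (Fin n)} {u x : Fin n} (hg : Good I (h₀ ++ u :: (m ++ [u])))
    (hu : u ∉ h₀) (hm : u ∉ m)
    (F : Layout I) (ha : I.graph.Adj u x) (hr : F.rank x < F.rank u) (hx : m.head? ≠ some x) :
    x ∉ h₀ ++ u :: (m ++ [u]) := by
  intro hx'
  have hxu : x ≠ u := by rintro rfl; exact lt_irrefl _ hr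
  cases ht : F.top x with
  | none =>
    have hx₀ : x ∈ h₀ ++ u :: m := by simp [hxu] at hx' ⊢; tauto
    obtain ⟨c, d, hcd⟩ := List.append_of_mem hx₀
    have e : h₀ ++ u :: (m ++ [u]) = c ++ x :: (d ++ [u]) := by
      have := congrArg (· ++ [u]) hcd
      simpa using this
    rw [e] at hg
    obtain ⟨v, hv⟩ := F.top_of_rank_lt (d ++ [u]) x u (hg.reach (by simp))
      (hg.arcs.suffix ⟨c, by simp⟩) (by simp) hr
    rw [ht] at hv; cases hv
  | some v =>
    obtain ⟨a, b, hab⟩ := F.first_visit hg.head hg.arcs hx' (hg.reach (by simp)) ha hr (by simp [ht])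
    exact hx (next_eq hab hu hm hxu)

theorem decision_fresh {h : List (Fin n)} {u : Fin n} (hg : Good I (h ++ [u])) (hu : u ∉ h) :
    (T.state (h ++ [u])).cur = u ∧ (T.state (h ++ [u])).sat = false := by
  obtain ⟨-, h2, h3⟩ := T.state_spec _ hg.head
  simp at h2 h3
  rw [← h2] at h3
  exact ⟨h2.symm, by simpa [hu] using h3⟩

theorem decision_sat {h m : List (Fin n)} {u : Fin n} (hg : Good I (h ++ u :: (m ++ [u]))) :
    (T.state (h ++ u :: (m ++ [u]))).cur = u ∧ (T.state (h ++ u :: (m ++ [u]))).sat = true := by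
  obtain ⟨-, h2, h3⟩ := T.state_spec _ hg.head
  rw [List.getLast?_append] at h2
  simp [List.getLast?_cons] at h2
  refine ⟨h2.symm, h3.2 ?_⟩
  rw [← h2, List.dropLast_append_of_ne_nil (by simp)]
  cases m <;> simp

theorem after_R_le {u x : Fin n} (hT : T.Valid) (hu : I.Reach u) (hs : F.Side u x)
    (y : Option (ℝ × ℝ)) : Entry.after true (T.det u) y ≤
      Entry.go (I.cost u x) x (Entry.after false (T.R false x) y).pay := by
  rw [Entry.go_after]
  exact Entry.after_mono _ _ ((hT.det u hu).1 x hs)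

/-- The walk has entered the cycle of `u` at `v` and cannot reach `t` without returning there. Since
the return closes a walk which must be odd, the parity `b` of the remaining steps is fixed by
`g'.length`. The hypothesis on `y` says that the value at the return does not depend on the way
back, so it can be split off from the minimization. Induction on the rank covers both the successor
and the detours from `u`. -/
theorem val_R (hT : T.Valid) : ∀ (k : ℕ) (u : Fin n), F.rank u = k →
    ∀ (b : Bool) (h₀ : List (Fin n)) (v : Fin n) (g g' : List (Fin n)) (y : Option (ℝ × ℝ)),
    Good I (h₀ ++ [u]) → u ∉ h₀ → F.top u = some v → ¬ F.low u →
    h₀ ++ [u] = g ++ v :: g' → v ∉ g → v ∉ g' → Odd (g'.length + b.toNat) →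
    (T.state (h₀ ++ [u])).mode u = (if b then 4 else 3) →
    (∀ r, Good I (h₀ ++ [u] ++ r) → r.getLast? = some v → v ∉ r.dropLast →
      (∀ z ∈ r, z = v ∨ F.rank z ≤ F.rank u) → T.Val (h₀ ++ [u] ++ r) y) →
    T.Val (h₀ ++ [u]) (Entry.after b (T.R b u) y).pay := by
  intro k
  induction k using Nat.strong_induction_on with
  | _ k ih =>
    intro u hk b h₀ v g g' y hg hu htop hnl hdec hvg hvg' hodd hmode hcont
    have hur : I.Reach u := hg.reach (by simp)
    have hut : u ≠ I.t := fun h => hnl ((F.low_iff hur).2 (Or.inl h))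
    have hnlow : ∀ x, I.graph.Adj u x → F.rank x < F.rank u → ¬ F.low x := fun x ha hr hl =>
      hnl ((F.low_iff hur).2 (Or.inr ⟨x, ha, hr, hl⟩))
    obtain ⟨huv, hasuc, hsuc⟩ := F.suc_spec htop
    have hvu : v ≠ u := by rintro rfl; exact lt_irrefl _ huv
    -- moves to the successor
    have hnext : ∀ (b' : Bool) (m : List (Fin n)), Good I (h₀ ++ [u] ++ m) →
        (h₀ ++ [u] ++ m).getLast? = some u →
        (∀ z ∈ m, F.rank z ≤ F.rank u) → (F.suc u ≠ v → F.suc u ∉ h₀ ++ [u] ++ m) →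
        Odd (g'.length + m.length + 1 + b'.toNat) →
        (F.suc u ≠ v → T.newMode (T.state (h₀ ++ [u] ++ m)) (F.suc u) = if b' then 4 else 3) →
        T.Val (h₀ ++ [u] ++ m ++ [F.suc u]) (Entry.after b' (T.next b' u) y).pay := by
      intro b' m hgm hlm hrm hfr hom hmm
      have hvm : v ∉ m := fun h => by have := hrm v h; omega
      have e : h₀ ++ [u] ++ m = g ++ v :: (g' ++ m) := by rw [hdec]; simp
      rcases hsuc with hs | ⟨hs, hts⟩
      · simp only [next, htop, hs, if_true]
        cases b' with
        | true =>
          -- The successor is already the top while an odd number of further steps is required: the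
          -- move would close an even walk.
          simp only [if_true, Entry.after_top, Entry.pay_top]
          intro q hp
          have h1 : NoEven (h₀ ++ [u] ++ m ++ [v] ++ q) := hp.noEvenCycle
          rw [e] at h1
          have h2 : Odd ((g' ++ m).length + 1) := NoEven.odd (a := g) (b := g' ++ m) (c := q) (v := v)
            (by simpa using h1)
          simp at h2 hom
          grind
        | false =>
          simp only [Bool.false_eq_true, if_false, Entry.pay_after_zero]
          have hgood : Good I (h₀ ++ [u] ++ m ++ [v]) := by
            refine hgm.snoc hlm hut (hs ▸ hasuc) ?_
            rw [e]
            refine NoEven.append_old (e ▸ hgm.noEven) hvg (by simp [hvg', hvm]) ?_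
            simpa using hom
          have := hcont (m ++ [v]) (by simpa using hgood) (by simp) (by simpa using hvm) (by
            intro z hz
            simp at hz
            rcases hz with hz | hz
            · exact Or.inr (hrm z hz)
            · exact Or.inl hz)
          simpa using this
      · have hsv : F.suc u ≠ v := fun h => by rw [h] at hs; omega
        have hfr' := hfr hsv
        have hnx : T.next b' u = T.R b' (F.suc u) := by
          unfold next
          rw [if_neg]
          rw [htop]
          simpa using hsv.symm
        rw [hnx]
        refine ih _ (hk ▸ hs) (F.suc u) rfl b' (h₀ ++ [u] ++ m) v g (g' ++ m ++ [F.suc u]) y ?_ hfr'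
          hts (hnlow _ hasuc hs) ?_ hvg ?_ ?_ ?_ ?_
        · exact hgm.snoc hlm hut hasuc (hgm.noEven.append_new hfr')
        · rw [e]; simp
        · simp [hvg', hvm, hsv.symm]
        · simpa [Nat.add_assoc] using hom
        · rw [T.mode_new hgm.head hfr', hmm hsv]
        · intro r hgr hlr hvr hzr
          have := hcont (m ++ F.suc u :: r) (by simpa using hgr)
            (by rw [List.getLast?_append, List.getLast?_cons, hlr]; simp) (by
              rw [List.dropLast_append_of_ne_nil (by simp),
                List.dropLast_cons_of_ne_nil (by rintro rfl; simp at hlr)]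
              simp [hvm, hvr, hsv.symm]) (by
            intro z hz
            simp at hz
            rcases hz with hz | rfl | hz
            · exact Or.inr (hrm z hz)
            · exact Or.inr hs.le
            · rcases hzr z hz with h | h
              · exact Or.inl h
              · exact Or.inr (by omega))
          simpa using this
    obtain ⟨hcur, hsat⟩ := T.decision_fresh hg hu
    have hfirst : T.Val (h₀ ++ [u] ++ [F.suc u]) (Entry.after (!b) (T.next (!b) u) y).pay := by
      have := hnext (!b) [] (by simpa using hg) (by simp) (by simp) (fun h => ?_) ?_ (fun h => ?_)
      · simpa using this
      · rcases hsuc with hs | ⟨hs, -⟩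
        · exact absurd hs h
        · simpa using fresh_of_fresh hg hu F hasuc hs
      · cases b <;> simp at hodd ⊢ <;> grind
      · rcases hsuc with hs | ⟨hs, hs'⟩
        · exact absurd hs h
        · simp only [List.append_nil]
          have hts : F.top (F.suc u) ≠ some u := by
            rw [hs']; simpa using hvu
          unfold newMode
          rw [hsat, hcur, hmode]
          cases b <;> simp [hts]
    -- For a detour the induction hypothesis is used with `u` as the top and with the value of the
    -- second visit of `u` as continuation.
    have hside : ∀ x, I.graph.Adj u x → F.rank x < F.rank u → F.top x = some u →
        T.Val (h₀ ++ [u] ++ [x]) (Entry.after false (T.R false x)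
          (Entry.go (I.cost u (F.suc u)) (F.suc u)
            (Entry.after b (T.next b u) y).pay).pay).pay := by
      intro x hax hrx htx
      have hfr := fresh_of_fresh hg hu F hax hrx
      have hgx : Good I (h₀ ++ [u] ++ [x]) :=
        hg.snoc (by simp) hut hax (hg.noEven.append_new hfr)
      have hxu : x ≠ u := by rintro rfl; exact lt_irrefl _ hrx
      refine ih _ (hk ▸ hrx) x rfl false (h₀ ++ [u]) u h₀ [x] _ hgx hfr htx (hnlow x hax hrx)
        (by simp) hu (by simpa using hxu.symm) (by simp) ?_ ?_
      · rw [T.mode_new hg.head hfr]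
        unfold newMode
        rw [hsat, hcur, hmode]
        cases b <;> simp [htx]
      · intro r hgr hlr hur' hzr
        obtain ⟨r', rfl⟩ := List.getLast?_eq_some_iff.1 hlr
        rw [List.dropLast_concat] at hur'
        have e : h₀ ++ [u] ++ [x] ++ (r' ++ [u]) = h₀ ++ u :: ((x :: r') ++ [u]) := by simp
        have hux : u ∉ x :: r' := by simp [hur', hxu.symm]
        have hgr' := hgr
        rw [e] at hgr'
        obtain ⟨hcur', hsat'⟩ := T.decision_sat hgr'
        have hmode' : (T.state (h₀ ++ u :: ((x :: r') ++ [u]))).mode u = if b then 4 else 3 := by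
          rw [← hmode, ← T.mode_append hg.head (x :: r' ++ [u]) (x := u) (by simp)]
          simp
        have hsr : F.suc u ≠ v → F.rank (F.suc u) < F.rank u ∧ F.top (F.suc u) = some v := by
          intro h
          rcases hsuc with hs | hs
          · exact absurd hs h
          · exact hs
        have hstep : T.Val (h₀ ++ [u] ++ [x] ++ (r' ++ [u]) ++ [F.suc u])
            (Entry.after b (T.next b u) y).pay := by
          have := (hnext b (x :: r' ++ [u]) (by simpa using hgr) (by
              rw [List.getLast?_append]; simp [List.getLast?_cons]) (by
              intro z hz
              simp at hz
              rcases hz with rfl | hz | rfl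
              · exact hrx.le
              · rcases hzr z (by simp [hz]) with h | h
                · exact h ▸ le_refl _
                · omega
              · exact le_refl _) (fun h => by
                have := fresh_of_sat hgr' hu hux F hasuc (hsr h).1 (by
                  simp only [List.head?_cons, ne_eq, Option.some.injEq]
                  rintro rfl
                  rw [htx] at hsr
                  exact hvu (Option.some.inj (hsr h).2).symm)
                simpa using this) (by
                have h1 : Odd ((x :: r').length + 1) :=
                  NoEven.odd (a := h₀) (c := []) (v := u) (by simpa using hgr'.noEven)
                simp at h1 ⊢
                grind) (fun h => by
                have : T.newMode (T.state (h₀ ++ u :: ((x :: r') ++ [u]))) (F.suc u) =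
                    if b then 4 else 3 := by
                  unfold newMode
                  rw [hsat', hcur', hmode']
                  cases b <;> simp
                simpa using this))
          simpa using this
        -- At the second visit of `u` the successor is the only move left: another detour would
        -- visit `u` three times, and the other descents never come back.
        refine T.val_step (u := u) hgr.head (by rw [List.getLast?_append]; simp) hut (fun z haz => ?_)
          (Or.inr ⟨F.suc u, _, hasuc, ?_, rfl⟩) (fun hB => ?_)
        · rcases F.arc hur haz with ⟨-, hz⟩ | ⟨hz, hz'⟩ | ⟨hz, hz'⟩
          · subst hz
            refine ⟨_, ?_, le_refl _⟩
            exact hstep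
          · refine ⟨none, ?_, by simp⟩
            rw [e]
            exact T.dead_side hz' (hnlow z haz hz)
          · exact ⟨none, T.dead_exit hz' (hnlow z haz hz), by simp⟩
        · exact hstep
        · rw [Entry.vert_go hB, e]
          unfold decision
          rw [hsat', hcur', hmode']
          cases b <;> simp
    have hR := hT.R u b hur (by simp [htop])
    -- The continuation `y` is distributed over the minimum in the equation for `R`, which turns its
    -- two members into the entries of the actual moves.
    have hB₁ : Entry.after b (T.R b u) y = min
        (Entry.go (I.cost u (F.suc u)) (F.suc u) (Entry.after (!b) (T.next (!b) u) y).pay)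
        (Entry.after true (T.det u) (Entry.go (I.cost u (F.suc u)) (F.suc u)
            (Entry.after b (T.next b u) y).pay).pay) := by
      rw [hR, Entry.after_min, Entry.go_after, Entry.go_after, Entry.after_after, Bool.not_not,
        Bool.true_xor, Bool.not_not]
    refine T.val_step (u := u) hg.head (by simp) hut (fun x hax => ?_) ?_ (fun hB => ?_)
    · rcases F.arc hur hax with ⟨-, rfl⟩ | ⟨hrx, htx⟩ | ⟨hrx, htx⟩
      · exact ⟨_, hfirst, by rw [hB₁]; exact min_le_left _ _⟩
      · refine ⟨_, hside x hax hrx htx, ?_⟩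
        rw [hB₁]
        exact (min_le_right _ _).trans (T.after_R_le hT hur ⟨hax, htx, hnlow x hax hrx⟩ _)
      · exact ⟨none, T.dead_exit htx (hnlow x hax hrx), by simp⟩
    · rcases min_choice (Entry.go (I.cost u (F.suc u)) (F.suc u) (Entry.after (!b) (T.next (!b) u) y).pay)
        (Entry.after true (T.det u) (Entry.go (I.cost u (F.suc u)) (F.suc u)
            (Entry.after b (T.next b u) y).pay).pay) with h | h
      · exact Or.inr ⟨_, _, hasuc, hfirst, by rw [hB₁, h]⟩
      · rcases (hT.det u hur).2 with hd | ⟨x, hx, hd⟩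
        · left
          rw [hB₁, h, hd, Entry.after_top]
        · have hrx : F.rank x < F.rank u := (F.suc_spec hx.2.1).1
          refine Or.inr ⟨x, _, hx.1, hside x hx.1 hrx hx.2.1, ?_⟩
          rw [hB₁, h, hd]
          exact (Entry.go_after _ _ false _ _).symm
    · rw [Entry.vert_after hB]
      unfold decision
      rw [hsat, hcur, hmode]
      cases b <;> simp

end Tables
end ShortestPathGame

/-! ### Values of the positions on the descent to the target -/

namespace ShortestPathGame

namespace Tables

variable {n : ℕ} {I : Game n} {F : Layout I} (T : Tables I F)

/-- The player deciding in `v` moves at even times, so the parity of `P.length` tells who pays for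
the last arc. -/
theorem costs_concat (I : Game n) (x : Fin n) : ∀ (P : List (Fin n)) (v u : Fin n),
    (v :: P).getLast? = some u → I.costs v (P ++ [x]) =
      (if Odd P.length then (I.costs v P).1 else (I.costs v P).1 + I.cost u x,
        if Odd P.length then (I.costs v P).2 + I.cost u x else (I.costs v P).2) := by
  intro P
  induction P with
  | nil => intro v u h; simp at h; subst h; simp [Game.costs]
  | cons w P ih =>
    intro v u h
    rw [List.getLast?_cons_cons] at h
    simp only [List.cons_append, Game.costs, ih w u h, List.length_cons]
    by_cases ho : Odd P.length
    · simp [ho, Nat.odd_add_one, add_assoc]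
    · simp [ho, Nat.odd_add_one]

/-- The plain descent to `t` already gives a finite entry, by induction on the rank; the other
alternatives can only lower the minimum. -/
theorem low_ne_top (hT : T.Valid) : ∀ (k : ℕ) (u : Fin n), F.rank u = k → I.Reach u → F.low u →
    T.EC u ≠ ⊤ ∧ T.EU u ≠ ⊤ := by
  intro k
  induction k using Nat.strong_induction_on with
  | _ k ih =>
    intro u hk hu hl
    rw [hT.EC u hu, hT.EU u hu]
    rcases (F.low_iff hu).1 hl with h | ⟨w, ha, hr, hlw⟩
    · simp [h]
    · obtain ⟨h1, h2⟩ := ih _ (hk ▸ hr) w rfl (hu.tail ha) hlw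
      have hC := (hT.rtC u hu).1 w ⟨ha, hr, hlw⟩
      have hU := (hT.rtU u hu).1 w ⟨ha, hr, hlw⟩
      have e1 : T.rtC u ≠ ⊤ := by
        intro h
        simp only [h, top_le_iff, Entry.go_eq_top, Entry.pay_eq_none] at hC
        exact h1 hC
      have e2 : T.rtU u ≠ ⊤ := by
        intro h
        simp only [h, top_le_iff, Entry.go_eq_top, Entry.pay_eq_none] at hU
        split_ifs at hU
        · exact h1 hU
        · exact h2 hU
      constructor <;> (intro h; rw [min_eq_top, min_eq_top] at h)
      · exact e1 h.1.1
      · exact e2 h.1.1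

/-- The walk `h` visits `u` for the first time and cannot go round the cycle of `u`. -/
structure StateU (h : List (Fin n)) (u : Fin n) : Prop where
  good : Good I h
  fresh : ∃ h₀, h = h₀ ++ [u] ∧ u ∉ h₀
  low : F.low u
  mode : (T.state h).mode u = 2
  -- A return to the top `v` would force a third visit of `z`.
  blocked : ∀ v, F.top u = some v → ∃ z a b c, h = a ++ z :: (b ++ z :: c) ∧
    (z = v ∨ (F.top z = some v ∧ F.low z))

/-- The walk `h` visits `u` for the first time, and has come directly from the top of its cycle. -/
structure StateC (h : List (Fin n)) (u : Fin n) : Prop where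
  good : Good I h
  fresh : ∃ h₀, h = h₀ ++ [u] ∧ u ∉ h₀
  low : F.low u
  mode : (T.state h).mode u = 1
  -- The way `P` from the top is kept with its totals, parity and modes because going round the
  -- cycle means walking it again.
  path : ∀ v, F.top u = some v → ∃ g P, h = g ++ v :: P ∧ P.getLast? = some u ∧ v ∉ g ∧
    (∀ z ∈ P, z ∉ g) ∧ (v :: P).IsChain (F.Step v) ∧ I.costs v P = (T.pa u, T.pb u) ∧
    T.par u = decide (Odd P.length) ∧ ∀ z ∈ v :: P, (T.state h).mode z ≤ 2

theorem arc_side_of_not_route {u x : Fin n} (hu : I.Reach u) (ha : I.graph.Adj u x)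
    (hr : ¬ F.Route u x) : (F.top u ≠ none ∧ x = F.suc u) ∨ F.Side u x ∨
      (F.rank x < F.rank u ∧ F.top x = none ∧ ¬ F.low x) := by
  rcases F.arc hu ha with h | ⟨h, h'⟩ | ⟨h, h'⟩
  · exact Or.inl h
  · exact Or.inr (Or.inl ⟨ha, h', fun hl => hr ⟨ha, h, hl⟩⟩)
  · exact Or.inr (Or.inr ⟨h, h', fun hl => hr ⟨ha, h, hl⟩⟩)

/-- By `dead_sat` only descents to low vertices are legal at the second visit. The hypothesis on
`m.head?` ensures that the excursion did not begin with such a descent, so the next vertex is new.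
Its cycle, if any, is blocked by the two visits of `u`. -/
theorem val_S (hT : T.Valid) {h₀ m : List (Fin n)} {u : Fin n}
    (IH : ∀ x h, F.rank x < F.rank u → T.StateU h x → T.Val h (T.EU x).pay)
    (hg : Good I (h₀ ++ u :: (m ++ [u]))) (hu₀ : u ∉ h₀) (hum : u ∉ m) (hut : u ≠ I.t)
    (hl : F.low u) (hm : ∀ x, m.head? = some x → ¬ F.Route u x)
    (hmode : (T.state (h₀ ++ u :: (m ++ [u]))).mode u ≤ 2) :
    T.Val (h₀ ++ u :: (m ++ [u])) (T.S u).pay := by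
  have hur : I.Reach u := hg.reach (by simp)
  obtain ⟨hcur, hsat⟩ := T.decision_sat hg
  have hlast : (h₀ ++ u :: (m ++ [u])).getLast? = some u := by
    rw [List.getLast?_append]; simp [List.getLast?_cons]
  have key : ∀ x, F.Route u x → T.Val (h₀ ++ u :: (m ++ [u]) ++ [x]) (T.EU x).pay := by
    intro x hx
    have hfr : x ∉ h₀ ++ u :: (m ++ [u]) :=
      fresh_of_sat hg hu₀ hum F hx.1 hx.2.1 fun h => hm x h hx
    refine IH x _ hx.2.1 ⟨hg.snoc hlast hut hx.1 (hg.noEven.append_new hfr), ⟨_, rfl, hfr⟩, hx.2.2, ?_, ?_⟩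
    · rw [T.mode_new hg.head hfr]
      unfold newMode
      rw [hsat, hcur]
      simp [hmode]
    · intro v hv
      -- The blocking vertex is `u`, which is the top of the cycle of `x` or a low vertex on this
      -- cycle.
      refine ⟨u, h₀, m, [x], by simp, ?_⟩
      rcases F.arc hur hx.1 with ⟨ht, h⟩ | ⟨-, h⟩ | ⟨-, h⟩
      · obtain ⟨v', hv'⟩ := Option.ne_none_iff_exists'.1 ht
        rcases F.suc_spec hv' with ⟨h1, -, h2 | ⟨-, h2⟩⟩
        · have := hx.2.1
          rw [h, h2] at this
          omega
        · rw [← h, hv] at h2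
          cases h2
          exact Or.inr ⟨hv', hl⟩
      · rw [hv] at h; exact Or.inl (Option.some.inj h).symm
      · rw [hv] at h; cases h
  refine T.val_step hg.head hlast hut (fun x hax => ?_) ?_ (fun _ => ?_)
  · by_cases hx : F.Route u x
    · exact ⟨_, key x hx, (hT.S u hur).1 x hx⟩
    · exact ⟨none, T.dead_sat hur hl hax hx, by simp⟩
  · rcases (hT.S u hur).2 with h | ⟨x, hx, h⟩
    · exact Or.inl h
    · exact Or.inr ⟨x, _, hx.1, key x hx, h⟩
  · unfold decision
    rw [hsat, hcur]
    simp [hmode]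

/-- This is `val_R` for a cycle with top `u`, where the continuation is the second visit of `u` and
thus has the value `S u`. One arc and an even rest make the detour odd. -/
theorem val_side (hT : T.Valid) {h₀ : List (Fin n)} {u x : Fin n}
    (IH : ∀ x h, F.rank x < F.rank u → T.StateU h x → T.Val h (T.EU x).pay)
    (hg : Good I (h₀ ++ [u])) (hu₀ : u ∉ h₀) (hut : u ≠ I.t) (hl : F.low u)
    (hmode : (T.state (h₀ ++ [u])).mode u = 1 ∨ (T.state (h₀ ++ [u])).mode u = 2)
    (hs : F.Side u x) :
    T.Val (h₀ ++ [u] ++ [x]) (Entry.after false (T.R false x) (T.S u).pay).pay := by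
  have hrx : F.rank x < F.rank u := (F.suc_spec hs.2.1).1
  have hxu : x ≠ u := by rintro rfl; exact lt_irrefl _ hrx
  have hfr := fresh_of_fresh hg hu₀ F hs.1 hrx
  obtain ⟨hcur, hsat⟩ := T.decision_fresh hg hu₀
  refine T.val_R hT _ x rfl false (h₀ ++ [u]) u h₀ [x] _
    (hg.snoc (by simp) hut hs.1 (hg.noEven.append_new hfr)) hfr hs.2.1 hs.2.2 (by simp) hu₀
    (by simpa using hxu.symm) (by simp) ?_ ?_
  · rw [T.mode_new hg.head hfr]
    unfold newMode
    rw [hsat, hcur]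
    rcases hmode with h | h <;> simp [h, hs.2.1, hs.2.2]
  · intro r hgr hlr hur hzr
    obtain ⟨r', rfl⟩ := List.getLast?_eq_some_iff.1 hlr
    rw [List.dropLast_concat] at hur
    have e : h₀ ++ [u] ++ [x] ++ (r' ++ [u]) = h₀ ++ u :: ((x :: r') ++ [u]) := by simp
    rw [e] at hgr ⊢
    refine T.val_S hT IH hgr hu₀ (by simp [hur, hxu.symm]) hut hl ?_ ?_
    · intro y hy
      simp at hy
      subst hy
      exact fun h => hs.2.2 h.2.2
    · have : (T.state (h₀ ++ [u] ++ ([x] ++ (r' ++ [u])))).mode u = (T.state (h₀ ++ [u])).mode u :=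
        T.mode_append hg.head _ (by simp)
      rw [← List.append_assoc, e] at this
      omega

/-- Back at `v`, the walk has to repeat `P`: each of its vertices is visited for the second time, so
only descents to low vertices are legal, and `Layout.route` leaves a single one as long as it
follows the cycle. `A` is the part already repeated and `B` the part to come; at the end of `P` the
value is that of `val_S`. -/
theorem val_loop (hT : T.Valid) {g r : List (Fin n)} {u v : Fin n}
    (IH : ∀ x h, F.rank x < F.rank u → T.StateU h x → T.Val h (T.EU x).pay)
    (hut : u ≠ I.t) (hl : F.low u) (P : List (Fin n))
    (hPl : P.getLast? = some u)
    (hPg : ∀ z ∈ P, z ∉ g) (hch : (v :: P).IsChain (F.Step v))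
    (hr : r.head? = some (F.suc u)) (hsr : ¬ F.Route u (F.suc u)) (hrl : r.getLast? = some v)
    (hrP : ∀ z ∈ P, z ∉ r) (hrs : (g ++ v :: P).head? = some I.s)
    (hm : ∀ z ∈ v :: P, (T.state (g ++ v :: P)).mode z ≤ 2) :
    ∀ (B A : List (Fin n)) (x : Fin n), P = A ++ B → (v :: A).getLast? = some x →
      Good I (g ++ v :: P ++ r ++ A) →
      T.Val (g ++ v :: P ++ r ++ A) (Entry.after (decide (Odd B.length))
        (Entry.mk (I.costs x B).1 (I.costs x B).2 0) (T.S u).pay).pay := by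
  obtain ⟨r', rfl⟩ := List.getLast?_eq_some_iff.1 hrl
  have hrank : ∀ (Q : List (Fin n)) (w : Fin n), (w :: Q).IsChain (F.Step v) →
      ∀ z ∈ Q, F.rank z < F.rank w ∧ F.low z ∧ F.top z = some v := by
    intro Q
    induction Q with
    | nil => intro w _ z hz; simp at hz
    | cons y Q ih =>
      intro w hc z hz
      rw [List.isChain_cons_cons] at hc
      rcases List.mem_cons.1 hz with rfl | hz
      · exact hc.1.2
      · have := ih y hc.2 z hz
        exact ⟨this.1.trans hc.1.2.1, this.2⟩
  have hvP : v ∉ P := fun h => lt_irrefl _ (hrank P v hch v h).1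
  have hodd : NoEven (g ++ v :: P ++ (r' ++ [v])) → Odd (P.length + (r' ++ [v]).length) := by
    intro h
    have := NoEven.odd (a := g) (b := P ++ r') (c := []) (v := v) (by simpa using h)
    simpa [Nat.add_assoc] using this
  intro B
  induction B with
  | nil =>
    intro A x hPA hAx hgood
    simp only [List.append_nil] at hPA
    subst hPA
    simp only [Game.costs, List.length_nil, Nat.not_odd_zero, decide_false, Entry.pay_after_zero]
    obtain ⟨P', hP'⟩ := List.getLast?_eq_some_iff.1 hPl
    have huv : u ≠ v := by
      rintro rfl
      exact hvP (by rw [hP']; simp)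
    have huP' : u ∉ P' := by
      intro hu
      obtain ⟨c, d, rfl⟩ := List.append_of_mem hu
      have hc : (u :: (d ++ [u])).IsChain (F.Step v) := hch.suffix ⟨v :: c, by rw [hP']; simp⟩
      exact lt_irrefl _ (hrank _ _ hc u (by simp)).1
    have hur' : u ∉ r' ++ [v] := hrP u (by rw [hP']; simp)
    have e : g ++ v :: P ++ (r' ++ [v]) ++ P =
        (g ++ v :: P') ++ u :: ((r' ++ [v] ++ P') ++ [u]) := by rw [hP']; simp
    have hmode : (T.state (g ++ v :: P ++ ((r' ++ [v]) ++ P))).mode u ≤ 2 := by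
      rw [T.mode_append hrs _ (by rw [hP']; simp)]
      exact hm u (by rw [hP']; simp)
    rw [← List.append_assoc, e] at hmode
    rw [e] at hgood ⊢
    refine T.val_S hT IH hgood ?_ ?_ hut hl ?_ hmode
    · have := hPg u (by rw [hP']; simp)
      simp [this, huv, huP']
    · simp at hur' ⊢
      exact ⟨hur'.1, hur'.2, huP'⟩
    · intro x hx
      rw [List.head?_append, hr] at hx
      simp at hx
      exact hx ▸ hsr
  | cons y B ih =>
    intro A x hPA hAx hgood
    have hstep : F.Step v x y := by
      obtain ⟨A', hA'⟩ := List.getLast?_eq_some_iff.1 hAx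
      have : [x, y].IsChain (F.Step v) := hch.infix ⟨A', B, by
        rw [hPA, ← List.cons_append, hA']; simp⟩
      simpa using this
    have hxr : I.Reach x := hgood.reach (by
      have : x ∈ v :: A := List.mem_of_getLast? hAx
      simp at this ⊢
      tauto)
    have hxm : x ∈ v :: P := by
      have : x ∈ v :: A := List.mem_of_getLast? hAx
      rw [hPA]
      simp at this ⊢
      tauto
    have hxl : F.low x := (F.low_iff hxr).2 (Or.inr ⟨y, hstep.1, hstep.2.1, hstep.2.2.1⟩)
    have hxt : x ≠ I.t := F.rank_target hstep.2.1 (hxr.tail hstep.1) hstep.2.2.1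
    have hlast : (g ++ v :: P ++ (r' ++ [v]) ++ A).getLast? = some x := by
      rw [List.getLast?_append, List.getLast?_append]
      rw [List.getLast?_cons] at hAx
      simp at hAx ⊢
      cases hA : A.getLast? <;> simp_all
    -- the two visits of `x`
    obtain ⟨a, b, hab⟩ : ∃ a b, g ++ v :: P ++ (r' ++ [v]) ++ A = a ++ x :: (b ++ [x]) := by
      rcases List.eq_nil_or_concat A with rfl | ⟨A', x', rfl⟩
      · simp at hAx
        subst hAx
        exact ⟨g, P ++ r', by simp⟩
      · have : x' = x := by
          rw [List.concat_eq_append, ← List.cons_append, List.getLast?_concat] at hAx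
          exact Option.some.inj hAx
        subst this
        exact ⟨g ++ v :: A', y :: B ++ (r' ++ [v]) ++ A', by rw [hPA]; simp⟩
    have hroute : ∀ z, F.Route x z → z = y := by
      intro z hz
      by_contra hne
      have := F.route hxr hstep.1 hz.1 (Ne.symm hne) hstep.2.1 hz.2.1 hstep.2.2.1 hz.2.2
      rw [hstep.2.2.2] at this
      cases this
    have hsat : (T.state (g ++ v :: P ++ (r' ++ [v]) ++ A)).cur = x ∧
        (T.state (g ++ v :: P ++ (r' ++ [v]) ++ A)).sat = true := by
      rw [hab] at hgood ⊢
      exact T.decision_sat hgood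
    have hmode : (T.state (g ++ v :: P ++ ((r' ++ [v]) ++ A))).mode x ≤ 2 := by
      have hx : x ∈ g ++ v :: P := List.mem_append_right _ hxm
      rw [T.mode_append hrs _ hx]
      exact hm x hxm
    rw [← List.append_assoc] at hmode
    have hyA : y ∉ A := by
      intro hy
      obtain ⟨c, d, rfl⟩ := List.append_of_mem hy
      have hc : (y :: (d ++ y :: B)).IsChain (F.Step v) := hch.suffix ⟨v :: c, by rw [hPA]; simp⟩
      exact lt_irrefl _ (hrank _ _ hc y (by simp)).1
    have hyB : y ∉ B := by
      intro hy
      have hc : (y :: B).IsChain (F.Step v) := hch.suffix ⟨v :: A, by rw [hPA]; simp⟩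
      exact lt_irrefl _ (hrank _ _ hc y hy).1
    have hyP : y ∈ P := by rw [hPA]; simp
    have hyv : y ≠ v := by rintro rfl; exact hvP hyP
    have hnext : T.Val (g ++ v :: P ++ (r' ++ [v]) ++ A ++ [y])
        (Entry.after (decide (Odd B.length))
          (Entry.mk (I.costs y B).1 (I.costs y B).2 0) (T.S u).pay).pay := by
      rw [List.append_assoc _ A]
      refine ih (A ++ [y]) y (by rw [hPA]; simp) (by simp [List.getLast?_cons]) ?_
      rw [← List.append_assoc]
      refine hgood.snoc hlast hxt hstep.1 ?_
      have e : g ++ v :: P ++ (r' ++ [v]) ++ A =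
          (g ++ v :: A) ++ y :: (B ++ (r' ++ [v]) ++ A) := by rw [hPA]; simp
      have hn := hgood.noEven
      have ho := hodd hn.prefix
      rw [e] at hn ⊢
      refine hn.append_old ?_ ?_ ?_
      · have := hPg y hyP
        simp [this, hyv, hyA]
      · have := hrP y hyP
        simp at this ⊢
        exact ⟨hyB, this.1, this.2, hyA⟩
      · rw [hPA] at ho
        simp at ho ⊢
        grind
    have e : (Entry.after (decide (Odd (y :: B).length))
        (Entry.mk (I.costs x (y :: B)).1 (I.costs x (y :: B)).2 0) (T.S u).pay).pay =
        (Entry.go (I.cost x y) y (Entry.after (decide (Odd B.length))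
          (Entry.mk (I.costs y B).1 (I.costs y B).2 0) (T.S u).pay).pay).pay := by
      rw [Entry.go_after]
      have : decide (Odd (y :: B).length) = !decide (Odd B.length) := by
        rw [List.length_cons, ← decide_not, decide_eq_decide, Nat.odd_add_one]
      rw [this]
      cases (T.S u).pay <;> simp [Game.costs]
    rw [e]
    refine T.val_step hgood.head hlast hxt (fun z haz => ?_)
      (Or.inr ⟨y, _, hstep.1, hnext, rfl⟩) (fun hB => ?_)
    · by_cases hz : F.Route x z
      · rw [hroute z hz]
        exact ⟨_, hnext, le_refl _⟩
      · refine ⟨none, ?_, by simp⟩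
        rw [hab]
        exact T.dead_sat hxr hxl haz hz
    · rw [Entry.vert_go hB]
      unfold decision
      rw [hsat.1, hsat.2]
      simp only [if_true, hmode]
      -- The entry `S x` is computed from `EU y` and need not be the value of this position. Its
      -- vertex is right nevertheless: `y` is the only candidate and its entry is finite.
      have hy := (T.low_ne_top hT _ y rfl (hxr.tail hstep.1) hstep.2.2.1).2
      have hS := hT.S x hxr
      have hne : T.S x ≠ ⊤ := by
        intro h
        have := hS.1 y ⟨hstep.1, hstep.2.1, hstep.2.2.1⟩
        rw [h, top_le_iff, Entry.go_eq_top, Entry.pay_eq_none] at this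
        exact hy this
      obtain ⟨z, hz, h⟩ := hS.2.resolve_left hne
      rw [hroute z hz] at h
      rw [h] at hne ⊢
      exact Entry.vert_go hne

/-- A cycle has just been entered at its top `u`; the way from the top is a single arc. -/
theorem stateC_of_hang (hT : T.Valid) {h₀ : List (Fin n)} {u x : Fin n} (hg : Good I (h₀ ++ [u]))
    (hu₀ : u ∉ h₀) (hgx : Good I (h₀ ++ [u] ++ [x])) (hfr : x ∉ h₀ ++ [u]) (hx : F.Route u x)
    (htx : F.top x = some u) (hmu : (T.state (h₀ ++ [u])).mode u ≤ 2)
    (hmx : (T.state (h₀ ++ [u] ++ [x])).mode x = 1) : T.StateC (h₀ ++ [u] ++ [x]) x := by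
  refine ⟨hgx, ⟨_, rfl, hfr⟩, hx.2.2, hmx, fun v hv => ?_⟩
  rw [htx] at hv
  cases hv
  obtain ⟨h1, h2, h3⟩ := hT.par_side u x (hg.reach (by simp)) hx.1 hx.2.1 htx
  refine ⟨h₀, [x], by simp, by simp, hu₀, ?_, ?_, ?_, ?_, ?_⟩
  · simp at hfr ⊢
    exact hfr.1
  · simp only [List.isChain_cons_cons, List.isChain_singleton, and_true]
    exact ⟨hx.1, hx.2.1, hx.2.2, htx⟩
  · simp [Game.costs, h2, h3]
  · simp [h1]
  · intro z hz
    simp at hz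
    rcases hz with rfl | rfl
    · rw [T.mode_append hg.head _ (by simp)]
      exact hmu
    · omega

/-- The way from the top is prolonged along the cycle, and `par_step` updates its parity and totals.
-/
theorem stateC_of_suc (hT : T.Valid) {h : List (Fin n)} {u x v : Fin n} (hs : T.StateC h u)
    (hgx : Good I (h ++ [x])) (hfr : x ∉ h) (hx : F.Route u x)
    (hv : F.top u = some v) (htx : F.top x = some v)
    (hmx : (T.state (h ++ [x])).mode x = 1) : T.StateC (h ++ [x]) x := by
  refine ⟨hgx, ⟨_, rfl, hfr⟩, hx.2.2, hmx, fun v' hv' => ?_⟩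
  rw [htx] at hv'
  cases hv'
  obtain ⟨g, P, hdec, hPl, hvg, hPg, hch, hcost, hpar, hmode⟩ := hs.path v hv
  have hur : I.Reach u := by
    obtain ⟨h₀, h1, -⟩ := hs.fresh
    exact hs.good.reach (by rw [h1]; simp)
  obtain ⟨h1, h2, h3⟩ := hT.par_step u x v hur hx.1 hx.2.1 htx hv
  refine ⟨g, P ++ [x], by rw [hdec]; simp, by simp, hvg, ?_, ?_, ?_, ?_, ?_⟩
  · intro z hz
    simp at hz
    rcases hz with hz | rfl
    · exact hPg z hz
    · rw [hdec] at hfr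
      simp at hfr
      exact hfr.1
  · rw [← List.cons_append, List.isChain_append]
    refine ⟨hch, by simp, ?_⟩
    intro a ha b hb
    rw [List.getLast?_cons, hPl] at ha
    simp at ha hb
    subst ha hb
    exact ⟨hx.1, hx.2.1, hx.2.2, htx⟩
  · rw [costs_concat I x P v u (by rw [List.getLast?_cons, hPl]; rfl), hcost, h2, h3, hpar]
    by_cases ho : Odd P.length <;> simp [ho]
  · rw [h1, hpar, ← decide_not, decide_eq_decide, List.length_append, List.length_singleton,
      Nat.odd_add_one]
  · intro z hz
    rw [← List.cons_append] at hz
    rcases List.mem_append.1 hz with hz | hz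
    · rw [T.mode_append hs.good.head _ (by rw [hdec]; exact List.mem_append_right _ hz)]
      exact hmode z hz
    · simp at hz
      subst hz
      omega

/-- Besides descents and detours there could only be the move round the cycle, which is blocked. A
descent into a cycle with top `u` opens a new cycle and uses `EC`; a descent along the cycle of `u`
inherits the blocking vertex. -/
theorem val_EU (hT : T.Valid) {u : Fin n}
    (IHC : ∀ x h, F.rank x < F.rank u → T.StateC h x → T.Val h (T.EC x).pay)
    (IH : ∀ x h, F.rank x < F.rank u → T.StateU h x → T.Val h (T.EU x).pay)
    {h : List (Fin n)} (hs : T.StateU h u) (hut : u ≠ I.t) (hl : F.low u) :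
    T.Val h (T.EU u).pay := by
  obtain ⟨h₀, rfl, hu₀⟩ := hs.fresh
  have hg := hs.good
  have hmode := hs.mode
  have hur : I.Reach u := hg.reach (by simp)
  obtain ⟨hcur, hsat⟩ := T.decision_fresh hg hu₀
  have hroute : ∀ x, F.Route u x → T.Val (h₀ ++ [u] ++ [x])
      (if F.top x = some u then T.EC x else T.EU x).pay := by
    intro x hx
    have hfr := fresh_of_fresh hg hu₀ F hx.1 hx.2.1
    have hgx : Good I (h₀ ++ [u] ++ [x]) :=
      hg.snoc (by simp) hut hx.1 (hg.noEven.append_new hfr)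
    have hm : (T.state (h₀ ++ [u] ++ [x])).mode x = if F.top x = some u then 1 else 2 := by
      rw [T.mode_new hg.head hfr]
      unfold newMode
      rw [hsat, hcur]
      simp [hmode, hx.2.2]
    split_ifs with htx
    · rw [if_pos htx] at hm
      exact IHC x _ hx.2.1 (T.stateC_of_hang hT hg hu₀ hgx hfr hx htx (by omega) hm)
    · rw [if_neg htx] at hm
      refine IH x _ hx.2.1 ⟨hgx, ⟨_, rfl, hfr⟩, hx.2.2, hm, fun v hv => ?_⟩
      rcases F.arc hur hx.1 with ⟨ht, h⟩ | ⟨-, h⟩ | ⟨-, h⟩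
      · obtain ⟨v', hv'⟩ := Option.ne_none_iff_exists'.1 ht
        rcases F.suc_spec hv' with ⟨h1, -, h2 | ⟨-, h2⟩⟩
        · have := hx.2.1
          rw [h, h2] at this
          omega
        · rw [← h, hv] at h2
          cases h2
          obtain ⟨z, a, b, c, e, hz⟩ := hs.blocked v hv'
          exact ⟨z, a, b, c ++ [x], by rw [e]; simp, hz⟩
      · exact absurd h htx
      · rw [hv] at h; cases h
  have hE := hT.EU u hur
  rw [if_neg hut, min_top_right] at hE
  refine T.val_step hg.head (by simp) hut (fun x hax => ?_) ?_ (fun _ => ?_)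
  · by_cases hx : F.Route u x
    · exact ⟨_, hroute x hx, by rw [hE]; exact (min_le_left _ _).trans ((hT.rtU u hur).1 x hx)⟩
    · rcases arc_side_of_not_route hur hax hx with ⟨ht, rfl⟩ | hx | ⟨-, h1, h2⟩
      · refine ⟨none, fun q hp => ?_, by simp⟩
        have hp' : I.IsPlay (h₀ ++ [u] ++ F.suc u :: q) := by simpa using hp
        obtain ⟨v, hv⟩ := Option.ne_none_iff_exists'.1 ht
        have hm := top_mem_of_suc hp' hv hx
        obtain ⟨z, a, b, c, e, hz⟩ := hs.blocked v hv
        have hzr : I.Reach z := hg.reach (by rw [e]; simp)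
        have hzm : z ∈ F.suc u :: q := by
          rcases hz with rfl | ⟨hz, hzl⟩
          · exact hm
          · exact low_mem_of_mem (F.top_reach hur hv) hzr hp' hm hz hzl
        rw [e] at hp'
        exact play_third' hp' hzm
      · exact ⟨_, T.val_side hT IH hg hu₀ hut hl (Or.inr hmode) hx, by
          rw [hE]
          exact (min_le_right _ _).trans (T.after_R_le hT hur hx _)⟩
      · exact ⟨none, T.dead_exit h1 h2, by simp⟩
  · rw [hE]
    rcases min_choice (T.rtU u) (Entry.after true (T.det u) (T.S u).pay) with h | h
    · rw [h]
      rcases (hT.rtU u hur).2 with h | ⟨x, hx, h⟩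
      · exact Or.inl h
      · exact Or.inr ⟨x, _, hx.1, hroute x hx, h⟩
    · rw [h]
      rcases (hT.det u hur).2 with h | ⟨x, hx, h⟩
      · left; rw [h, Entry.after_top]
      · refine Or.inr ⟨x, _, hx.1, T.val_side hT IH hg hu₀ hut hl (Or.inr hmode) hx, ?_⟩
        rw [h]
        exact (Entry.go_after _ _ false _ _).symm
  · unfold decision
    rw [hsat, hcur]
    simp [hmode]

/-- Here the walk may also go round the cycle of `u`: `val_R` governs the way back to the top, with
the value given by `val_loop` as its continuation. -/
theorem val_EC (hT : T.Valid) {u : Fin n}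
    (IHC : ∀ x h, F.rank x < F.rank u → T.StateC h x → T.Val h (T.EC x).pay)
    (IH : ∀ x h, F.rank x < F.rank u → T.StateU h x → T.Val h (T.EU x).pay)
    {h : List (Fin n)} (hs : T.StateC h u) (hut : u ≠ I.t) (hl : F.low u) :
    T.Val h (T.EC u).pay := by
  obtain ⟨h₀, rfl, hu₀⟩ := hs.fresh
  have hg := hs.good
  have hmode := hs.mode
  have hur : I.Reach u := hg.reach (by simp)
  obtain ⟨hcur, hsat⟩ := T.decision_fresh hg hu₀
  have hroute : ∀ x, F.Route u x → T.Val (h₀ ++ [u] ++ [x]) (T.EC x).pay := by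
    intro x hx
    have hfr := fresh_of_fresh hg hu₀ F hx.1 hx.2.1
    have hgx : Good I (h₀ ++ [u] ++ [x]) :=
      hg.snoc (by simp) hut hx.1 (hg.noEven.append_new hfr)
    have hm : (T.state (h₀ ++ [u] ++ [x])).mode x = 1 := by
      rw [T.mode_new hg.head hfr]
      unfold newMode
      rw [hsat, hcur]
      simp [hmode, hx.2.2]
    refine IHC x _ hx.2.1 ?_
    rcases F.arc hur hx.1 with ⟨ht, h⟩ | ⟨-, h⟩ | ⟨-, h⟩
    · obtain ⟨v', hv'⟩ := Option.ne_none_iff_exists'.1 ht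
      rcases F.suc_spec hv' with ⟨h1, -, h2 | ⟨-, h2⟩⟩
      · have := hx.2.1
        rw [h, h2] at this
        omega
      · rw [← h] at h2
        exact T.stateC_of_suc hT hs hgx hfr hx hv' h2 hm
    · exact T.stateC_of_hang hT hg hu₀ hgx hfr hx h (by omega) hm
    · exact ⟨hgx, ⟨_, rfl, hfr⟩, hx.2.2, hm, fun v hv => by rw [hv] at h; cases h⟩
  have hloop : F.top u ≠ none → ¬ F.Route u (F.suc u) → ∃ y, T.Val (h₀ ++ [u] ++ [F.suc u]) y ∧
      Entry.after true (T.loop u) (T.S u).pay = Entry.go (I.cost u (F.suc u)) (F.suc u) y := by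
    intro ht hnr
    obtain ⟨v, hv⟩ := Option.ne_none_iff_exists'.1 ht
    obtain ⟨g, P, hdec, hPl, hvg, hPg, hch, hcost, hpar, hmP⟩ := hs.path v hv
    have hvr := F.top_reach hur hv
    obtain ⟨huv, hasuc, hsuc⟩ := F.suc_spec hv
    have huP : u ∈ P := List.mem_of_getLast? hPl
    have hvP : v ∉ P := by
      intro h
      have : ∀ (Q : List (Fin n)) (w : Fin n), (w :: Q).IsChain (F.Step v) →
          ∀ z ∈ Q, F.rank z < F.rank w := by
        intro Q
        induction Q with
        | nil => intro w _ z hz; simp at hz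
        | cons y Q ih =>
          intro w hc z hz
          rw [List.isChain_cons_cons] at hc
          rcases List.mem_cons.1 hz with rfl | hz
          · exact hc.1.2.1
          · exact (ih y hc.2 z hz).trans hc.1.2.1
      exact lt_irrefl _ (this P v hch v h)
    have hPrank : ∀ z ∈ P, F.rank u ≤ F.rank z := by
      obtain ⟨P', hP'⟩ := List.getLast?_eq_some_iff.1 hPl
      have : ∀ (Q : List (Fin n)), (Q ++ [u]).IsChain (F.Step v) →
          ∀ z ∈ Q, F.rank u ≤ F.rank z := by
        intro Q
        induction Q with
        | nil => intro _ z hz; simp at hz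
        | cons y Q ih =>
          intro hc z hz
          rw [List.cons_append] at hc
          rcases List.mem_cons.1 hz with rfl | hz
          · cases Q with
            | nil =>
              rw [List.nil_append, List.isChain_cons_cons] at hc
              exact hc.1.2.1.le
            | cons y' Q =>
              rw [List.cons_append, List.isChain_cons_cons] at hc
              exact (ih hc.2 y' (by simp)).trans hc.1.2.1.le
          · exact ih hc.tail z hz
      intro z hz
      rw [hP'] at hz hch
      rcases List.mem_append.1 hz with hz | hz
      · exact this P' hch.tail z hz
      · simp at hz; rw [hz]
    -- Apart from `v`, the way back runs through vertices of smaller rank than `u` and so avoids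
    -- `P`. Hence the repetition of `P` is admissible whichever way back was taken, as `val_R`
    -- demands.
    have hcont : ∀ r, Good I (h₀ ++ [u] ++ r) → r.head? = some (F.suc u) → r.getLast? = some v →
        v ∉ r.dropLast → (∀ z ∈ r, z = v ∨ F.rank z < F.rank u) → T.Val (h₀ ++ [u] ++ r)
          (Entry.after (T.par u) (Entry.mk (T.pa u) (T.pb u) 0) (T.S u).pay).pay := by
      intro r hgr hrh hrl hvr' hzr
      have := T.val_loop hT (g := g) (r := r) IH hut hl P hPl hPg hch hrh hnr hrl (by
          intro z hz hzr'
          rcases hzr z hzr' with h | h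
          · exact hvP (h ▸ hz)
          · have := hPrank z hz
            omega) (by rw [← hdec]; exact hg.head) (by rw [← hdec]; exact hmP) P [] v rfl (by simp)
        (by rw [← hdec]; simpa using hgr)
      rw [← hdec, hcost, ← hpar] at this
      simpa using this
    obtain ⟨y, hy⟩ : ∃ y, y = (Entry.after (T.par u) (T.next (T.par u) u)
        (Entry.after (T.par u) (Entry.mk (T.pa u) (T.pb u) 0) (T.S u).pay).pay).pay := ⟨_, rfl⟩
    refine ⟨y, ?_, ?_⟩
    · rcases hsuc with hsv | ⟨hsr, hts⟩
      · have hn : T.next (T.par u) u = if T.par u then ⊤ else Entry.mk 0 0 0 := by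
          unfold next
          rw [hv, hsv, if_pos rfl]
        rw [hn] at hy
        have hval := hcont [v]
        rw [hsv]
        cases hp : T.par u with
        | true =>
          simp [hp] at hy
          rw [hy]
          intro q hq
          have h1 : NoEven (h₀ ++ [u] ++ [v] ++ q) := hq.noEvenCycle
          rw [hdec] at h1
          have h2 : Odd (P.length + 1) := NoEven.odd (a := g) (c := q) (v := v) (by simpa using h1)
          rw [hp] at hpar
          have h3 : Odd P.length := of_decide_eq_true hpar.symm
          grind
        | false =>
          rw [hp] at hy hval
          simp only [Bool.false_eq_true, if_false, Entry.pay_after_zero] at hy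
          rw [hy]
          have h3 : ¬ Odd P.length := by rw [hp] at hpar; exact of_decide_eq_false hpar.symm
          refine hval ?_ (by rw [hsv]; rfl) rfl (by simp) (by simp)
          refine hg.snoc (by simp) hut (hsv ▸ hasuc) ?_
          have := hg.noEven
          rw [hdec] at this ⊢
          exact this.append_old hvg hvP (by grind)
      · have hsv : F.suc u ≠ v := fun h => by rw [h] at hsr; omega
        have hn : T.next (T.par u) u = T.R (T.par u) (F.suc u) := by
          unfold next
          rw [if_neg]
          rw [hv]
          simpa using hsv.symm
        rw [hn] at hy
        have hfr := fresh_of_fresh hg hu₀ F hasuc hsr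
        have hnl : ¬ F.low (F.suc u) := fun h => hnr ⟨hasuc, hsr, h⟩
        rw [hy]
        refine T.val_R hT _ (F.suc u) rfl (T.par u) (h₀ ++ [u]) v g (P ++ [F.suc u]) _
          (hg.snoc (by simp) hut hasuc (hg.noEven.append_new hfr)) hfr hts hnl
          (by rw [hdec]; simp) hvg (by simp [hvP, hsv.symm]) ?_ ?_ ?_
        · rw [List.length_append, List.length_singleton, hpar]
          by_cases h : Odd P.length <;> (simp [h]; try grind)
        · rw [T.mode_new hg.head hfr]
          unfold newMode
          rw [hsat, hcur]
          have : v ≠ u := by rintro rfl; exact hvP huP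
          simp [hmode, hnl, hts, this]
        · intro r hgr hrl hvr' hzr
          have := hcont (F.suc u :: r) (by simpa using hgr) rfl
            (by rw [List.getLast?_cons, hrl]; rfl) (by
              rw [List.dropLast_cons_of_ne_nil (by rintro rfl; simp at hrl)]
              simp [hvr', hsv.symm]) (by
              intro z hz
              rcases List.mem_cons.1 hz with rfl | hz
              · exact Or.inr hsr
              · rcases hzr z hz with h | h
                · exact Or.inl h
                · exact Or.inr (by omega))
          simpa using this
    · rw [hy, hT.loop u hur ht hnr]
      -- The way back and the repeated `P` have the same parity, so together they leave the roles of
      -- the players unchanged.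
      rw [Entry.after_after, Bool.xor_self, Entry.go_after]
      cases (T.S u).pay with
      | none => simp
      | some q =>
        rcases Entry.cases (T.next (T.par u) u) with h | ⟨a, b, w, h⟩ <;> rw [h] <;>
          cases T.par u <;> simp [add_assoc]
  have hE := hT.EC u hur
  rw [if_neg hut, min_top_right] at hE
  refine T.val_step hg.head (by simp) hut (fun x hax => ?_) ?_ (fun _ => ?_)
  · by_cases hx : F.Route u x
    · exact ⟨_, hroute x hx, by
        rw [hE]
        exact (min_le_left _ _).trans ((min_le_left _ _).trans ((hT.rtC u hur).1 x hx))⟩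
    · rcases arc_side_of_not_route hur hax hx with ⟨ht, rfl⟩ | hx | ⟨-, h1, h2⟩
      · obtain ⟨y, h1, h2⟩ := hloop ht hx
        exact ⟨y, h1, by rw [hE, ← h2]; exact min_le_right _ _⟩
      · exact ⟨_, T.val_side hT IH hg hu₀ hut hl (Or.inl hmode) hx, by
          rw [hE]
          exact (min_le_left _ _).trans ((min_le_right _ _).trans (T.after_R_le hT hur hx _))⟩
      · exact ⟨none, T.dead_exit h1 h2, by simp⟩
  · rw [hE]
    rcases min_choice (min (T.rtC u) (Entry.after true (T.det u) (T.S u).pay))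
      (Entry.after true (T.loop u) (T.S u).pay) with h | h <;> rw [h]
    · rcases min_choice (T.rtC u) (Entry.after true (T.det u) (T.S u).pay) with h | h <;> rw [h]
      · rcases (hT.rtC u hur).2 with h | ⟨x, hx, h⟩
        · exact Or.inl h
        · exact Or.inr ⟨x, _, hx.1, hroute x hx, h⟩
      · rcases (hT.det u hur).2 with h | ⟨x, hx, h⟩
        · left; rw [h, Entry.after_top]
        · refine Or.inr ⟨x, _, hx.1, T.val_side hT IH hg hu₀ hut hl (Or.inl hmode) hx, ?_⟩
          rw [h]
          exact (Entry.go_after _ _ false _ _).symm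
    · by_cases ht : F.top u = none ∨ F.Route u (F.suc u)
      · left; rw [hT.loop_top u hur ht, Entry.after_top]
      · push Not at ht
        obtain ⟨y, h1, h2⟩ := hloop ht.1 ht.2
        obtain ⟨v, hv⟩ := Option.ne_none_iff_exists'.1 ht.1
        exact Or.inr ⟨_, y, (F.suc_spec hv).2.1, h1, h2⟩
  · unfold decision
    rw [hsat, hcur]
    simp [hmode]

/-- The two kinds of first visits refer to each other, but only at vertices of smaller rank. -/
theorem val_E (hT : T.Valid) : ∀ (k : ℕ) (u : Fin n), F.rank u = k →
    (∀ h, T.StateC h u → T.Val h (T.EC u).pay) ∧ (∀ h, T.StateU h u → T.Val h (T.EU u).pay) := by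
  intro k
  induction k using Nat.strong_induction_on with
  | _ k ih =>
    intro u hk
    have IHC : ∀ x h, F.rank x < F.rank u → T.StateC h x → T.Val h (T.EC x).pay :=
      fun x h hr => (ih _ (hk ▸ hr) x rfl).1 h
    have IHU : ∀ x h, F.rank x < F.rank u → T.StateU h x → T.Val h (T.EU x).pay :=
      fun x h hr => (ih _ (hk ▸ hr) x rfl).2 h
    by_cases hut : u = I.t
    -- No route starts at `t`, so `S` is `⊤` there, excursions do not contribute, and both entries
    -- are zero.
    · have key : ∀ h, Good I h → (∃ h₀, h = h₀ ++ [u] ∧ u ∉ h₀) → T.Val h (some (0, 0)) ∧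
          T.EC u = Entry.mk 0 0 0 ∧ T.EU u = Entry.mk 0 0 0 := by
        rintro h hg ⟨h₀, rfl, hu₀⟩
        have hur : I.Reach u := hg.reach (by simp)
        have hno : ∀ w, ¬ F.Route u w := fun w hw =>
          F.rank_target hw.2.1 (hur.tail hw.1) hw.2.2 hut
        have h1 : T.S u = ⊤ := (hT.S u hur).2.resolve_right fun ⟨w, hw, _⟩ => hno w hw
        have h2 : T.rtC u = ⊤ := (hT.rtC u hur).2.resolve_right fun ⟨w, hw, _⟩ => hno w hw
        have h3 : T.rtU u = ⊤ := (hT.rtU u hur).2.resolve_right fun ⟨w, hw, _⟩ => hno w hw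
        refine ⟨T.val_target hg.head hg.arcs hg.noEven ?_ (by simp [hut]), ?_, ?_⟩
        · rw [List.dropLast_concat, ← hut]; exact hu₀
        · rw [hT.EC u hur, h1, h2, if_pos hut]
          simp
        · rw [hT.EU u hur, h1, h3, if_pos hut]
          simp
      refine ⟨fun h hs => ?_, fun h hs => ?_⟩
      · obtain ⟨h1, h2, -⟩ := key h hs.good hs.fresh
        rw [h2]; exact h1
      · obtain ⟨h1, -, h2⟩ := key h hs.good hs.fresh
        rw [h2]; exact h1
    · exact ⟨fun h hs => T.val_EC hT IHC IHU hs hut hs.low,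
        fun h hs => T.val_EU hT IHC IHU hs hut hs.low⟩

/-- The simulation follows the path of the subgame perfect equilibrium. -/
theorem exists_outcome (hT : T.Valid) (ht : I.Reach I.t) :
    ∃ q, I.IsPlay (I.s :: q) ∧ I.Outcome [I.s] q ∧ T.Sim (start I) q := by
  have hs : I.Reach I.s := Relation.ReflTransGen.refl
  -- The start has no top, so the walk from `s` to `t` given by `ht` leaves only the first case of
  -- `low_or_top`.
  have hlow : F.low I.s := by
    obtain ⟨l, hl, hc⟩ := List.exists_isChain_cons_of_relationReflTransGen ht
    rcases F.low_or_top l I.s hs hl (by rw [List.getLast?_eq_some_getLast (by simp), hc]) with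
      h | ⟨v, h, -⟩
    · exact h
    · rw [F.top_start] at h; cases h
  have hst : T.state [I.s] = start I := rfl
  have hC : T.StateC [I.s] I.s := by
    refine ⟨⟨rfl, by simp, ?_, by simp⟩, ⟨[], rfl, by simp⟩, hlow, ?_, ?_⟩
    · intro i j hij hj
      simp at hj
      omega
    · rw [hst]; simp [start]
    · intro v hv
      rw [F.top_start] at hv; cases hv
  have hv := (T.val_E hT _ I.s rfl).1 _ hC
  have hne := (T.low_ne_top hT _ I.s rfl hs hlow).1
  rcases Entry.cases (T.EC I.s) with h | ⟨a, b, v, h⟩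
  · exact absurd h hne
  · rw [h, Entry.pay_mk] at hv
    obtain ⟨q, u, h1, h2, h3, h4, h5⟩ := hv
    exact ⟨q, h1, h2, h5⟩

end Tables
end ShortestPathGame

/-! ### Every ranking of a directed cactus graph yields a layout -/

namespace ShortestPathGame

/-! ### Cycles of a cactus graph -/

/-- Let `s(a, a')` be the first edge of the cycle and `s(b, b')` the edge following `b`. If `b` were
connected to `a` without cycle edges, then, without `s(a, a')`, the ends of `s(b, b')` would remain
connected after removing `s(b, b')`, because the rest of the cycle leads from `b'` to `a`. So `s(b,
b')` would lie on a second cycle, which misses `s(a, a')`, contrary to the cactus property. -/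
theorem IsCactus.not_reachable_start {V : Type*} {H : SimpleGraph V} (hH : IsCactus H) {a b : V}
    (c : H.Walk a a) (hc : c.IsCycle) (hb : b ∈ c.support) (hab : b ≠ a) :
    ¬ (H.deleteEdges {e | e ∈ c.edges}).Reachable b a := by
  classical
  intro hr
  cases c with
  | nil => simp at hb; exact hab hb
  | @cons _ a' _ h p =>
    rw [SimpleGraph.Walk.cons_isCycle_iff] at hc
    obtain ⟨hp, he⟩ := hc
    have hbp : b ∈ p.support := by
      rw [SimpleGraph.Walk.support_cons] at hb
      exact (List.mem_cons.1 hb).resolve_left hab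
    have hsplit := p.take_spec hbp
    -- the rest of the path from `b` to `a`
    generalize hq : p.dropUntil b hbp = q at hsplit
    cases q with
    | nil => exact hab rfl
    | @cons _ b' _ hbb' q =>
      have hqe : ∀ e ∈ (SimpleGraph.Walk.cons hbb' q).edges, e ∈ p.edges := by
        intro e h'
        rw [← hsplit, SimpleGraph.Walk.edges_append]
        exact List.mem_append_right _ h'
      have hqp : (SimpleGraph.Walk.cons hbb' q).IsPath := by
        rw [← hq]
        exact hp.dropUntil hbp
      have hbb'q : s(b, b') ∉ q.edges := by
        have := hqp.isTrail.edges_nodup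
        rw [SimpleGraph.Walk.edges_cons, List.nodup_cons] at this
        exact this.1
      have hmem : s(b, b') ∈ p.edges := hqe _ (by simp)
      -- the graph without the first edge
      let H' := H.deleteEdges {s(a, a')}
      have hadj : H'.Adj b b' := by
        rw [SimpleGraph.deleteEdges_adj]
        refine ⟨hbb', fun h => ?_⟩
        simp only [Set.mem_singleton_iff] at h
        exact he (h ▸ hmem)
      have h1 : (H'.deleteEdges {s(b, b')}).Reachable b a := by
        refine hr.mono ?_
        intro x y hxy
        simp only [H', SimpleGraph.deleteEdges_adj, Set.mem_ofPred_eq, Set.mem_singleton_iff,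
          SimpleGraph.Walk.edges_cons, List.mem_cons, not_or] at hxy ⊢
        refine ⟨⟨hxy.1, hxy.2.1⟩, fun h => hxy.2.2 (h ▸ hmem)⟩
      have h2 : (H'.deleteEdges {s(b, b')}).Reachable b' a := by
        refine ⟨q.transfer _ ?_⟩
        intro e heq
        have hep : e ∈ p.edges := hqe e (by simp [heq])
        simp only [H', SimpleGraph.edgeSet_deleteEdges, Set.mem_sdiff, Set.mem_singleton_iff]
        refine ⟨⟨q.edges_subset_edgeSet heq, ?_⟩, ?_⟩
        · rintro rfl; exact he hep
        · rintro rfl; exact hbb'q heq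
      obtain ⟨x, d, hd, hed⟩ := SimpleGraph.adj_and_reachable_delete_edges_iff_exists_cycle.1
        ⟨hadj, h1.trans h2.symm⟩
      have hle : H' ≤ H := SimpleGraph.deleteEdges_le _
      have hcyc : (SimpleGraph.Walk.cons h p).IsCycle :=
        SimpleGraph.Walk.cons_isCycle_iff _ _ |>.2 ⟨hp, he⟩
      have := (hH (d.mapLe hle) (SimpleGraph.Walk.cons h p) (hd.mapLe hle) hcyc s(b, b')
        (by simpa using hed) (by simp [hmem]) s(a, a')).2 (by simp)
      rw [SimpleGraph.Walk.edges_mapLe_eq_edges] at this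
      have := d.edges_subset_edgeSet this
      simp [H', SimpleGraph.edgeSet_deleteEdges] at this

/-- Two vertices of a cycle are not connected without the edges of the cycle. -/
theorem IsCactus.not_reachable {V : Type*} {H : SimpleGraph V} (hH : IsCactus H) {u a b : V}
    (c : H.Walk u u) (hc : c.IsCycle) (ha : a ∈ c.support) (hb : b ∈ c.support) (hab : a ≠ b) :
    ¬ (H.deleteEdges {e | e ∈ c.edges}).Reachable a b := by
  classical
  have := hH.not_reachable_start (c.rotate b hb) (hc.rotate hb)
    ((SimpleGraph.Walk.mem_support_rotate_iff _ _ _).2 ha) hab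
  have e : {e | e ∈ (c.rotate b hb).edges} = {e | e ∈ c.edges} := by
    ext e
    exact (c.rotate_edges b hb).mem_iff
  rwa [e] at this

/-! ### Rankings by finishing times -/

/-- A ranking as it results from a depth-first search: along the arcs which do not close a cycle
the rank decreases. -/
structure Ranking {n : ℕ} (I : Game n) where
  rank : Fin n → ℕ
  exists_in : ∀ {x}, I.Reach x → x ≠ I.s → ∃ p, I.Reach p ∧ I.graph.Adj p x ∧ rank x < rank p
  back : ∀ {u w}, I.Reach u → I.graph.Adj u w → rank u ≤ rank w →
    Relation.ReflTransGen (fun a b => I.graph.Adj a b ∧ rank b < rank a) w u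
  inj : ∀ {u v}, I.Reach u → I.Reach v → rank u = rank v → u = v

namespace Ranking

variable {n : ℕ} {I : Game n} (K : Ranking I)

/-- There is a walk along which the rank decreases. -/
def Desc : Fin n → Fin n → Prop :=
  Relation.ReflTransGen (fun a b => I.graph.Adj a b ∧ K.rank b < K.rank a)

theorem Desc.le {u v : Fin n} (h : K.Desc u v) : K.rank v ≤ K.rank u := by
  induction h with
  | refl => exact le_refl _
  | tail _ h ih => exact h.2.le.trans ih

theorem Desc.reach {u v : Fin n} (h : K.Desc u v) (hu : I.Reach u) : I.Reach v := by
  induction h with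
  | refl => exact hu
  | tail _ h ih => exact ih.tail h.1

/-- Passing to predecessors of larger rank must end, and it can end only at `s`. -/
theorem desc_start {u : Fin n} (hu : I.Reach u) : K.Desc I.s u := by
  obtain ⟨M, hM⟩ : ∃ M, ∀ x, K.rank x ≤ M :=
    ⟨Finset.univ.sup K.rank, fun x => Finset.le_sup (Finset.mem_univ x)⟩
  induction hk : M - K.rank u using Nat.strong_induction_on generalizing u with
  | _ k ih =>
    by_cases hus : u = I.s
    · subst hus; exact .refl
    · obtain ⟨p, hp, ha, hr⟩ := K.exists_in hu hus
      have := hM p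
      exact (ih _ (by omega) hp rfl).tail ⟨ha, hr⟩

/-- All steps of the walk follow arcs to lower ranks. -/
def IsDesc {H : SimpleGraph (Fin n)} {u v : Fin n} (p : H.Walk u v) : Prop :=
  ∀ d ∈ p.darts, I.graph.Adj d.fst d.snd ∧ K.rank d.snd < K.rank d.fst

section Walk

variable {H : SimpleGraph (Fin n)}

theorem Desc.exists_walk (hO : IsOrientationOf I.graph H) {v u : Fin n} (h : K.Desc v u) :
    ∃ p : H.Walk v u, K.IsDesc p := by
  induction h using Relation.ReflTransGen.head_induction_on with
  | refl => exact ⟨.nil, by simp [IsDesc]⟩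
  | head h _ ih =>
    obtain ⟨p, hp⟩ := ih
    refine ⟨.cons ((hO.1 _ _).2 (Or.inl h.1)) p, ?_⟩
    intro d hd
    rw [SimpleGraph.Walk.darts_cons, List.mem_cons] at hd
    rcases hd with rfl | hd
    · exact h
    · exact hp d hd

variable {K}

theorem IsDesc.cons {u v w : Fin n} {h : H.Adj u v} {p : H.Walk v w}
    (hp : K.IsDesc (.cons h p)) : (I.graph.Adj u v ∧ K.rank v < K.rank u) ∧ K.IsDesc p := by
  constructor
  · exact hp ⟨(u, v), h⟩ (by simp)
  · intro d hd
    exact hp d (by simp [hd])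

theorem IsDesc.rank_le {u v : Fin n} {p : H.Walk u v} (hp : K.IsDesc p) {x : Fin n}
    (hx : x ∈ p.support) : K.rank x ≤ K.rank u ∧ K.rank v ≤ K.rank x ∧
      (x ≠ u → K.rank x < K.rank u) ∧ (x ≠ v → K.rank v < K.rank x) := by
  induction p generalizing x with
  | nil => simp at hx; simp [hx]
  | @cons a b c h p ih =>
    obtain ⟨h1, h2⟩ := hp.cons
    rw [SimpleGraph.Walk.support_cons, List.mem_cons] at hx
    rcases hx with rfl | hx
    · have := ih h2 p.start_mem_support
      refine ⟨le_refl _, by omega, by simp, fun _ => by omega⟩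
    · have := ih h2 hx
      exact ⟨by omega, this.2.1, fun _ => by omega, this.2.2.2⟩

theorem IsDesc.isPath {u v : Fin n} {p : H.Walk u v} (hp : K.IsDesc p) : p.IsPath := by
  induction p with
  | nil => simp
  | @cons a b c h p ih =>
    obtain ⟨h1, h2⟩ := hp.cons
    rw [SimpleGraph.Walk.cons_isPath_iff]
    refine ⟨ih h2, fun ha => ?_⟩
    have := (h2.rank_le ha).1
    omega

theorem IsDesc.exists_pred {u v : Fin n} {p : H.Walk u v} (hp : K.IsDesc p) {x : Fin n}
    (hx : x ∈ p.support) (hxu : x ≠ u) : ∃ y ∈ p.support, I.graph.Adj y x ∧ K.rank x < K.rank y ∧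
      s(y, x) ∈ p.edges := by
  induction p with
  | nil => simp at hx; exact absurd hx hxu
  | @cons a b c h p ih =>
    obtain ⟨h1, h2⟩ := hp.cons
    rw [SimpleGraph.Walk.support_cons, List.mem_cons] at hx
    have hx := hx.resolve_left hxu
    by_cases hxb : x = b
    · subst hxb
      exact ⟨a, by simp, h1.1, h1.2, by simp⟩
    · obtain ⟨y, h3, h4, h5, h6⟩ := ih h2 hx hxb
      exact ⟨y, by simp [h3], h4, h5, by simp [h6]⟩

theorem IsDesc.of_edge (hO : IsOrientationOf I.graph H) {u v : Fin n} {p : H.Walk u v}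
    (hp : K.IsDesc p) {x y : Fin n} (he : s(x, y) ∈ p.edges) (ha : I.graph.Adj x y) :
    x ∈ p.support ∧ y ∈ p.support ∧ K.rank y < K.rank x := by
  refine ⟨p.fst_mem_support_of_mem_edges he, p.snd_mem_support_of_mem_edges he, ?_⟩
  rw [SimpleGraph.Walk.edges, List.mem_map] at he
  obtain ⟨d, hd, h⟩ := he
  have h1 := hp d hd
  rw [SimpleGraph.Dart.edge, Sym2.eq_iff] at h
  rcases h with ⟨h, h'⟩ | ⟨h, h'⟩
  · rw [h, h'] at h1
    exact h1.2
  · rw [h, h'] at h1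
    exact absurd h1.1 (hO.2 _ _ ha)

theorem IsDesc.out_unique (hO : IsOrientationOf I.graph H) {u v : Fin n} {p : H.Walk u v}
    (hp : K.IsDesc p) {x y z : Fin n} (hy : s(x, y) ∈ p.edges) (hay : I.graph.Adj x y)
    (hz : s(x, z) ∈ p.edges) (haz : I.graph.Adj x z) : y = z := by
  induction p with
  | nil => simp at hy
  | @cons a b c h p ih =>
    obtain ⟨h1, h2⟩ := hp.cons
    have key : ∀ w, I.graph.Adj x w → s(x, w) ∈ (SimpleGraph.Walk.cons h p).edges →
        (x = a ∧ w = b) ∨ (s(x, w) ∈ p.edges ∧ x ≠ a) := by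
      intro w haw hw
      rw [SimpleGraph.Walk.edges_cons, List.mem_cons] at hw
      rcases hw with hw | hw
      · rw [Sym2.eq_iff] at hw
        rcases hw with hw | ⟨rfl, rfl⟩
        · exact Or.inl hw
        · exact absurd h1.1 (hO.2 _ _ haw)
      · refine Or.inr ⟨hw, ?_⟩
        rintro rfl
        have := (h2.rank_le (p.fst_mem_support_of_mem_edges hw)).1
        omega
    rcases key y hay hy with ⟨h3, h4⟩ | ⟨h3, h4⟩ <;> rcases key z haz hz with ⟨h5, h6⟩ | ⟨h5, h6⟩
    · rw [h4, h6]
    · exact absurd h3 h6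
    · exact absurd h5 h4
    · exact ih h2 h3 h5

theorem IsDesc.in_unique (hO : IsOrientationOf I.graph H) {u v : Fin n} {p : H.Walk u v}
    (hp : K.IsDesc p) {x y z : Fin n} (hy : s(y, x) ∈ p.edges) (hay : I.graph.Adj y x)
    (hz : s(z, x) ∈ p.edges) (haz : I.graph.Adj z x) : y = z := by
  induction p with
  | nil => simp at hy
  | @cons a b c h p ih =>
    obtain ⟨h1, h2⟩ := hp.cons
    have key : ∀ w, I.graph.Adj w x → s(w, x) ∈ (SimpleGraph.Walk.cons h p).edges →
        (x = b ∧ w = a) ∨ (s(w, x) ∈ p.edges ∧ x ≠ b) := by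
      intro w haw hw
      rw [SimpleGraph.Walk.edges_cons, List.mem_cons] at hw
      rcases hw with hw | hw
      · rw [Sym2.eq_iff] at hw
        rcases hw with hw | ⟨rfl, rfl⟩
        · exact Or.inl hw.symm
        · exact absurd h1.1 (hO.2 _ _ haw)
      · refine Or.inr ⟨hw, ?_⟩
        rintro rfl
        obtain ⟨h3, -, h4⟩ := h2.of_edge hO hw haw
        have := (h2.rank_le h3).1
        omega
    rcases key y hay hy with ⟨h3, h4⟩ | ⟨h3, h4⟩ <;> rcases key z haz hz with ⟨h5, h6⟩ | ⟨h5, h6⟩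
    · rw [h4, h6]
    · exact absurd h3 h6
    · exact absurd h5 h4
    · exact ih h2 h3 h5

theorem IsDesc.exists_succ {u v : Fin n} {p : H.Walk u v} (hp : K.IsDesc p) {x : Fin n}
    (hx : x ∈ p.support) (hxv : x ≠ v) : ∃ y ∈ p.support, I.graph.Adj x y ∧ K.rank y < K.rank x ∧
      s(x, y) ∈ p.edges := by
  induction p with
  | nil => simp at hx; exact absurd hx hxv
  | @cons a b c h p ih =>
    obtain ⟨h1, h2⟩ := hp.cons
    rw [SimpleGraph.Walk.support_cons, List.mem_cons] at hx
    rcases hx with rfl | hx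
    · exact ⟨b, by simp, h1.1, h1.2, by simp⟩
    · obtain ⟨y, h3, h4, h5, h6⟩ := ih h2 hx hxv
      exact ⟨y, by simp [h3], h4, h5, by simp [h6]⟩

variable (K)

/-- The walk `p` descends from `v` to `u`, and an arc leads back from `u` to `v`. -/
structure IsCyc {u v : Fin n} (p : H.Walk v u) : Prop where
  reach : I.Reach u
  arc : I.graph.Adj u v
  lt : K.rank u < K.rank v
  desc : K.IsDesc p

variable {K}

/-! ### Directed cycles of a cactus graph and their tops -/

namespace IsCyc

variable {u v : Fin n} {p : H.Walk v u}

theorem reach_top (hc : K.IsCyc p) : I.Reach v := hc.reach.tail hc.arc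

theorem not_mem (hO : IsOrientationOf I.graph H) (hc : K.IsCyc p) : s(u, v) ∉ p.edges := by
  intro h
  have := (hc.desc.of_edge hO h hc.arc).2.2
  have := hc.lt
  omega

theorem isCycle (hO : IsOrientationOf I.graph H) (hc : K.IsCyc p) :
    (SimpleGraph.Walk.cons ((hO.1 u v).2 (Or.inl hc.arc)) p).IsCycle :=
  (SimpleGraph.Walk.cons_isCycle_iff _ _).2 ⟨hc.desc.isPath, hc.not_mem hO⟩

/-- The graph without the edges of the cycle. -/
def rest (u v : Fin n) (p : H.Walk v u) : SimpleGraph (Fin n) :=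
  H.deleteEdges {e | e = s(u, v) ∨ e ∈ p.edges}

theorem not_reachable (hH : IsCactus H) (hO : IsOrientationOf I.graph H) (hc : K.IsCyc p)
    {a b : Fin n} (ha : a ∈ p.support) (hb : b ∈ p.support) (hab : a ≠ b) :
    ¬ (rest u v p).Reachable a b := by
  have := hH.not_reachable _ (hc.isCycle hO) (a := a) (b := b) (by simp [ha]) (by simp [hb]) hab
  simpa [rest] using this

theorem rest_adj (hO : IsOrientationOf I.graph H) {a b : Fin n} (h : I.graph.Adj a b)
    (h1 : s(a, b) ≠ s(u, v)) (h2 : s(a, b) ∉ p.edges) : (rest u v p).Adj a b := by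
  rw [rest, SimpleGraph.deleteEdges_adj]
  exact ⟨(hO.1 _ _).2 (Or.inl h), by simp only [Set.mem_ofPred_eq, not_or]; exact ⟨h1, h2⟩⟩

theorem eq_of_edge (hO : IsOrientationOf I.graph H) (hc : K.IsCyc p) {a b : Fin n}
    (h : I.graph.Adj a b) (h1 : s(a, b) = s(u, v)) : a = u ∧ b = v := by
  rw [Sym2.eq_iff] at h1
  rcases h1 with h1 | ⟨rfl, rfl⟩
  · exact h1
  · exact absurd hc.arc (hO.2 _ _ h)

/-- From above, a cycle can only be entered at its top. -/
theorem entry (hH : IsCactus H) (hO : IsOrientationOf I.graph H) (hc : K.IsCyc p) {x q : Fin n}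
    (hx : x ∈ p.support) (hxv : x ≠ v) (hq : I.Reach q) (ha : I.graph.Adj q x)
    (hr : K.rank x < K.rank q) : s(q, x) ∈ p.edges := by
  by_contra hqx
  -- All arcs of a descent from `s` to `v` start above `v`, while the cycle has no vertex above `v`.
  have hs : (rest u v p).Reachable I.s v := by
    have key : ∀ z, K.Desc z v → (rest u v p).Reachable z v := by
      intro z hz
      induction hz using Relation.ReflTransGen.head_induction_on with
      | refl => exact .refl _
      | @head a b h hb ih =>
        refine SimpleGraph.Reachable.trans (SimpleGraph.Adj.reachable ?_) ih
        have h1 : K.rank v ≤ K.rank b := Desc.le K hb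
        refine rest_adj hO h.1 (fun he => ?_) (fun he => ?_)
        · obtain ⟨rfl, rfl⟩ := hc.eq_of_edge hO h.1 he
          have := h.2
          have := hc.lt
          omega
        · have := (hc.desc.rank_le (p.fst_mem_support_of_mem_edges he)).1
          have := h.2
          omega
    exact key _ (K.desc_start hc.reach_top)
  -- Along a descent, `y` is the last vertex of the cycle met so far, or `v` if there was none. For
  -- the tail `q` of the given arc it differs from `x`, although the arc joins it to `x` outside the
  -- cycle.
  have key : ∀ z, K.Desc I.s z → ∃ y ∈ p.support, (K.rank z ≤ K.rank y ∨ y = v) ∧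
      (rest u v p).Reachable z y := by
    intro z hz
    induction hz with
    | refl => exact ⟨v, by simp, Or.inr rfl, hs⟩
    | @tail z z' _ h ih =>
      obtain ⟨y, h1, h2, h3⟩ := ih
      by_cases he : s(z, z') = s(u, v)
      · obtain ⟨rfl, rfl⟩ := hc.eq_of_edge hO h.1 he
        exact ⟨z', by simp, Or.inr rfl, .refl _⟩
      · by_cases he' : s(z, z') ∈ p.edges
        · exact ⟨z', p.snd_mem_support_of_mem_edges he', Or.inl le_rfl, .refl _⟩
        · refine ⟨y, h1, h2.imp_left (fun h' => h.2.le.trans h'), ?_⟩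
          exact (rest_adj hO h.1 he he').reachable.symm.trans h3
  obtain ⟨y, h1, h2, h3⟩ := key q (K.desc_start hq)
  refine hc.not_reachable hH hO hx h1 ?_ (SimpleGraph.Reachable.trans ?_ h3)
  · rintro rfl
    rcases h2 with h2 | h2
    · omega
    · exact hxv h2
  · refine (rest_adj hO ha (fun he => ?_) hqx).reachable.symm
    exact hxv (hc.eq_of_edge hO ha he).2

/-- Two cycles which share a vertex below their tops are equal. -/
theorem unique (hH : IsCactus H) (hO : IsOrientationOf I.graph H) (hc : K.IsCyc p)
    {u' v' : Fin n} {p' : H.Walk v' u'} (hc' : K.IsCyc p') {x : Fin n} (hx : x ∈ p.support)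
    (hxv : x ≠ v) (hx' : x ∈ p'.support) (hxv' : x ≠ v') :
    u = u' ∧ v = v' ∧ ∀ e, e ∈ p.edges ↔ e ∈ p'.edges := by
  obtain ⟨q, h1, h2, h3, h4⟩ := hc.desc.exists_pred hx hxv
  have hdesc : ∀ {w}, w ∈ p.support → K.Desc v w := by
    intro w hw
    have aux : ∀ {a b : Fin n} (r : H.Walk a b), K.IsDesc r → ∀ w ∈ r.support, K.Desc a w := by
      intro a b r hr
      induction r with
      | nil => intro w hw; simp at hw; rw [hw]; exact .refl
      | @cons a b c h r ih =>
        intro w hw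
        obtain ⟨g1, g2⟩ := hr.cons
        rw [SimpleGraph.Walk.support_cons, List.mem_cons] at hw
        rcases hw with rfl | hw
        · exact .refl
        · exact .head g1 (ih g2 w hw)
    exact aux p hc.desc w hw
  have hq : I.Reach q := (hdesc h1).reach K hc.reach_top
  -- The arc on which the first cycle enters `x` must also belong to the second one, so the two
  -- cycles share an edge.
  have h5 := hc'.entry hH hO hx' hxv' hq h2 h3
  have hE : ∀ f, (f = s(u, v) ∨ f ∈ p.edges) ↔ (f = s(u', v') ∨ f ∈ p'.edges) := by
    have := hH _ _ (hc.isCycle hO) (hc'.isCycle hO) s(q, x) (by simp [h4]) (by simp [h5])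
    simpa using this
  have mem : ∀ {a b c d : Fin n} {r : H.Walk b a}, s(c, d) = s(a, b) ∨ s(c, d) ∈ r.edges →
      d ∈ r.support := by
    intro a b c d r h
    rcases h with h | h
    · rw [Sym2.eq_iff] at h
      rcases h with ⟨-, rfl⟩ | ⟨-, rfl⟩ <;> simp
    · exact r.snd_mem_support_of_mem_edges h
  have g1 := (hc'.desc.rank_le (mem ((hE s(u, v)).1 (Or.inl rfl)))).1
  have g2 := (hc.desc.rank_le (mem ((hE s(u', v')).2 (Or.inl rfl)))).1
  obtain rfl : v = v' := K.inj hc.reach_top hc'.reach_top (le_antisymm g1 g2)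
  have hu : u = u' := by
    rcases (hE s(u, v)).1 (Or.inl rfl) with h | h
    · exact (hc'.eq_of_edge hO hc.arc h).1
    · have := (hc'.desc.of_edge hO h hc.arc).2.2
      have := hc.lt
      omega
  subst hu
  refine ⟨rfl, rfl, fun e => ?_⟩
  have n1 := hc.not_mem hO
  have n2 := hc'.not_mem hO
  constructor
  · intro h
    exact ((hE e).1 (Or.inr h)).resolve_left (fun h' => n1 (h' ▸ h))
  · intro h
    exact ((hE e).2 (Or.inr h)).resolve_left (fun h' => n2 (h' ▸ h))

end IsCyc

variable (K H)

/-- On some directed cycle with top `v`, the vertex `x ≠ v` is followed by `y`. -/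
def Suc (x v y : Fin n) : Prop :=
  ∃ (u : Fin n) (p : H.Walk v u), K.IsCyc p ∧ x ∈ p.support ∧ x ≠ v ∧
    ((x = u ∧ y = v) ∨ (s(x, y) ∈ p.edges ∧ I.graph.Adj x y))

variable {K H}

theorem Suc.unique (hH : IsCactus H) (hO : IsOrientationOf I.graph H) {x v y v' y' : Fin n}
    (h : K.Suc H x v y) (h' : K.Suc H x v' y') : v = v' ∧ y = y' := by
  obtain ⟨u, p, hc, hx, hxv, hy⟩ := h
  obtain ⟨u', p', hc', hx', hxv', hy'⟩ := h'
  obtain ⟨rfl, rfl, hE⟩ := hc.unique hH hO hc' hx hxv hx' hxv'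
  refine ⟨rfl, ?_⟩
  rcases hy with ⟨rfl, rfl⟩ | ⟨hy, ha⟩ <;> rcases hy' with ⟨h1, rfl⟩ | ⟨hy', ha'⟩
  · rfl
  · obtain ⟨-, h2, h3⟩ := hc'.desc.of_edge hO hy' ha'
    have := (hc'.desc.rank_le h2).2.1
    omega
  · obtain ⟨-, h2, h3⟩ := hc.desc.of_edge hO hy ha
    have := (hc.desc.rank_le h2).2.1
    subst h1
    omega
  · exact hc.desc.out_unique hO hy ha ((hE _).2 hy') ha'

theorem IsCyc.exists_suc {u v : Fin n} {p : H.Walk v u} (hc : K.IsCyc p) {x : Fin n}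
    (hx : x ∈ p.support) (hxv : x ≠ v) : ∃ y, K.Suc H x v y := by
  by_cases h : x = u
  · exact ⟨v, u, p, hc, hx, hxv, Or.inl ⟨h, rfl⟩⟩
  · obtain ⟨y, h1, h2, h3, h4⟩ := hc.desc.exists_succ hx h
    exact ⟨y, u, p, hc, hx, hxv, Or.inr ⟨h4, h2⟩⟩

variable (K H)

open Classical in
/-- The top of the cycle which contains `x` below its top. -/
noncomputable def top (x : Fin n) : Option (Fin n) :=
  if h : ∃ v y, K.Suc H x v y then some h.choose else none

open Classical in
/-- The successor of `x` on its cycle. -/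
noncomputable def suc (x : Fin n) : Fin n :=
  if h : ∃ v y, K.Suc H x v y then h.choose_spec.choose else x

variable {K H}

theorem Suc.eq (hH : IsCactus H) (hO : IsOrientationOf I.graph H) {x v y : Fin n}
    (h : K.Suc H x v y) : K.top H x = some v ∧ K.suc H x = y := by
  have h' : ∃ v y, K.Suc H x v y := ⟨v, y, h⟩
  rw [top, suc, dif_pos h', dif_pos h']
  have := h'.choose_spec.choose_spec.unique hH hO h
  exact ⟨by rw [this.1], this.2⟩

theorem suc_of_top {x v : Fin n} (h : K.top H x = some v) : K.Suc H x v (K.suc H x) := by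
  by_cases h' : ∃ v y, K.Suc H x v y
  · rw [top, dif_pos h'] at h
    rw [suc, dif_pos h']
    have := h'.choose_spec.choose_spec
    obtain rfl := Option.some.inj h
    exact this
  · rw [top, dif_neg h'] at h
    cases h

/-- Both descents end in `t`. Without the edges of the cycle, the descent through `w` joins `t` to a
cycle vertex of rank at most `K.rank w`, whereas the descent through `w'` never meets the cycle and
joins `t` to `u`. Two different vertices of the cycle would be connected. -/
theorem IsCyc.route (hH : IsCactus H) (hO : IsOrientationOf I.graph H) {v₀ u₀ : Fin n}
    {p : H.Walk v₀ u₀} (hc : K.IsCyc p) {u w w' : Fin n} (hu : I.Reach u)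
    (hw : w ∈ p.support) (hwv : w ≠ v₀)
    (ha : I.graph.Adj u w) (ha' : I.graph.Adj u w') (hne : w ≠ w') (hr : K.rank w < K.rank u)
    (hr' : K.rank w' < K.rank u) (hl : K.Desc w I.t) (hl' : K.Desc w' I.t) : False := by
  have he := hc.entry hH hO hw hwv hu ha hr
  have hus := p.fst_mem_support_of_mem_edges he
  have hmax := (hc.desc.rank_le hus).1
  have he' : s(u, w') ∉ p.edges := fun h => hne (hc.desc.out_unique hO he ha h ha')
  have claim1 : ∀ z, K.Desc w z → ∃ y ∈ p.support, K.rank y ≤ K.rank w ∧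
      (IsCyc.rest u₀ v₀ p).Reachable z y := by
    intro z hz
    induction hz with
    | refl => exact ⟨w, hw, le_rfl, .refl _⟩
    | @tail z z' hz h ih =>
      obtain ⟨y, h1, h2, h3⟩ := ih
      have hzw : K.rank z ≤ K.rank w := Desc.le K hz
      by_cases g : s(z, z') = s(u₀, v₀)
      · obtain ⟨rfl, rfl⟩ := hc.eq_of_edge hO h.1 g
        have := h.2
        have := hc.lt
        omega
      · by_cases g' : s(z, z') ∈ p.edges
        · exact ⟨z', p.snd_mem_support_of_mem_edges g', h.2.le.trans hzw, .refl _⟩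
        · exact ⟨y, h1, h2, (IsCyc.rest_adj hO h.1 g g').reachable.symm.trans h3⟩
  have claim2 : ∀ z, K.Desc w' z → z ∉ p.support ∧ (IsCyc.rest u₀ v₀ p).Reachable z u := by
    intro z hz
    induction hz with
    | refl =>
      constructor
      · intro hm
        refine he' (hc.entry hH hO hm ?_ hu ha' hr')
        rintro rfl
        omega
      · refine (IsCyc.rest_adj hO ha' (fun h => ?_) he').reachable.symm
        obtain ⟨rfl, rfl⟩ := hc.eq_of_edge hO ha' h
        omega
    | @tail z z' hz h ih =>
      have hzw : K.rank z ≤ K.rank w' := Desc.le K hz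
      have hrz : I.Reach z := Desc.reach K hz (hu.tail ha')
      have h2 := h.2
      have hnot : s(z, z') ∉ p.edges := fun hm => ih.1 (p.fst_mem_support_of_mem_edges hm)
      refine ⟨fun hm => hnot (hc.entry hH hO hm ?_ hrz h.1 h.2), ?_⟩
      · rintro rfl
        omega
      · refine (IsCyc.rest_adj hO h.1 (fun he => ih.1 ?_) hnot).reachable.symm.trans ih.2
        obtain ⟨rfl, rfl⟩ := hc.eq_of_edge hO h.1 he
        simp
  obtain ⟨y, h1, h2, h3⟩ := claim1 _ hl
  refine hc.not_reachable hH hO h1 hus ?_ (h3.symm.trans (claim2 _ hl').2)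
  rintro rfl
  omega

variable (K)

/-- The layout which results from a ranking. -/
noncomputable def layout (hH : IsCactus H) (hO : IsOrientationOf I.graph H) : Layout I where
  rank := K.rank
  top := K.top H
  suc := K.suc H
  low u := K.Desc u I.t
  suc_spec := by
    intro u v h
    obtain ⟨u₀, p, hc, hx, hxv, hy⟩ := suc_of_top h
    refine ⟨(hc.desc.rank_le hx).2.2.1 hxv, ?_⟩
    rcases hy with ⟨rfl, h2⟩ | ⟨h1, h2⟩
    · rw [h2]
      exact ⟨hc.arc, Or.inl rfl⟩
    · obtain ⟨-, h4, h5⟩ := hc.desc.of_edge hO h1 h2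
      refine ⟨h2, Or.inr ⟨h5, ?_⟩⟩
      have h6 := (hc.desc.rank_le hx).1
      obtain ⟨y, h7⟩ := hc.exists_suc h4 (by rintro h; rw [h] at h5; omega)
      exact (h7.eq hH hO).1
  arc := by
    intro u w hu ha
    rcases le_or_gt (K.rank u) (K.rank w) with hr | hr
    · left
      -- The arc closes a directed cycle with the descent from `w` to `u`; hence `w` is both the top
      -- and the successor of `u`.
      obtain ⟨p, hp⟩ := Desc.exists_walk K hO (K.back hu ha hr)
      have hne : u ≠ w := by
        rintro rfl
        exact hO.2 _ _ ha ha
      have hlt : K.rank u < K.rank w :=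
        lt_of_le_of_ne hr (fun h => hne (K.inj hu (hu.tail ha) h))
      have hs : K.Suc H u w w := ⟨u, p, ⟨hu, ha, hlt, hp⟩, by simp, hne, Or.inl ⟨rfl, rfl⟩⟩
      have := hs.eq hH hO
      exact ⟨by simp [this.1], this.2.symm⟩
    · cases h : K.top H w with
      | none => exact Or.inr (Or.inr ⟨hr, rfl⟩)
      | some v =>
        obtain ⟨u₀, p, hc, hx, hxv, hy⟩ := suc_of_top h
        -- The arc belongs to the cycle of `w`, so its tail is the top or precedes `w` below the
        -- top.
        have he := hc.entry hH hO hx hxv hu ha hr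
        by_cases huv : u = v
        · subst huv
          exact Or.inr (Or.inl ⟨hr, rfl⟩)
        · left
          have hs : K.Suc H u v w :=
            ⟨u₀, p, hc, p.fst_mem_support_of_mem_edges he, huv, Or.inr ⟨he, ha⟩⟩
          have := hs.eq hH hO
          exact ⟨by simp [this.1], this.2.symm⟩
  arc_in := by
    intro x p q ht hp hq ha ha' hr hr'
    obtain ⟨v, hv⟩ := Option.ne_none_iff_exists'.1 ht
    obtain ⟨u₀, r, hc, hx, hxv, hy⟩ := suc_of_top hv
    exact hc.desc.in_unique hO (hc.entry hH hO hx hxv hp ha hr) ha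
      (hc.entry hH hO hx hxv hq ha' hr') ha'
  exists_in := K.exists_in
  route := by
    intro u w w' hu ha ha' hne hr hr' hl hl'
    cases h : K.top H w with
    | none => rfl
    | some v =>
      obtain ⟨u₀, p, hc, hx, hxv, hy⟩ := suc_of_top h
      exact (hc.route hH hO hu hx hxv ha ha' hne hr hr' hl hl').elim
  low_iff := by
    intro u hu
    constructor
    · intro h
      rcases Relation.ReflTransGen.cases_head h with h | ⟨w, h1, h2⟩
      · exact Or.inl h
      · exact Or.inr ⟨w, h1.1, h1.2, h2⟩
    · rintro (rfl | ⟨w, h1, h2, h3⟩)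
      · exact .refl
      · exact .head ⟨h1, h2⟩ h3
  top_reach := by
    intro u v hu h
    obtain ⟨u₀, p, hc, -⟩ := suc_of_top h
    exact hc.reach_top

end Walk

end Ranking

end ShortestPathGame

namespace ShortestPathGame

/-! ### The number of edges of a cactus graph -/

/-- A forest extends to a spanning tree of the complete graph. -/
theorem ncard_edgeSet_le_of_isAcyclic {V : Type*} [Fintype V] [Nonempty V] {F : SimpleGraph V}
    (hF : F.IsAcyclic) : F.edgeSet.ncard ≤ Fintype.card V := by
  classical
  obtain ⟨T, hFT, -, hT⟩ :=
    (SimpleGraph.connected_top (V := V)).exists_isTree_le_of_le_of_isAcyclic le_top hF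
  have h1 := hT.card_edgeFinset
  have h2 : F.edgeSet.ncard ≤ T.edgeSet.ncard :=
    Set.ncard_le_ncard (SimpleGraph.edgeSet_subset_edgeSet.2 hFT) (Set.toFinite _)
  rw [Set.ncard_eq_toFinset_card'] at h2
  have h3 : T.edgeSet.toFinset.card = T.edgeFinset.card := rfl
  rw [Set.ncard_eq_toFinset_card'] at h2 ⊢
  omega

/-- Each edge outside a spanning forest closes a cycle with forest edges. Assigning to it a forest
edge of this cycle is injective: two cycles sharing that edge coincide, and each contains only one
edge outside the forest. -/
theorem IsCactus.ncard_edgeSet_le {V : Type*} [Fintype V] [Nonempty V] {H : SimpleGraph V}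
    (hH : IsCactus H) : H.edgeSet.ncard ≤ 2 * Fintype.card V := by
  classical
  obtain ⟨F, hFH, hF, hr⟩ := SimpleGraph.exists_isAcyclic_reachable_eq_le (G := H)
  have key : ∀ e ∈ H.edgeSet \ F.edgeSet, ∃ f ∈ F.edgeSet, ∃ (u : V) (c : H.Walk u u), c.IsCycle ∧
      e ∈ c.edges ∧ f ∈ c.edges ∧ ∀ g ∈ c.edges, g = e ∨ g ∈ F.edgeSet := by
    intro e he
    induction e with
    | _ a b =>
    obtain ⟨he, hne⟩ := he
    replace he : H.Adj a b := he
    have hab : F.Reachable b a := by rw [hr]; exact (SimpleGraph.Adj.reachable he).symm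
    obtain ⟨p, hp⟩ := hab.exists_isPath
    have hmem : s(a, b) ∉ (p.mapLe hFH).edges := by
      rw [SimpleGraph.Walk.edges_mapLe_eq_edges]
      exact fun h => hne (p.edges_subset_edgeSet h)
    have hc : (SimpleGraph.Walk.cons he (p.mapLe hFH)).IsCycle :=
      (SimpleGraph.Walk.cons_isCycle_iff _ _).2 ⟨hp.mapLe hFH, hmem⟩
    cases p with
    | nil => exact absurd rfl (SimpleGraph.Adj.ne he)
    | @cons _ x _ h p =>
      refine ⟨s(b, x), h, a, _, hc, by simp, by simp, ?_⟩
      intro g hg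
      rw [SimpleGraph.Walk.edges_cons, SimpleGraph.Walk.edges_mapLe_eq_edges, List.mem_cons] at hg
      exact hg.imp_right (fun h' => SimpleGraph.Walk.edges_subset_edgeSet _ h')
  choose! f hf u c hc hec hfc hgc using key
  have h1 : (H.edgeSet \ F.edgeSet).ncard ≤ F.edgeSet.ncard := by
    refine Set.ncard_le_ncard_of_injOn f hf ?_ (Set.toFinite _)
    intro e he e' he' h
    have := (hH _ _ (hc e he) (hc e' he') (f e) (hfc e he) (h ▸ hfc e' he') e).1 (hec e he)
    exact (hgc e' he' e this).resolve_right he.2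
  have h2 := ncard_edgeSet_le_of_isAcyclic hF
  have h3 : H.edgeSet.ncard = (H.edgeSet \ F.edgeSet).ncard + F.edgeSet.ncard :=
    (Set.ncard_sdiff_add_ncard_of_subset (SimpleGraph.edgeSet_subset_edgeSet.2 hFH)
      (Set.toFinite _)).symm
  omega

theorem ListsArcs.length_le {n : ℕ} {G : Digraph (Fin n)} {L : List (Fin n × Fin n)}
    (hL : ListsArcs G L) (hG : IsDirectedCactus G) (hn : 0 < n) : L.length ≤ 2 * n := by
  classical
  obtain ⟨H, hH, hO⟩ := hG
  have : Nonempty (Fin n) := ⟨⟨0, hn⟩⟩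
  have h1 := hH.ncard_edgeSet_le
  rw [Fintype.card_fin] at h1
  refine le_trans ?_ h1
  rw [← List.toFinset_card_of_nodup hL.1, ← Set.ncard_coe_finset]
  refine Set.ncard_le_ncard_of_injOn (fun a => s(a.1, a.2)) ?_ ?_ (Set.toFinite _)
  · intro a ha
    simp only [List.coe_toFinset, Set.mem_ofPred_eq, hL.2] at ha
    exact (hO.1 _ _).2 (Or.inl ha)
  · intro a ha b hb h
    simp only [List.coe_toFinset, Set.mem_ofPred_eq, hL.2] at ha hb
    simp only [Sym2.eq_iff] at h
    rcases h with h | ⟨h, h'⟩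
    · exact Prod.ext h.1 h.2
    · rw [h, h'] at ha
      exact absurd ha (hO.2 _ _ hb)

end ShortestPathGame

namespace ShortestPathGame

/-! ### Depth-first search -/

/-- An event of a depth-first search: the arc from `u` to `w` is scanned for `(u, some w)`,
the vertex `u` is finished for `(u, none)`. -/
abbrev Event (n : ℕ) := Fin n × Option (Fin n)

/-- The vertices in the order of the events in which they are finished, the heads of the arcs which
have not been scanned, and the events so far. -/
structure Search (n : ℕ) where
  stack : List (Fin n)
  done : List (Fin n)
  rem : Fin n → List (Fin n)
  events : List (Event n)

namespace Search

variable {n : ℕ} {I : Game n}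

/-- The steps of a depth-first search. -/
inductive Step : Search n → Search n → Prop
  | pop {u S D rem ev} (h : rem u = []) :
      Step ⟨u :: S, D, rem, ev⟩ ⟨S, D ++ [u], rem, ev ++ [(u, none)]⟩
  -- The arc is not removed from the list: it will be scanned after `w` has been finished.
  | push {u S D rem ev w l} (h : rem u = w :: l) (hw : w ∉ D ++ u :: S) :
      Step ⟨u :: S, D, rem, ev⟩ ⟨w :: u :: S, D, rem, ev⟩
  | scan {u S D rem ev w l} (h : rem u = w :: l) (hw : w ∈ D ++ u :: S) :
      Step ⟨u :: S, D, rem, ev⟩ ⟨u :: S, D, Function.update rem u l, ev ++ [(u, some w)]⟩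

/-- The arcs which do not close a cycle with the stack, when the vertices will be finished in the
order of `O`. -/
def Down (I : Game n) (O : List (Fin n)) (a b : Fin n) : Prop :=
  I.graph.Adj a b ∧ [b, a].Sublist O

/-- The event may take place after the events in `pre`. -/
def Fits (I : Game n) (O : List (Fin n)) (pre : List (Event n)) : Event n → Prop
  | (u, none) => u ∈ O ∧ (u, none) ∉ pre ∧ ∀ w, I.graph.Adj u w → (u, some w) ∈ pre
  | (u, some w) => u ∈ O ∧ w ∈ O ∧ I.graph.Adj u w ∧ (u, none) ∉ pre ∧ (u, some w) ∉ pre ∧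
      (((w, none) ∈ pre ∧ [w, u].Sublist O) ∨
        ((w, none) ∉ pre ∧ Relation.ReflTransGen (Down I O) w u))

/-- The list `done ++ stack` anticipates the finishing order. A new vertex is inserted into it
without changing the order of the others, so earlier events stay correct. -/
theorem Fits.mono {O O' : List (Fin n)} (h : O.Sublist O') {pre : List (Event n)} {e : Event n}
    (hf : Fits I O pre e) : Fits I O' pre e := by
  obtain ⟨u, _ | w⟩ := e
  · exact ⟨h.subset hf.1, hf.2⟩
  · refine ⟨h.subset hf.1, h.subset hf.2.1, hf.2.2.1, hf.2.2.2.1, hf.2.2.2.2.1, ?_⟩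
    rcases hf.2.2.2.2.2 with h1 | h1
    · exact Or.inl ⟨h1.1, h1.2.trans h⟩
    · exact Or.inr ⟨h1.1, Relation.ReflTransGen.mono (fun a b hab => ⟨hab.1, hab.2.trans h⟩) _ _ h1.2⟩

/-- The invariant of the search. -/
structure Inv (I : Game n) (d : Search n) : Prop where
  nodup : (d.done ++ d.stack).Nodup
  chain : d.stack.IsChain fun a b => I.graph.Adj b a
  reach : ∀ x ∈ d.done ++ d.stack, I.Reach x
  start : I.s ∈ d.done ++ d.stack
  pred : ∀ x ∈ d.done ++ d.stack, x ≠ I.s →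
    ∃ p, p ∈ d.done ++ d.stack ∧ Down I (d.done ++ d.stack) p x
  rem_adj : ∀ u w, w ∈ d.rem u → I.graph.Adj u w ∧ (u, some w) ∉ d.events
  adj : ∀ u w, I.graph.Adj u w → w ∈ d.rem u ∨ (u, some w) ∈ d.events
  rem_nodup : ∀ u, (d.rem u).Nodup
  fin_iff : ∀ u, (u, none) ∈ d.events ↔ u ∈ d.done
  fits : ∀ pre e suf, d.events = pre ++ e :: suf → Fits I (d.done ++ d.stack) pre e

/-- The number of steps which can still follow. -/
def fuel (d : Search n) : ℕ :=
  2 * (n - (d.done ++ d.stack).length) + d.stack.length + ∑ u, (d.rem u).length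

/-- An unvisited vertex counts twice, for being pushed and for being finished. Every step uses up
one unit and creates at most one event, so the initial fuel also bounds the number of events. -/
theorem Step.fuel {d d' : Search n} (hd' : (d'.done ++ d'.stack).Nodup) (h : Step d d') :
    d'.fuel < d.fuel ∧ d'.events.length + d'.fuel ≤ d.events.length + d.fuel := by
  cases h with
  | pop h => simp [Search.fuel]; omega
  | push h hw =>
    have := hd'.length_le_card
    simp [Search.fuel] at this ⊢
    omega
  | @scan u S D rem ev w l h hw =>
    have h1 : ∑ x, (Function.update rem u l x).length + 1 = ∑ x, (rem x).length := by
      rw [← Finset.add_sum_erase _ _ (Finset.mem_univ u),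
        ← Finset.add_sum_erase _ (fun x => (rem x).length) (Finset.mem_univ u)]
      have : ∑ x ∈ Finset.univ.erase u, (Function.update rem u l x).length =
          ∑ x ∈ Finset.univ.erase u, (rem x).length :=
        Finset.sum_congr rfl fun x hx => by
          rw [Function.update_of_ne (Finset.ne_of_mem_erase hx)]
      rw [this, h]
      simp
      omega
    simp [Search.fuel]
    omega

theorem forall_split_append {α : Type*} {P : List α → α → Prop} {l : List α} {x : α}
    (h : ∀ pre e suf, l = pre ++ e :: suf → P pre e) (hx : P l x) :
    ∀ pre e suf, l ++ [x] = pre ++ e :: suf → P pre e := by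
  intro pre e suf he
  rcases List.eq_nil_or_concat suf with rfl | ⟨suf, y, rfl⟩
  · have := List.append_inj' he rfl
    rw [← this.1]
    have h2 := this.2
    simp at h2
    rwa [← h2]
  · have : l ++ [x] = (pre ++ e :: suf) ++ [y] := by simpa using he
    exact h pre e suf (List.append_inj' this rfl).1

/-- The stack is a directed path whose later vertices finish earlier. So an arc from the top of the
stack back to a vertex on it closes a directed cycle with a descent. -/
theorem down_of_mem {O : List (Fin n)} : ∀ (S : List (Fin n)) (u : Fin n),
    ((u :: S).IsChain fun a b => I.graph.Adj b a) → (u :: S).Sublist O →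
    ∀ w ∈ u :: S, Relation.ReflTransGen (Down I O) w u := by
  intro S
  induction S with
  | nil =>
    intro u _ _ w hw
    simp at hw
    rw [hw]
  | cons v S ih =>
    intro u hc hs w hw
    rw [List.isChain_cons_cons] at hc
    rcases List.mem_cons.1 hw with rfl | hw
    · exact .refl
    · refine (ih v hc.2 ((List.sublist_cons_self _ _).trans hs) w hw).tail ⟨hc.1, ?_⟩
      exact List.Sublist.trans (by simp) hs

theorem Inv.step {d d' : Search n} (hd : Inv I d) (h : Step d d') : Inv I d' := by
  cases h with
  | @pop u S D rem ev h =>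
    have hO : (D ++ [u]) ++ S = D ++ u :: S := by simp
    refine ⟨by simpa only [hO] using hd.nodup, hd.chain.tail, by simpa only [hO] using hd.reach,
      by simpa only [hO] using hd.start, by simpa only [hO] using hd.pred, ?_, ?_, hd.rem_nodup,
      ?_, ?_⟩
    · intro x w hw
      exact ⟨(hd.rem_adj x w hw).1, by simpa using (hd.rem_adj x w hw).2⟩
    · intro x w ha
      exact (hd.adj x w ha).imp_right (fun h => by simp [h])
    · intro x
      simp [← hd.fin_iff x]
    · simp only [hO]
      refine forall_split_append hd.fits ⟨by simp, ?_, ?_⟩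
      · have := hd.nodup
        rw [hd.fin_iff]
        simp only [List.nodup_append] at this
        exact fun hu => this.2.2 u hu u (by simp) rfl
      · intro w ha
        exact (hd.adj u w ha).resolve_left (by simp [h])
  | @push u S D rem ev w l h hw =>
    have hO : (D ++ u :: S).Sublist (D ++ w :: u :: S) :=
      List.Sublist.append_left (List.sublist_cons_self _ _) _
    have ha := (hd.rem_adj u w (by simp [h])).1
    refine ⟨?_, List.isChain_cons_cons.2 ⟨ha, hd.chain⟩, ?_, hO.subset hd.start, ?_, hd.rem_adj,
      hd.adj, hd.rem_nodup, hd.fin_iff, fun pre e suf he => (hd.fits pre e suf he).mono hO⟩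
    · refine List.nodup_middle.2 ?_
      exact List.nodup_cons.2 ⟨hw, hd.nodup⟩
    · intro x hx
      simp only [List.mem_append, List.mem_cons] at hx
      by_cases hxw : x = w
      · rw [hxw]
        exact (hd.reach u (by simp)).tail ha
      · exact hd.reach x (by simp; tauto)
    · intro x hx hxs
      simp only [List.mem_append, List.mem_cons] at hx
      by_cases hxw : x = w
      · rw [hxw]
        refine ⟨u, by simp, ha, ?_⟩
        exact List.Sublist.trans (by simp) (List.sublist_append_right D _)
      · obtain ⟨p, h1, h2⟩ := hd.pred x (by simp; tauto) hxs
        exact ⟨p, hO.subset h1, h2.1, h2.2.trans hO⟩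
  | @scan u S D rem ev w l h hw =>
    have ha := hd.rem_adj u w (by simp [h])
    have hn := hd.rem_nodup u
    simp only [h, List.nodup_cons] at hn
    have hu : u ∉ D := by
      have := hd.nodup
      simp only [List.nodup_append] at this
      exact fun hu => this.2.2 u hu u (by simp) rfl
    refine ⟨hd.nodup, hd.chain, hd.reach, hd.start, hd.pred, ?_, ?_, ?_, ?_, ?_⟩
    · intro x y hy
      dsimp only at hy ⊢
      by_cases hx : x = u
      · subst hx
        rw [Function.update_self] at hy
        have := hd.rem_adj x y (by simp [h, hy])
        refine ⟨this.1, ?_⟩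
        simp only [List.mem_append, List.mem_singleton, Prod.mk.injEq, Option.some.injEq, true_and]
        rintro (h' | rfl)
        · exact this.2 h'
        · exact hn.1 hy
      · rw [Function.update_of_ne hx] at hy
        have := hd.rem_adj x y hy
        refine ⟨this.1, ?_⟩
        simp [hx]
        exact this.2
    · intro x y hxy
      dsimp only
      by_cases hx : x = u
      · subst hx
        rw [Function.update_self]
        rcases hd.adj x y hxy with h' | h'
        · simp only [h, List.mem_cons] at h'
          rcases h' with rfl | h'
          · right; simp
          · exact Or.inl h'
        · right; simp at h' ⊢; exact Or.inl h'
      · rw [Function.update_of_ne hx]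
        exact (hd.adj x y hxy).imp_right (fun h => by simp at h ⊢; exact Or.inl h)
    · intro x
      dsimp only
      by_cases hx : x = u
      · subst hx
        rw [Function.update_self]
        exact hn.2
      · rw [Function.update_of_ne hx]
        exact hd.rem_nodup x
    · intro x
      simp [← hd.fin_iff x]
    · refine forall_split_append hd.fits ⟨by simp, hw, ha.1, ?_, ha.2, ?_⟩
      · rw [hd.fin_iff]
        exact hu
      · by_cases hwD : w ∈ D
        · refine Or.inl ⟨(hd.fin_iff w).2 hwD, ?_⟩
          show ([w] ++ [u]).Sublist _
          exact List.Sublist.append (by simpa using hwD) (by simp)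
        · refine Or.inr ⟨fun h' => hwD ((hd.fin_iff w).1 h'), ?_⟩
          refine down_of_mem S u hd.chain (List.sublist_append_right _ _) w ?_
          exact (List.mem_append.1 hw).resolve_left hwD

end Search

/-- The order of the events in which the tables can be filled. -/
structure Schedule {n : ℕ} (I : Game n) (rank : Fin n → ℕ) (ev : List (Event n)) : Prop where
  mem_fin : ∀ {u}, I.Reach u → (u, none) ∈ ev
  fin : ∀ {pre u suf}, ev = pre ++ (u, none) :: suf →
    I.Reach u ∧ (u, none) ∉ pre ∧ ∀ w, I.graph.Adj u w → (u, some w) ∈ pre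
  arc : ∀ {pre u w suf}, ev = pre ++ (u, some w) :: suf →
    I.Reach u ∧ I.graph.Adj u w ∧ (u, none) ∉ pre ∧ (u, some w) ∉ pre ∧
      ((w, none) ∈ pre ↔ rank w < rank u)

theorem idxOf_lt_of_sublist {α : Type*} [DecidableEq α] {O : List α} (hO : O.Nodup) {a b : α}
    (h : [a, b].Sublist O) : O.idxOf a < O.idxOf b := by
  induction O with
  | nil => simp at h
  | cons x O ih =>
    rw [List.nodup_cons] at hO
    cases h with
    | cons _ h =>
      have ha : a ∈ O := h.subset (by simp)
      have hb : b ∈ O := h.subset (by simp)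
      rw [List.idxOf_cons_ne _ (by rintro rfl; exact hO.1 ha),
        List.idxOf_cons_ne _ (by rintro rfl; exact hO.1 hb)]
      have := ih hO.2 h
      omega
    | cons_cons _ h =>
      have hb : b ∈ O := h.subset (by simp)
      rw [List.idxOf_cons_self, List.idxOf_cons_ne _ (by rintro rfl; exact hO.1 hb)]
      omega

/-- When the stack is empty, `done` is the finishing order and the position in it serves as the
rank. That all events fit into this order gives the ranking and the schedule alike. -/
theorem Search.Inv.exists_schedule {n : ℕ} {I : Game n} {d : Search n} (hd : d.Inv I)
    (hs : d.stack = []) : ∃ K : Ranking I, Schedule I K.rank d.events := by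
  obtain ⟨S, D, rem, ev⟩ := d
  dsimp only at hs
  subst hs
  have hD := hd.nodup
  simp only [List.append_nil] at hD
  have hfits := hd.fits
  simp only [List.append_nil] at hfits
  have hreach := hd.reach
  simp only [List.append_nil] at hreach
  have harc : ∀ u w, u ∈ D → I.graph.Adj u w → ∃ pre suf, ev = pre ++ (u, some w) :: suf := by
    intro u w hu ha
    obtain ⟨pre, suf, h⟩ := List.append_of_mem ((hd.fin_iff u).2 hu)
    have := (hfits _ _ _ h).2.2 w ha
    exact List.append_of_mem (by dsimp only at h; rw [h]; simp [this])
  have hmem : ∀ u, I.Reach u → u ∈ D := by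
    intro u hu
    induction hu with
    | refl => simpa using hd.start
    | tail _ ha ih =>
      obtain ⟨pre, suf, h⟩ := harc _ _ ih ha
      exact (hfits _ _ _ h).2.1
  refine ⟨⟨fun u => D.idxOf u, ?_, ?_, ?_⟩, ?_, ?_, ?_⟩
  · intro x hx hxs
    obtain ⟨p, h1, h2⟩ := hd.pred x (by simpa using hmem x hx) hxs
    simp only [List.append_nil] at h1 h2
    exact ⟨p, hreach p h1, h2.1, idxOf_lt_of_sublist hD h2.2⟩
  · intro u w hu ha hr
    obtain ⟨pre, suf, h⟩ := harc u w (hmem u hu) ha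
    rcases (hfits _ _ _ h).2.2.2.2.2 with h1 | h1
    · have := idxOf_lt_of_sublist hD h1.2
      omega
    · exact Relation.ReflTransGen.mono (fun a b hab => ⟨hab.1, idxOf_lt_of_sublist hD hab.2⟩) _ _ h1.2
  · intro u v hu hv h
    exact (List.idxOf_inj (hmem u hu)).1 h
  · intro u hu
    exact (hd.fin_iff u).2 (hmem u hu)
  · intro pre u suf h
    have := hfits _ _ _ h
    exact ⟨hreach u this.1, this.2⟩
  · intro pre u w suf h
    have := hfits _ _ _ h
    refine ⟨hreach u this.1, this.2.2.1, this.2.2.2.1, this.2.2.2.2.1, ?_⟩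
    rcases this.2.2.2.2.2 with h1 | h1
    · simp only [h1.1, true_iff]
      exact idxOf_lt_of_sublist hD h1.2
    · simp only [h1.1, false_iff, not_lt]
      have aux : ∀ a b, Relation.ReflTransGen (Search.Down I D) a b → D.idxOf b ≤ D.idxOf a := by
        intro a b hab
        induction hab with
        | refl => exact le_refl _
        | tail _ h ih => exact (idxOf_lt_of_sublist hD h.2).le.trans ih
      exact aux _ _ h1.2

end ShortestPathGame

/-! ### Compilation of an abstract memory with entries, and rules for verifying programs -/

namespace ShortestPathGame

/-! ### Programs with registers and arrays for entries -/

/-- The memory with additional registers and arrays for entries. -/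
@[ext] structure Store where
  reg : ℕ → ℕ
  arr : ℕ → ℕ → ℕ
  num : ℕ → ℝ
  numArr : ℕ → ℕ → ℝ
  ereg : ℕ → Entry
  etab : ℕ → ℕ → Entry

namespace Store

/-- The entry which is represented by a word and two numbers. -/
noncomputable def decode (f : ℕ) (a b : ℝ) : Entry := if f = 0 then ⊤ else Entry.mk a b (f - 1)

/-- The registers and arrays with large numbers represent entries. -/
noncomputable def view (σ : Memory) : Store where
  reg i := if i < 90 then σ.reg i else 0
  arr k i := if k < 90 then σ.arr k i else 0
  num x := if x < 90 then σ.num x else 0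
  numArr k i := if k < 90 then σ.numArr k i else 0
  ereg x := decode (σ.reg (100 + x)) (σ.num (100 + 2 * x)) (σ.num (101 + 2 * x))
  etab k i := decode (σ.arr (100 + k) i) (σ.numArr (100 + 2 * k) i) (σ.numArr (101 + 2 * k) i)

end Store

/-- Instructions, also for entries. -/
inductive Op
  | const (i k : ℕ)
  | copy (i j : ℕ)
  | succ (i j : ℕ)
  | pred (i j : ℕ)
  | load (i a j : ℕ)
  | store (a j i : ℕ)
  | numZero (x : ℕ)
  | numAdd (x y z : ℕ)
  | numLoad (x a j : ℕ)
  | numStore (a j x : ℕ)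
  | eTop (x : ℕ)
  | eZero (x : ℕ)
  | eLoad (x a j : ℕ)
  | eStore (a j x : ℕ)
  | eMin (x y : ℕ)
  | eGo (x c j : ℕ)
  | eAfter (x y : ℕ)
  | eAdd (x p q : ℕ)
  | eVert (i x : ℕ)

namespace Op

/-- The effect of an instruction. -/
noncomputable def run (s : Store) : Op → Store
  | const i k => { s with reg := Function.update s.reg i k }
  | copy i j => { s with reg := Function.update s.reg i (s.reg j) }
  | succ i j => { s with reg := Function.update s.reg i (s.reg j + 1) }
  | pred i j => { s with reg := Function.update s.reg i (s.reg j - 1) }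
  | load i a j => { s with reg := Function.update s.reg i (s.arr a (s.reg j)) }
  | store a j i =>
      { s with arr := Function.update s.arr a (Function.update (s.arr a) (s.reg j) (s.reg i)) }
  | numZero x => { s with num := Function.update s.num x 0 }
  | numAdd x y z => { s with num := Function.update s.num x (s.num y + s.num z) }
  | numLoad x a j => { s with num := Function.update s.num x (s.numArr a (s.reg j)) }
  | numStore a j x =>
      { s with
        numArr := Function.update s.numArr a (Function.update (s.numArr a) (s.reg j) (s.num x)) }
  | eTop x => { s with ereg := Function.update s.ereg x ⊤ }
  | eZero x => { s with ereg := Function.update s.ereg x (Entry.mk 0 0 0) }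
  | eLoad x a j => { s with ereg := Function.update s.ereg x (s.etab a (s.reg j)) }
  | eStore a j x =>
      { s with etab := Function.update s.etab a (Function.update (s.etab a) (s.reg j) (s.ereg x)) }
  | eMin x y => { s with ereg := Function.update s.ereg x (min (s.ereg x) (s.ereg y)) }
  | eGo x c j =>
      { s with ereg := Function.update s.ereg x (Entry.go (s.num c) (s.reg j) (s.ereg x).pay) }
  | eAfter x y =>
      { s with ereg := Function.update s.ereg x (Entry.after true (s.ereg x) (s.ereg y).pay) }
  | eAdd x p q =>
      { s with
        ereg := Function.update s.ereg x (Entry.after false (s.ereg x) (some (s.num p, s.num q))) }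
  | eVert i x => { s with reg := Function.update s.reg i (s.ereg x).vert }

/-- The registers and arrays which are not reserved. -/
def ok : Op → Bool
  | const i _ => i < 90
  | copy i j | succ i j | pred i j => i < 90 && j < 90
  | load i a j => i < 90 && a < 90 && j < 90
  | store a j i => a < 90 && j < 90 && i < 90
  | numZero x => x < 90
  | numAdd x y z => x < 90 && y < 90 && z < 90
  | numLoad x a j => x < 90 && a < 90 && j < 90
  | numStore a j x => a < 90 && j < 90 && x < 90
  | eTop _ | eZero _ => true
  | eLoad _ _ j => j < 90
  | eStore _ j _ => j < 90
  | eMin _ _ => true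
  | eGo _ c j => c < 90 && j < 90
  | eAfter x y => x != y
  | eAdd _ p q => p < 90 && q < 90
  | eVert i _ => i < 90

/-- What the instruction changes: a register, an array, a real register, a real array, a register
or an array for entries. -/
def target : Op → ℕ × ℕ
  | const i _ | copy i _ | succ i _ | pred i _ | load i _ _ | eVert i _ => (0, i)
  | store a _ _ => (1, a)
  | numZero x | numAdd x _ _ | numLoad x _ _ => (2, x)
  | numStore a _ _ => (3, a)
  | eTop x | eZero x | eLoad x _ _ | eMin x _ | eGo x _ _ | eAfter x _ | eAdd x _ _ => (4, x)
  | eStore a _ _ => (5, a)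

/-- Copying an entry between registers. -/
def copyEntry (x y : ℕ) : Prog :=
  .seq (.instr (.copy (100 + x) (100 + y)))
    (.seq (.instr (.numCopy (100 + 2 * x) (100 + 2 * y)))
      (.instr (.numCopy (101 + 2 * x) (101 + 2 * y))))

/-- The program for an instruction. -/
def prog : Op → Prog
  | const i k => .instr (.const i k)
  | copy i j => .instr (.copy i j)
  | succ i j => .instr (.succ i j)
  | pred i j => .instr (.pred i j)
  | load i a j => .instr (.load i a j)
  | store a j i => .instr (.store a j i)
  | numZero x => .instr (.numZero x)
  | numAdd x y z => .instr (.numAdd x y z)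
  | numLoad x a j => .instr (.numLoad x a j)
  | numStore a j x => .instr (.numStore a j x)
  | eTop x => .instr (.const (100 + x) 0)
  | eZero x => .seq (.instr (.const (100 + x) 1))
      (.seq (.instr (.numZero (100 + 2 * x))) (.instr (.numZero (101 + 2 * x))))
  | eLoad x a j => .seq (.instr (.load (100 + x) (100 + a) j))
      (.seq (.instr (.numLoad (100 + 2 * x) (100 + 2 * a) j))
        (.instr (.numLoad (101 + 2 * x) (101 + 2 * a) j)))
  | eStore a j x => .seq (.instr (.store (100 + a) j (100 + x)))
      (.seq (.instr (.numStore (100 + 2 * a) j (100 + 2 * x)))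
        (.instr (.numStore (101 + 2 * a) j (101 + 2 * x))))
  | eMin x y => .seq (.instr (.const 99 0)) (.cond (.eq (100 + y) 99) .skip
      (.cond (.eq (100 + x) 99) (copyEntry x y)
      (.cond (.numLt (100 + 2 * y) (100 + 2 * x)) (copyEntry x y)
      (.cond (.numLt (100 + 2 * x) (100 + 2 * y)) .skip
      (.cond (.numLt (101 + 2 * y) (101 + 2 * x)) (copyEntry x y)
      (.cond (.numLt (101 + 2 * x) (101 + 2 * y)) .skip
      (.cond (.lt (100 + y) (100 + x)) (copyEntry x y) .skip)))))))
  | eGo x c j => .seq (.instr (.const 99 0)) (.cond (.eq (100 + x) 99) .skip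
      (.seq (.instr (.succ (100 + x) j))
      (.seq (.instr (.numAdd 99 c (101 + 2 * x)))
      (.seq (.instr (.numCopy (101 + 2 * x) (100 + 2 * x)))
        (.instr (.numCopy (100 + 2 * x) 99))))))
  | eAfter x y => .seq (.instr (.const 99 0)) (.cond (.eq (100 + y) 99)
      (.instr (.const (100 + x) 0))
      (.seq (.instr (.numAdd (100 + 2 * x) (100 + 2 * x) (101 + 2 * y)))
        (.instr (.numAdd (101 + 2 * x) (101 + 2 * x) (100 + 2 * y)))))
  | eAdd x p q => .seq (.instr (.numAdd (100 + 2 * x) (100 + 2 * x) p))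
      (.instr (.numAdd (101 + 2 * x) (101 + 2 * x) q))
  | eVert i x => .instr (.pred i (100 + x))

-- Changes which concern only the entry register `x`. The cells 90 to 99 are invisible in `view` and
-- may be used as scratch.
open Store in
theorem view_update_entry {σ τ : Memory} {x : ℕ} {e : Entry}
    (h1 : ∀ i, i < 90 ∨ (100 ≤ i ∧ i ≠ 100 + x) → τ.reg i = σ.reg i) (h2 : τ.arr = σ.arr)
    (h3 : ∀ i, i < 90 ∨ (100 ≤ i ∧ i ≠ 100 + 2 * x ∧ i ≠ 101 + 2 * x) → τ.num i = σ.num i)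
    (h4 : τ.numArr = σ.numArr)
    (h5 : decode (τ.reg (100 + x)) (τ.num (100 + 2 * x)) (τ.num (101 + 2 * x)) = e) :
    view τ = { view σ with ereg := Function.update (view σ).ereg x e } := by
  ext i
  · simp only [view]
    split_ifs with h
    · rw [h1 i (Or.inl h)]
    · rfl
  · simp only [view, h2]
  · simp only [view]
    split_ifs with h
    · rw [h3 i (Or.inl h)]
    · rfl
  · simp only [view, h4]
  · simp only [view, Function.update_apply]
    split_ifs with h
    · rw [h, h5]
    · rw [h1, h3, h3] <;> omega
  · simp only [view, h2, h4]

theorem exec_copyEntry (σ : Memory) (x y : ℕ) : ∃ τ, Exec (copyEntry x y) σ τ 3 ∧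
    Store.view τ = { Store.view σ with
      ereg := Function.update (Store.view σ).ereg x ((Store.view σ).ereg y) } := by
  refine ⟨_, .seq (.instr _ _) (.seq (.instr _ _) (.instr _ _)), ?_⟩
  apply view_update_entry
  · intro i hi
    simp only [Instr.apply, Function.update_apply]
    rw [if_neg (by omega)]
  · rfl
  · intro i hi
    simp only [Instr.apply, Function.update_apply]
    rw [if_neg (by omega), if_neg (by omega)]
  · rfl
  · simp only [Instr.apply, Function.update_apply, Store.view]
    simp
    rw [if_neg (by omega)]

theorem min_decode_left {f f' : ℕ} {a b a' b' : ℝ} (h : f' = 0 ∨ (f ≠ 0 ∧ f' ≠ 0 ∧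
    (a < a' ∨ a = a' ∧ (b < b' ∨ b = b' ∧ f ≤ f')))) :
    min (Store.decode f a b) (Store.decode f' a' b') = Store.decode f a b := by
  unfold Store.decode
  rcases h with h | ⟨h, h', h2⟩
  · rw [if_pos h, min_top_right]
  · rw [if_neg h, if_neg h', min_eq_left_iff, Entry.mk_le_mk]
    rcases h2 with h2 | ⟨h2, h3 | ⟨h3, h4⟩⟩
    · exact Or.inl h2
    · exact Or.inr ⟨h2, Or.inl h3⟩
    · exact Or.inr ⟨h2, Or.inr ⟨h3, by omega⟩⟩

theorem min_decode_right {f f' : ℕ} {a b a' b' : ℝ} (h : f = 0 ∨ (f ≠ 0 ∧ f' ≠ 0 ∧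
    (a' < a ∨ a' = a ∧ (b' < b ∨ b' = b ∧ f' ≤ f)))) :
    min (Store.decode f a b) (Store.decode f' a' b') = Store.decode f' a' b' := by
  rw [min_comm]
  exact min_decode_left (h.imp_right fun h => ⟨h.2.1, h.1, h.2.2⟩)

theorem view_scratch (σ : Memory) (k : ℕ) :
    Store.view (Instr.apply σ (.const 99 k)) = Store.view σ := by
  ext i
  · simp only [Store.view, Instr.apply, Function.update_apply]
    split_ifs <;> first | rfl | omega
  · rfl
  · rfl
  · rfl
  · simp only [Store.view, Instr.apply, Function.update_apply]
    rw [if_neg (by omega)]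
  · rfl

theorem exec_eMin (σ : Memory) (x y : ℕ) : ∃ τ k, Exec (prog (eMin x y)) σ τ k ∧
    k ≤ 12 ∧ Store.view τ = run (Store.view σ) (eMin x y) := by
  let ρ := Instr.apply σ (.const 99 0)
  have hρ : Store.view ρ = Store.view σ := view_scratch σ 0
  obtain ⟨τ, h1, h2⟩ := exec_copyEntry ρ x y
  rw [hρ] at h2
  have h0 : ρ.reg 99 = 0 := by simp [ρ, Instr.apply]
  have hr : ∀ z, ρ.reg (100 + z) = σ.reg (100 + z) := fun z => by
    simp only [ρ, Instr.apply, Function.update_apply]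
    rw [if_neg (by omega)]
  have hL : min ((Store.view σ).ereg x) ((Store.view σ).ereg y) = (Store.view σ).ereg x →
      Store.view ρ = run (Store.view σ) (eMin x y) := by
    intro h
    rw [run, h, Function.update_eq_self, hρ]
  have hR : min ((Store.view σ).ereg x) ((Store.view σ).ereg y) = (Store.view σ).ereg y →
      Store.view τ = run (Store.view σ) (eMin x y) := by
    intro h
    rw [run, h, h2]
  have hs : Exec (.instr (.const 99 0)) σ ρ 1 := .instr _ _
  by_cases t1 : (Test.eq (100 + y) 99).Holds ρ
  · refine ⟨ρ, _, .seq hs (.condTrue t1 (.skip _)), by omega, hL (min_decode_left (Or.inl ?_))⟩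
    rwa [Test.Holds, h0, hr] at t1
  have g1 : σ.reg (100 + y) ≠ 0 := by rwa [Test.Holds, h0, hr] at t1
  by_cases t2 : (Test.eq (100 + x) 99).Holds ρ
  · refine ⟨τ, _, .seq hs (.condFalse t1 (.condTrue t2 h1)), by omega,
      hR (min_decode_right (Or.inl ?_))⟩
    rwa [Test.Holds, h0, hr] at t2
  have g2 : σ.reg (100 + x) ≠ 0 := by rwa [Test.Holds, h0, hr] at t2
  by_cases t3 : (Test.numLt (100 + 2 * y) (100 + 2 * x)).Holds ρ
  · refine ⟨τ, _, .seq hs (.condFalse t1 (.condFalse t2 (.condTrue t3 h1))), by omega,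
      hR (min_decode_right (Or.inr ⟨g2, g1, Or.inl t3⟩))⟩
  by_cases t4 : (Test.numLt (100 + 2 * x) (100 + 2 * y)).Holds ρ
  · refine ⟨ρ, _, .seq hs (.condFalse t1 (.condFalse t2 (.condFalse t3 (.condTrue t4
      (.skip _))))), by omega, hL (min_decode_left (Or.inr ⟨g2, g1, Or.inl t4⟩))⟩
  have g4 : σ.num (100 + 2 * x) = σ.num (100 + 2 * y) :=
    le_antisymm (not_lt.1 t3) (not_lt.1 t4)
  by_cases t5 : (Test.numLt (101 + 2 * y) (101 + 2 * x)).Holds ρ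
  · refine ⟨τ, _, .seq hs (.condFalse t1 (.condFalse t2 (.condFalse t3 (.condFalse t4
      (.condTrue t5 h1))))), by omega,
      hR (min_decode_right (Or.inr ⟨g2, g1, Or.inr ⟨g4.symm, Or.inl t5⟩⟩))⟩
  by_cases t6 : (Test.numLt (101 + 2 * x) (101 + 2 * y)).Holds ρ
  · refine ⟨ρ, _, .seq hs (.condFalse t1 (.condFalse t2 (.condFalse t3 (.condFalse t4
      (.condFalse t5 (.condTrue t6 (.skip _))))))), by omega,
      hL (min_decode_left (Or.inr ⟨g2, g1, Or.inr ⟨g4, Or.inl t6⟩⟩))⟩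
  have g6 : σ.num (101 + 2 * x) = σ.num (101 + 2 * y) :=
    le_antisymm (not_lt.1 t5) (not_lt.1 t6)
  by_cases t7 : (Test.lt (100 + y) (100 + x)).Holds ρ
  · refine ⟨τ, _, .seq hs (.condFalse t1 (.condFalse t2 (.condFalse t3 (.condFalse t4
      (.condFalse t5 (.condFalse t6 (.condTrue t7 h1))))))), by omega,
      hR (min_decode_right (Or.inr ⟨g2, g1, Or.inr ⟨g4.symm, Or.inr ⟨g6.symm, ?_⟩⟩⟩))⟩
    rw [Test.Holds, hr, hr] at t7
    exact t7.le
  · refine ⟨ρ, _, .seq hs (.condFalse t1 (.condFalse t2 (.condFalse t3 (.condFalse t4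
      (.condFalse t5 (.condFalse t6 (.condFalse t7 (.skip _)))))))), by omega,
      hL (min_decode_left (Or.inr ⟨g2, g1, Or.inr ⟨g4, Or.inr ⟨g6, ?_⟩⟩⟩))⟩
    rw [Test.Holds, hr, hr] at t7
    exact not_lt.1 t7

theorem exec_eGo (σ : Memory) (x c j : ℕ) (hc : c < 90) (hj : j < 90) :
    ∃ τ k, Exec (prog (eGo x c j)) σ τ k ∧
    k ≤ 12 ∧ Store.view τ = run (Store.view σ) (eGo x c j) := by
  let ρ := Instr.apply σ (.const 99 0)
  have hρ : Store.view ρ = Store.view σ := view_scratch σ 0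
  have h0 : ρ.reg 99 = 0 := by simp [ρ, Instr.apply]
  have hr : ∀ z, ρ.reg (100 + z) = σ.reg (100 + z) := fun z => by
    simp only [ρ, Instr.apply, Function.update_apply]
    rw [if_neg (by omega)]
  have hs : Exec (.instr (.const 99 0)) σ ρ 1 := .instr _ _
  by_cases t1 : (Test.eq (100 + x) 99).Holds ρ
  · refine ⟨ρ, _, .seq hs (.condTrue t1 (.skip _)), by omega, ?_⟩
    rw [Test.Holds, h0, hr] at t1
    have h1 : (Store.view σ).ereg x = ⊤ := by
      simp only [Store.view, Store.decode]
      rw [if_pos t1]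
    rw [run, h1, Entry.pay_top, Entry.go_none, ← h1, Function.update_eq_self, hρ]
  · have g1 : σ.reg (100 + x) ≠ 0 := by rwa [Test.Holds, h0, hr] at t1
    refine ⟨_, _, .seq hs (.condFalse t1 (.seq (.instr _ _) (.seq (.instr _ _)
      (.seq (.instr _ _) (.instr _ _))))), by omega, ?_⟩
    rw [run, ← hρ]
    apply view_update_entry
    · intro i hi
      simp only [Instr.apply, Function.update_apply]
      rw [if_neg (by omega)]
    · rfl
    · intro i hi
      simp only [Instr.apply, Function.update_apply]
      rw [if_neg (by omega), if_neg (by omega), if_neg (by omega)]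
    · rfl
    · have e1 : ρ.reg j = σ.reg j := by
        simp only [ρ, Instr.apply, Function.update_apply]
        rw [if_neg (by omega)]
      have e2 : ρ.num = σ.num := rfl
      have e3 : 100 + 2 * x ≠ 99 ∧ 101 + 2 * x ≠ 99 ∧ 99 ≠ 101 + 2 * x ∧
        100 + 2 * x ≠ 101 + 2 * x ∧ 101 + 2 * x ≠ 100 + 2 * x := by omega
      simp [Instr.apply, Store.view, Store.decode, e1, e2, e3, hr, g1, hc, hj]

theorem exec_eAfter (σ : Memory) (x y : ℕ) (hxy : x ≠ y) :
    ∃ τ k, Exec (prog (eAfter x y)) σ τ k ∧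
    k ≤ 12 ∧ Store.view τ = run (Store.view σ) (eAfter x y) := by
  let ρ := Instr.apply σ (.const 99 0)
  have hρ : Store.view ρ = Store.view σ := view_scratch σ 0
  have h0 : ρ.reg 99 = 0 := by simp [ρ, Instr.apply]
  have hr : ∀ z, ρ.reg (100 + z) = σ.reg (100 + z) := fun z => by
    simp only [ρ, Instr.apply, Function.update_apply]
    rw [if_neg (by omega)]
  have hs : Exec (.instr (.const 99 0)) σ ρ 1 := .instr _ _
  by_cases t1 : (Test.eq (100 + y) 99).Holds ρ
  · refine ⟨_, _, .seq hs (.condTrue t1 (.instr _ _)), by omega, ?_⟩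
    rw [Test.Holds, h0, hr] at t1
    have h1 : (Store.view σ).ereg y = ⊤ := by
      simp only [Store.view, Store.decode]
      rw [if_pos t1]
    rw [run, h1, Entry.pay_top, Entry.after_none, ← hρ]
    apply view_update_entry
    · intro i hi
      simp only [Instr.apply, Function.update_apply]
      rw [if_neg (by omega)]
    · rfl
    · intro i hi
      rfl
    · rfl
    · simp [Instr.apply, Store.decode]
  · have g1 : σ.reg (100 + y) ≠ 0 := by rwa [Test.Holds, h0, hr] at t1
    refine ⟨_, _, .seq hs (.condFalse t1 (.seq (.instr _ _) (.instr _ _))), by omega, ?_⟩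
    rw [run, ← hρ]
    apply view_update_entry
    · intro i hi
      rfl
    · rfl
    · intro i hi
      simp only [Instr.apply, Function.update_apply]
      rw [if_neg (by omega), if_neg (by omega)]
    · rfl
    · have e2 : ρ.num = σ.num := rfl
      have e3 : 100 + 2 * x ≠ 101 + 2 * x ∧ 101 + 2 * x ≠ 100 + 2 * x ∧
        100 + 2 * y ≠ 100 + 2 * x ∧ y ≠ x := by omega
      -- If the entry is `⊤`, the additions only change numbers which are ignored.
      by_cases g2 : σ.reg (100 + x) = 0
      · simp [Instr.apply, Store.view, Store.decode, e2, e3, hr, g1, g2]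
      · simp [Instr.apply, Store.view, Store.decode, e2, e3, hr, g1, g2]

/-- The bound 12 covers the longest of these programs, the one for `eMin`. -/
theorem exec (o : Op) (ho : o.ok = true) (σ : Memory) : ∃ τ k, Exec o.prog σ τ k ∧
    k ≤ 12 ∧ Store.view τ = o.run (Store.view σ) := by
  cases o with
  | eMin x y => exact exec_eMin σ x y
  | eGo x c j =>
    simp [ok] at ho
    exact exec_eGo σ x c j ho.1 ho.2
  | eAfter x y => exact exec_eAfter σ x y (by simpa [ok] using ho)
  | eTop x =>
    refine ⟨_, 1, .instr _ _, by omega, ?_⟩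
    apply view_update_entry
    · intro i hi
      simp only [Instr.apply, Function.update_apply]
      rw [if_neg (by omega)]
    · rfl
    · intro i hi
      rfl
    · rfl
    · simp [Instr.apply, Store.decode]
  | eZero x =>
    refine ⟨_, _, .seq (.instr _ _) (.seq (.instr _ _) (.instr _ _)), by omega, ?_⟩
    apply view_update_entry
    · intro i hi
      simp only [Instr.apply, Function.update_apply]
      rw [if_neg (by omega)]
    · rfl
    · intro i hi
      simp only [Instr.apply, Function.update_apply]
      rw [if_neg (by omega), if_neg (by omega)]
    · rfl
    · simp [Instr.apply, Store.decode]
  | eLoad x a j =>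
    simp [ok] at ho
    refine ⟨_, _, .seq (.instr _ _) (.seq (.instr _ _) (.instr _ _)), by omega, ?_⟩
    apply view_update_entry
    · intro i hi
      simp only [Instr.apply, Function.update_apply]
      rw [if_neg (by omega)]
    · rfl
    · intro i hi
      simp only [Instr.apply, Function.update_apply]
      rw [if_neg (by omega), if_neg (by omega)]
    · rfl
    · have : j ≠ 100 + x := by omega
      simp [Instr.apply, Store.decode, Store.view, ho, this]
  | eStore a j x =>
    simp [ok] at ho
    refine ⟨_, _, .seq (.instr _ _) (.seq (.instr _ _) (.instr _ _)), by omega, ?_⟩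
    ext i
    · rfl
    · simp only [Store.view, Instr.apply, Function.update_apply, run]
      split_ifs <;> first | rfl | omega
    · rfl
    · simp only [Store.view, Instr.apply, Function.update_apply, run]
      split_ifs <;> first | rfl | omega
    · rfl
    · rename_i k
      by_cases h : i = a
      · subst h
        have e : 101 + 2 * i ≠ 100 + 2 * i ∧ 100 + 2 * i ≠ 101 + 2 * i := by omega
        simp only [Store.view, Instr.apply, Function.update_apply, run, e, ho, if_true, if_false]
        split_ifs <;> rfl
      · have e : 100 + i ≠ 100 + a ∧ 100 + 2 * i ≠ 100 + 2 * a ∧ 100 + 2 * i ≠ 101 + 2 * a ∧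
          101 + 2 * i ≠ 100 + 2 * a ∧ 101 + 2 * i ≠ 101 + 2 * a := by omega
        simp only [Store.view, Instr.apply, Function.update_apply, run, e, h, if_false]
  | eAdd x p q =>
    simp [ok] at ho
    refine ⟨_, _, .seq (.instr _ _) (.instr _ _), by omega, ?_⟩
    apply view_update_entry
    · intro i hi
      rfl
    · rfl
    · intro i hi
      simp only [Instr.apply, Function.update_apply]
      rw [if_neg (by omega), if_neg (by omega)]
    · rfl
    · have e3 : 100 + 2 * x ≠ 101 + 2 * x ∧ 101 + 2 * x ≠ 100 + 2 * x ∧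
        q ≠ 100 + 2 * x := by omega
      by_cases g2 : σ.reg (100 + x) = 0
      · simp [Instr.apply, Store.view, Store.decode, e3, g2]
      · simp [Instr.apply, Store.view, Store.decode, e3, g2, ho]
  | eVert i x =>
    simp [ok] at ho
    refine ⟨_, _, .instr _ _, by omega, ?_⟩
    ext k
    · simp only [Store.view, Instr.apply, Function.update_apply, run]
      by_cases h : k = i
      · subst h
        simp only [ho, if_true, Store.decode]
        split_ifs with g
        · simp [g]
        · simp
      · simp [h]
    · rfl
    · rfl
    · rfl
    · simp only [Store.view, Instr.apply, Function.update_apply, run]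
      rw [if_neg (by omega)]
    · rfl
  | store a j i =>
    simp [ok] at ho
    refine ⟨_, _, .instr _ _, by omega, ?_⟩
    ext k <;> simp only [Store.view, Instr.apply, Function.update_apply, run]
    · by_cases h : k = a
      · simp [h, ho, Function.update_apply]
      · simp [h]
    · rw [if_neg (by omega)]
  | numStore a j x =>
    simp [ok] at ho
    refine ⟨_, _, .instr _ _, by omega, ?_⟩
    ext k <;> simp only [Store.view, Instr.apply, Function.update_apply, run]
    · by_cases h : k = a
      · simp [h, ho, Function.update_apply]
      · simp [h]
    · rw [if_neg (by omega), if_neg (by omega)]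
  | _ =>
    simp [ok] at ho
    refine ⟨_, _, .instr _ _, by omega, ?_⟩
    ext k <;> simp only [Store.view, Instr.apply, Function.update_apply, run] <;> grind

end Op

/-! ### Programs without loops -/

/-- Programs without loops. -/
inductive Code
  | skip
  | op (o : Op)
  | seq (P Q : Code)
  | cond (b : Test) (P Q : Code)

instance : Coe Op Code := ⟨Code.op⟩

/-- The test succeeds. -/
def Test.Passes (s : Store) : Test → Prop
  | .eq i j => s.reg i = s.reg j
  | .lt i j => s.reg i < s.reg j
  | .numLt x y => s.num x < s.num y

/-- The test uses registers which are not reserved. -/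
def Test.ok : Test → Bool
  | .eq i j | .lt i j | .numLt i j => i < 90 && j < 90

theorem Test.passes_view {b : Test} (hb : b.ok = true) {σ : Memory} :
    b.Passes (Store.view σ) ↔ b.Holds σ := by
  cases b <;> simp [Test.ok] at hb <;> simp [Passes, Holds, Store.view, hb]

namespace Code

/-- Execute the programs of the list one after the other. -/
def block : List Code → Code
  | [] => skip
  | c :: l => seq c (block l)

open Classical in
/-- The effect of a program. -/
noncomputable def run (s : Store) : Code → Store
  | skip => s
  | op o => o.run s
  | seq P Q => Q.run (P.run s)
  | cond b P Q => if b.Passes s then P.run s else Q.run s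

/-- The program for the machine. -/
def prog : Code → Prog
  | skip => .skip
  | op o => o.prog
  | seq P Q => .seq P.prog Q.prog
  | cond b P Q => .cond b P.prog Q.prog

/-- A bound for the number of steps. -/
def time : Code → ℕ
  | skip => 1
  | op _ => 12
  | seq P Q => P.time + Q.time
  | cond _ P Q => P.time + Q.time + 1

/-- Only registers and arrays are used which are not reserved. -/
def ok : Code → Bool
  | skip => true
  | op o => o.ok
  | seq P Q => P.ok && Q.ok
  | cond b P Q => b.ok && P.ok && Q.ok

/-- What the program may change. -/
def targets : Code → List (ℕ × ℕ)
  | skip => []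
  | op o => [o.target]
  | seq P Q => P.targets ++ Q.targets
  | cond _ P Q => P.targets ++ Q.targets

theorem exec : ∀ (c : Code), c.ok = true → ∀ σ : Memory, ∃ τ k, Exec c.prog σ τ k ∧ k ≤ c.time ∧
    Store.view τ = c.run (Store.view σ) := by
  intro c
  induction c with
  | skip => exact fun _ σ => ⟨σ, 1, .skip σ, le_refl _, rfl⟩
  | op o => exact fun h σ => o.exec h σ
  | seq P Q ihP ihQ =>
    intro h σ
    simp only [ok, Bool.and_eq_true] at h
    obtain ⟨τ, k, h1, h2, h3⟩ := ihP h.1 σ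
    obtain ⟨ρ, l, g1, g2, g3⟩ := ihQ h.2 τ
    exact ⟨ρ, _, .seq h1 g1, by simp only [time]; omega, by rw [g3, h3, run]⟩
  | cond b P Q ihP ihQ =>
    intro h σ
    simp only [ok, Bool.and_eq_true] at h
    by_cases hb : b.Holds σ
    · obtain ⟨τ, k, h1, h2, h3⟩ := ihP h.1.2 σ
      exact ⟨τ, _, .condTrue hb h1, by simp only [time]; omega, by
        rw [h3, run, if_pos ((Test.passes_view h.1.1).2 hb)]⟩
    · obtain ⟨τ, k, h1, h2, h3⟩ := ihQ h.2 σ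
      exact ⟨τ, _, .condFalse hb h1, by simp only [time]; omega, by
        rw [h3, run, if_neg (fun hb' => hb ((Test.passes_view h.1.1).1 hb'))]⟩

/-- Both stores agree apart from the listed registers and arrays. -/
def Agree (l : List (ℕ × ℕ)) (s s' : Store) : Prop :=
  (∀ i, (0, i) ∉ l → s'.reg i = s.reg i) ∧ (∀ i, (1, i) ∉ l → s'.arr i = s.arr i) ∧
    (∀ i, (2, i) ∉ l → s'.num i = s.num i) ∧ (∀ i, (3, i) ∉ l → s'.numArr i = s.numArr i) ∧
    (∀ i, (4, i) ∉ l → s'.ereg i = s.ereg i) ∧ (∀ i, (5, i) ∉ l → s'.etab i = s.etab i)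

theorem Agree.refl (l : List (ℕ × ℕ)) (s : Store) : Agree l s s := by
  simp [Agree]

theorem Agree.trans {l : List (ℕ × ℕ)} {s s' s'' : Store} (h : Agree l s s') (h' : Agree l s' s'') :
    Agree l s s'' :=
  ⟨fun i hi => (h'.1 i hi).trans (h.1 i hi), fun i hi => (h'.2.1 i hi).trans (h.2.1 i hi),
    fun i hi => (h'.2.2.1 i hi).trans (h.2.2.1 i hi),
    fun i hi => (h'.2.2.2.1 i hi).trans (h.2.2.2.1 i hi),
    fun i hi => (h'.2.2.2.2.1 i hi).trans (h.2.2.2.2.1 i hi),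
    fun i hi => (h'.2.2.2.2.2 i hi).trans (h.2.2.2.2.2 i hi)⟩

theorem Agree.mono {l l' : List (ℕ × ℕ)} {s s' : Store} (h : Agree l s s') (hl : l ⊆ l') :
    Agree l' s s' :=
  ⟨fun i hi => h.1 i (fun h => hi (hl h)), fun i hi => h.2.1 i (fun h => hi (hl h)),
    fun i hi => h.2.2.1 i (fun h => hi (hl h)), fun i hi => h.2.2.2.1 i (fun h => hi (hl h)),
    fun i hi => h.2.2.2.2.1 i (fun h => hi (hl h)),
    fun i hi => h.2.2.2.2.2 i (fun h => hi (hl h))⟩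

/-- The frame rule: since the targets of concrete code are a concrete list, preservation of a cell
can be settled by `decide`. -/
theorem agree_run (c : Code) : ∀ s, Agree c.targets s (c.run s) := by
  induction c with
  | skip => exact fun s => Agree.refl _ s
  | op o =>
    intro s
    cases o <;> simp +contextual [Agree, targets, Op.target, run, Op.run]
  | seq P Q ihP ihQ =>
    intro s
    exact ((ihP s).mono (by simp [targets])).trans ((ihQ _).mono (by simp [targets]))
  | cond b P Q ihP ihQ =>
    intro s
    rw [run]
    split_ifs
    · exact (ihP s).mono (by simp [targets])
    · exact (ihQ s).mono (by simp [targets])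

end Code

/-! ### Correctness of programs -/

/-- Started in a store with the property `Pre`, the program halts after at most `k` steps in a store
with the property `Post`. -/
def Triple (P : Prog) (Pre : Store → Prop) (k : ℕ) (Post : Store → Prop) : Prop :=
  ∀ σ, Pre (Store.view σ) → ∃ τ l, Exec P σ τ l ∧ l ≤ k ∧ Post (Store.view τ)

namespace Triple

variable {P Q : Prog} {Pre Mid Post : Store → Prop} {k l : ℕ}

theorem seq (h : Triple P Pre k Mid) (h' : Triple Q Mid l Post) :
    Triple (.seq P Q) Pre (k + l) Post := by
  intro σ hσ
  obtain ⟨τ, i, h1, h2, h3⟩ := h σ hσ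
  obtain ⟨ρ, j, g1, g2, g3⟩ := h' τ h3
  exact ⟨ρ, _, .seq h1 g1, by omega, g3⟩

theorem weaken {Post' : Store → Prop} {k' : ℕ} (h : Triple P Pre k Post) (hk : k ≤ k')
    (hP : ∀ s, Post s → Post' s) : Triple P Pre k' Post' := by
  intro σ hσ
  obtain ⟨τ, i, h1, h2, h3⟩ := h σ hσ
  exact ⟨τ, i, h1, h2.trans hk, hP _ h3⟩

theorem code {c : Code} (hc : c.ok = true) (h : ∀ s, Pre s → Post (c.run s)) :
    Triple c.prog Pre c.time Post := by
  intro σ hσ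
  obtain ⟨τ, i, h1, h2, h3⟩ := c.exec hc σ
  exact ⟨τ, i, h1, h2, by rw [h3]; exact h _ hσ⟩

/-- A loop with the invariant `Inv m`, where `m` bounds the number of further iterations. -/
theorem loop {c : Code} (hc : c.ok = true) {b : Test} (hb : b.ok = true) {Inv : ℕ → Store → Prop}
    (hstep : ∀ m s, Inv m s → b.Passes s → ∃ m' < m, Inv m' (c.run s)) (m : ℕ) :
    Triple (.loop b c.prog) (Inv m) ((c.time + 1) * m + 1)
      (fun s => (∃ m', Inv m' s) ∧ ¬ b.Passes s) := by
  induction m using Nat.strong_induction_on with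
  | _ m ih =>
    intro σ hσ
    by_cases h : b.Holds σ
    · obtain ⟨τ, i, h1, h2, h3⟩ := c.exec hc σ
      obtain ⟨m', hm, hi⟩ := hstep m _ hσ ((Test.passes_view hb).2 h)
      rw [← h3] at hi
      obtain ⟨ρ, j, g1, g2, g3⟩ := ih m' hm τ hi
      refine ⟨ρ, _, .loopTrue h h1 g1, ?_, g3⟩
      have : (c.time + 1) * (m' + 1) ≤ (c.time + 1) * m := Nat.mul_le_mul_left _ hm
      rw [Nat.mul_add] at this
      omega
    · exact ⟨σ, 1, .loopFalse h, by omega, ⟨m, hσ⟩, fun h' => h ((Test.passes_view hb).1 h')⟩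

/-- A loop which is started with at most `M` further iterations. -/
theorem loop_le {c : Code} (hc : c.ok = true) {b : Test} (hb : b.ok = true)
    (Inv : ℕ → Store → Prop) {M : ℕ} (hpre : ∀ s, Pre s → ∃ m ≤ M, Inv m s)
    (hstep : ∀ m s, Inv m s → b.Passes s → ∃ m' < m, Inv m' (c.run s))
    (hpost : ∀ m s, Inv m s → ¬ b.Passes s → Post s) :
    Triple (.loop b c.prog) Pre ((c.time + 1) * M + 1) Post := by
  intro σ hσ
  obtain ⟨m, hm, hi⟩ := hpre _ hσ
  obtain ⟨τ, l, h1, h2, ⟨m', h3⟩, h4⟩ := loop hc hb hstep m σ hi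
  refine ⟨τ, l, h1, ?_, hpost _ _ h3 h4⟩
  have := Nat.mul_le_mul_left (c.time + 1) hm
  omega

end Triple

end ShortestPathGame

/-! ### Building the adjacency lists and running the search on the machine -/

namespace ShortestPathGame

/-! ### The adjacency lists -/

section

variable {n : ℕ} (I : Game n) (L : List (Fin n × Fin n))

/-- The store contains the instance. -/
structure Given (s : Store) : Prop where
  start : s.reg 1 = I.s
  target : s.reg 2 = I.t
  zero : s.reg 9 = 0
  tail : ∀ {e : ℕ} {u w : Fin n}, L[e]? = some (u, w) → s.arr 0 e = u
  head : ∀ {e : ℕ} {u w : Fin n}, L[e]? = some (u, w) → s.arr 1 e = w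
  cost : ∀ {e : ℕ} {u w : Fin n}, L[e]? = some (u, w) → s.numArr 0 e = I.cost u w

variable {I L}

theorem Given.agree {s s' : Store} {l : List (ℕ × ℕ)} (h : Given I L s) (ha : Code.Agree l s s')
    (hl : ∀ x ∈ [(0, 1), (0, 2), (0, 9), (1, 0), (1, 1), (3, 0)], x ∉ l) : Given I L s' := by
  simp only [List.mem_cons, List.not_mem_nil, or_false, forall_eq_or_imp, forall_eq] at hl
  obtain ⟨h1, h2, h3, h4, h5, h6⟩ := hl
  obtain ⟨a0, a1, -, a3, -⟩ := ha
  exact ⟨by rw [a0 _ h1, h.start], by rw [a0 _ h2, h.target], by rw [a0 _ h3, h.zero],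
    by rw [a1 _ h4]; exact h.tail, by rw [a1 _ h5]; exact h.head, by rw [a3 _ h6]; exact h.cost⟩

/-- The arrays from `k` on have not been used yet. -/
structure Fresh (k : ℕ) (s : Store) : Prop where
  arr : ∀ i, k ≤ i → i < 30 → s.arr i = fun _ => 0
  etab : ∀ i, s.etab i = fun _ => ⊤

theorem Fresh.agree {k : ℕ} {s s' : Store} {l : List (ℕ × ℕ)} (h : Fresh k s)
    (ha : Code.Agree l s s') (hl : ∀ x ∈ l, (x.1 = 1 → x.2 < k) ∧ x.1 ≠ 5) : Fresh k s' := by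
  constructor
  · intro i hi hi'
    rw [ha.2.1, h.arr i hi hi']
    intro hm
    have := (hl _ hm).1 rfl
    dsimp only at this
    omega
  · intro i
    rw [ha.2.2.2.2.2, h.etab i]
    intro hm
    exact (hl _ hm).2 rfl

theorem Fresh.mono {k k' : ℕ} {s : Store} (h : Fresh k s) (hk : k ≤ k') : Fresh k' s :=
  ⟨fun i hi => h.arr i (hk.trans hi), h.etab⟩

variable (L) in
/-- Starting with the arc number `a - 1`, the links `f` lead through arcs from `u` to the vertices
in the list; the numbers increase and are at least `b`. -/
inductive Links (f : ℕ → ℕ) (u : Fin n) : ℕ → ℕ → List (Fin n) → Prop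
  | nil (b : ℕ) : Links f u b 0 []
  | cons {b e : ℕ} {w : Fin n} {l : List (Fin n)} (hb : b ≤ e) (he : L[e]? = some (u, w))
      (h : Links f u (e + 1) (f (e + 1)) l) : Links f u b (e + 1) (w :: l)

theorem Links.mono {f : ℕ → ℕ} {u : Fin n} {b b' a : ℕ} {l : List (Fin n)}
    (h : Links L f u b a l) (hb : b' ≤ b) : Links L f u b' a l := by
  cases h with
  | nil => exact .nil _
  | cons h1 h2 h3 => exact .cons (hb.trans h1) h2 h3

/-- A list of arcs with numbers at least `b` reads only cells beyond `b`. -/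
theorem Links.update {f : ℕ → ℕ} {u : Fin n} {b a : ℕ} {l : List (Fin n)}
    (h : Links L f u b a l) (i v : ℕ) (hi : i ≤ b) :
    Links L (Function.update f i v) u b a l := by
  induction h with
  | nil => exact .nil _
  | cons h1 h2 h3 ih =>
    refine .cons h1 h2 ?_
    rw [Function.update_of_ne (by omega)]
    exact ih (by omega)

/-- The heads of the arcs from `u` in the list. -/
def heads (L : List (Fin n × Fin n)) (u : Fin n) : List (Fin n) :=
  (L.filter fun a => a.1 = u).map Prod.snd

theorem mem_heads {u w : Fin n} : w ∈ heads L u ↔ (u, w) ∈ L := by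
  simp only [heads, List.mem_map, List.mem_filter, decide_eq_true_eq, Prod.exists]
  constructor
  · rintro ⟨a, b, ⟨h, rfl⟩, rfl⟩; exact h
  · intro h; exact ⟨u, w, ⟨h, rfl⟩, rfl⟩

theorem nodup_heads (hL : L.Nodup) (u : Fin n) : (heads L u).Nodup := by
  refine List.Nodup.map_on ?_ (hL.filter _)
  intro a ha b hb h
  simp only [List.mem_filter, decide_eq_true_eq] at ha hb
  exact Prod.ext (ha.2.trans hb.2.symm) h

theorem sum_length_heads (L : List (Fin n × Fin n)) : ∑ u, (heads L u).length = L.length := by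
  induction L with
  | nil => simp [heads]
  | cons a L ih =>
    have : ∀ u, (heads (a :: L) u).length = (if a.1 = u then 1 else 0) + (heads L u).length := by
      intro u
      unfold heads
      by_cases h : a.1 = u
      · simp [h]; omega
      · simp [h]
    simp only [this, Finset.sum_add_distrib, ih]
    simp
    omega

/-- The program which inserts an arc into the list of its tail. -/
def linkArc : Code := Code.block [Op.pred 6 5, Op.load 7 0 6, Op.load 8 11 7, Op.store 10 5 8,
  Op.store 11 7 5, Op.copy 5 6]

/-- The invariant for inserting the arcs. -/
structure Linked (I : Game n) (L : List (Fin n × Fin n)) (m : ℕ) (s : Store) : Prop where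
  given : Given I L s
  fresh : Fresh 12 s
  count : s.reg 5 = m
  le : m ≤ L.length
  links : ∀ u : Fin n, Links L (s.arr 10) u m (s.arr 11 u) (heads (L.drop m) u)

/-- The arcs are inserted from the last to the first, so links lead to arcs with larger numbers, and
the cell written for the new arc is not read by the old lists. -/
theorem Linked.step {m : ℕ} {s : Store} (h : Linked I L m s) (hm : (Test.lt 9 5).Passes s) :
    ∃ m' < m, Linked I L m' (linkArc.run s) := by
  have ha := linkArc.agree_run s
  simp only [Test.Passes, h.given.zero, h.count] at hm
  obtain ⟨m, rfl⟩ : ∃ k, m = k + 1 := ⟨m - 1, by omega⟩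
  have hlt : m < L.length := h.le
  obtain ⟨⟨u, w⟩, huw⟩ : ∃ a, L[m] = a := ⟨_, rfl⟩
  have hget : L[m]? = some (u, w) := by rw [List.getElem?_eq_getElem hlt, huw]
  have hdrop : L.drop m = (u, w) :: L.drop (m + 1) := by rw [List.drop_eq_getElem_cons hlt, huw]
  have e0 := h.given.tail hget
  refine ⟨m, by omega, h.given.agree ha (by decide), h.fresh.agree ha (by decide), ?_, by omega, ?_⟩
  · simp [linkArc, Code.block, Code.run, Op.run, h.count]
  · intro x
    have e1 : (linkArc.run s).arr 10 = Function.update (s.arr 10) (m + 1) (s.arr 11 u) := by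
      simp [linkArc, Code.block, Code.run, Op.run, h.count, e0]
    have e2 : (linkArc.run s).arr 11 = Function.update (s.arr 11) u (m + 1) := by
      simp [linkArc, Code.block, Code.run, Op.run, h.count, e0]
    rw [e1, e2]
    by_cases hx : x = u
    · subst hx
      rw [Function.update_self]
      have : heads (L.drop m) x = w :: heads (L.drop (m + 1)) x := by
        rw [hdrop]
        simp [heads]
      rw [this]
      refine .cons le_rfl hget ?_
      rw [Function.update_self]
      exact (h.links x).update _ _ le_rfl
    · rw [Function.update_of_ne (fun h => hx (Fin.ext h))]
      have : heads (L.drop m) x = heads (L.drop (m + 1)) x := by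
        rw [hdrop]
        simp [heads, Ne.symm hx]
      rw [this]
      exact ((h.links x).update _ _ le_rfl).mono (by omega)

/-! ### Depth-first search on the machine -/

/-- The array contains the stack, the top at the end. -/
def Stacked (f : ℕ → ℕ) : List (Fin n) → Prop
  | [] => True
  | u :: S => f S.length = u ∧ Stacked f S

theorem Stacked.update {f : ℕ → ℕ} : ∀ {S : List (Fin n)}, Stacked f S → ∀ (i v : ℕ),
    S.length ≤ i → Stacked (Function.update f i v) S := by
  intro S
  induction S with
  | nil => intro _ _ _ _; trivial
  | cons u S ih =>
    intro h i v hi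
    simp only [List.length_cons] at hi
    refine ⟨?_, ih h.2 i v (by omega)⟩
    rw [Function.update_of_ne (by omega)]
    exact h.1

variable (L) in
/-- The arrays contain the event in cell `i`. -/
def EventAt (f g : ℕ → ℕ) (i : ℕ) : Event n → Prop
  | (u, none) => f i = u ∧ g i = 0
  | (u, some w) => f i = u ∧ ∃ e, g i = e + 1 ∧ L[e]? = some (u, w)

variable (L) in
/-- The arrays contain the list of events. -/
def Events (f g : ℕ → ℕ) (ev : List (Event n)) : Prop :=
  ∀ pre e suf, ev = pre ++ e :: suf → EventAt L f g pre.length e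

theorem Events.append {f g : ℕ → ℕ} {ev : List (Event n)} (h : Events L f g ev) {a b : ℕ}
    {e : Event n} (he : EventAt L (fun _ => a) (fun _ => b) 0 e) :
    Events L (Function.update f ev.length a) (Function.update g ev.length b) (ev ++ [e]) := by
  refine Search.forall_split_append (P := fun pre e => EventAt L (Function.update f ev.length a)
    (Function.update g ev.length b) pre.length e) ?_ ?_
  · intro pre e suf h'
    have hne : pre.length ≠ ev.length := by rw [h']; simp
    have := h pre e suf h'
    obtain ⟨u, _ | w⟩ := e
    · simpa only [EventAt, Function.update_of_ne hne] using this
    · simpa only [EventAt, Function.update_of_ne hne] using this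
  · obtain ⟨u, _ | w⟩ := e
    · simpa only [EventAt, Function.update_self] using he
    · simpa only [EventAt, Function.update_self] using he

/-- Finish the vertex on top of the stack. -/
def searchPop : Code := Code.block [Op.store 14 10 6, Op.store 15 10 9, Op.succ 10 10, Op.copy 8 5]

/-- Push a new vertex. -/
def searchPush : Code := Code.block [Op.const 13 1, Op.store 12 11 13, Op.store 13 8 11, Op.succ 8 8]

/-- Scan an arc. -/
def searchScan : Code := Code.block [Op.store 14 10 6, Op.store 15 10 7, Op.succ 10 10,
  Op.load 12 10 7, Op.store 11 6 12]

/-- A step of the depth-first search. -/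
def searchStep : Code := Code.block [Op.pred 5 8, Op.load 6 13 5, Op.load 7 11 6,
  Code.cond (.eq 7 9) searchPop (Code.block [Op.pred 11 7, Op.load 11 1 11, Op.load 12 12 11,
    Code.cond (.eq 12 9) searchPush searchScan])]

/-- The store contains the state of the search. -/
structure Searching (I : Game n) (L : List (Fin n × Fin n)) (d : Search n) (s : Store) : Prop where
  given : Given I L s
  fresh : Fresh 16 s
  size : s.reg 8 = d.stack.length
  stack : Stacked (s.arr 13) d.stack
  visited : ∀ x : Fin n, s.arr 12 x ≠ 0 ↔ x ∈ d.done ++ d.stack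
  links : ∀ u : Fin n, Links L (s.arr 10) u 0 (s.arr 11 u) (d.rem u)
  count : s.reg 10 = d.events.length
  events : Events L (s.arr 14) (s.arr 15) d.events

/-- The link of the vertex on top of the stack decides: `0` means that no arc is left, and `e + 1`
stands for arc number `e`, whose head is pushed or scanned according to the marks in array 12. -/
theorem Searching.step {d : Search n} {s : Store} (h : Searching I L d s)
    (hs : (Test.lt 9 8).Passes s) : ∃ d', d.Step d' ∧ Searching I L d' (searchStep.run s) := by
  have ha := searchStep.agree_run s
  have hg := h.given.agree ha (by decide)
  have hf := h.fresh.agree ha (by decide)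
  obtain ⟨S, D, rem, ev⟩ := d
  simp only [Test.Passes, h.given.zero, h.size] at hs
  cases S with
  | nil => simp at hs
  | cons u S =>
  have h0 := h.given.zero
  have hsz := h.size
  have hcnt := h.count
  have hst := h.stack
  dsimp only [List.length_cons] at hsz hcnt hst
  have hu : s.arr 13 S.length = u := hst.1
  have hlinks := h.links u
  dsimp only at hlinks
  generalize hr : rem u = r at hlinks
  generalize hp : s.arr 11 u = a at hlinks
  cases hlinks with
  | nil =>
    refine ⟨_, .pop hr, ?_⟩
    have hrun : searchStep.run s = { s with
        reg := (searchStep.run s).reg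
        arr := Function.update (Function.update s.arr 14
          (Function.update (s.arr 14) ev.length u)) 15 (Function.update (s.arr 15) ev.length 0) } := by
      simp [searchStep, searchPop, Code.block, Code.run, Op.run, Test.Passes, hsz, hcnt, hu, hp, h0]
    have hreg : (searchStep.run s).reg 8 = S.length ∧ (searchStep.run s).reg 10 = ev.length + 1 := by
      simp [searchStep, searchPop, Code.block, Code.run, Op.run, Test.Passes, hsz, hcnt, hu, hp, h0]
    have harr := congrArg Store.arr hrun
    dsimp only at harr
    refine ⟨hg, hf, hreg.1, ?_, ?_, ?_, ?_, ?_⟩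
    · simpa [harr] using hst.2
    · intro x
      simpa [harr] using h.visited x
    · intro x
      simpa [harr] using h.links x
    · simpa using hreg.2
    · simpa [harr] using h.events.append (e := (u, none)) ⟨rfl, rfl⟩
  | @cons _ e w l _ he hl =>
    have hw := h.given.head he
    by_cases hv : s.arr 12 w = 0
    · refine ⟨_, .push hr (fun hm => (h.visited w).2 hm hv), ?_⟩
      have hrun : searchStep.run s = { s with
          reg := (searchStep.run s).reg
          arr := Function.update (Function.update s.arr 12
            (Function.update (s.arr 12) w 1)) 13 (Function.update (s.arr 13) (S.length + 1) w) } := by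
        simp [searchStep, searchPush, Code.block, Code.run, Op.run, Test.Passes, hsz, hu, hp,
          h0, hw, hv]
      have hreg : (searchStep.run s).reg 8 = S.length + 2 ∧
          (searchStep.run s).reg 10 = ev.length := by
        simp [searchStep, searchPush, Code.block, Code.run, Op.run, Test.Passes, hsz, hcnt, hu, hp,
          h0, hw, hv]
      have harr := congrArg Store.arr hrun
      dsimp only at harr
      refine ⟨hg, hf, hreg.1, ?_, ?_, ?_, ?_, ?_⟩
      · simp only [harr, Function.update_self]
        exact ⟨by simp, hst.update _ _ (by simp)⟩
      · intro x
        have := h.visited x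
        simp only [List.mem_append, List.mem_cons] at this
        by_cases hx : x = w
        · simp [harr, hx]
        · have hx' : (x : ℕ) ≠ w := fun h => hx (Fin.ext h)
          simp [harr, hx, hx', this]
      · intro x
        simpa [harr] using h.links x
      · simpa using hreg.2
      · simpa [harr] using h.events
    · refine ⟨_, .scan hr ((h.visited w).1 hv), ?_⟩
      have hrun : searchStep.run s = { s with
          reg := (searchStep.run s).reg
          arr := Function.update (Function.update (Function.update s.arr 14
            (Function.update (s.arr 14) ev.length u)) 15
            (Function.update (s.arr 15) ev.length (e + 1))) 11
            (Function.update (s.arr 11) u (s.arr 10 (e + 1))) } := by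
        simp [searchStep, searchScan, Code.block, Code.run, Op.run, Test.Passes, hsz, hcnt, hu, hp,
          h0, hw, hv]
      have hreg : (searchStep.run s).reg 8 = S.length + 1 ∧
          (searchStep.run s).reg 10 = ev.length + 1 := by
        simp [searchStep, searchScan, Code.block, Code.run, Op.run, Test.Passes, hsz, hcnt, hu, hp,
          h0, hw, hv]
      have harr := congrArg Store.arr hrun
      dsimp only at harr
      refine ⟨hg, hf, hreg.1, ?_, ?_, ?_, ?_, ?_⟩
      · simpa [harr] using hst
      · intro x
        simpa [harr] using h.visited x
      · intro x
        by_cases hx : x = u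
        · subst hx
          simpa [harr] using hl.mono (Nat.zero_le _)
        · have hx' : (x : ℕ) ≠ u := fun h => hx (Fin.ext h)
          simpa [harr, hx, hx'] using h.links x
      · simpa using hreg.2
      · simpa [harr] using h.events.append (e := (u, some w)) ⟨rfl, e, rfl, he⟩

end

end ShortestPathGame

/-! ### The search produces a schedule; passes through it -/

namespace ShortestPathGame

section

variable {n : ℕ} {I : Game n} {L : List (Fin n × Fin n)}

variable (I L) in
/-- The store contains a schedule. -/
structure Scheduled (ev : List (Event n)) (s : Store) : Prop where
  given : Given I L s
  count : s.reg 10 = ev.length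
  events : Events L (s.arr 14) (s.arr 15) ev

theorem Scheduled.agree {ev : List (Event n)} {s s' : Store} {l : List (ℕ × ℕ)}
    (h : Scheduled I L ev s) (ha : Code.Agree l s s')
    (hl : ∀ x ∈ [(0, 1), (0, 2), (0, 9), (1, 0), (1, 1), (3, 0), (0, 10), (1, 14), (1, 15)],
      x ∉ l) : Scheduled I L ev s' := by
  refine ⟨h.given.agree ha fun x hx => hl x (by simp at hx ⊢; tauto), ?_, ?_⟩
  · rw [ha.1 _ (hl _ (by simp)), h.count]
  · rw [ha.2.1 _ (hl _ (by simp)), ha.2.1 _ (hl _ (by simp))]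
    exact h.events

/-- Preparation of the search. -/
def searchInit : Code := Code.block [Op.store 13 9 1, Op.const 5 1, Op.store 12 1 5, Op.copy 8 5,
  Op.const 10 0]

/-- The program for the search. -/
def searchProg : Prog := .seq (Code.op (.copy 5 3)).prog (.seq (.loop (.lt 9 5) linkArc.prog)
  (.seq searchInit.prog (.loop (.lt 9 8) searchStep.prog)))

theorem view_input (I : Game n) (L : List (Fin n × Fin n)) :
    Given I L (Store.view (input I L)) ∧ Fresh 10 (Store.view (input I L)) ∧
      (Store.view (input I L)).reg 3 = L.length := by
  refine ⟨⟨?_, ?_, ?_, ?_, ?_, ?_⟩, ⟨?_, ?_⟩, ?_⟩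
  · simp [Store.view, input]
  · simp [Store.view, input]
  · simp [Store.view, input]
  · intro e u w h
    simp [Store.view, input, h]
  · intro e u w h
    simp [Store.view, input, h]
  · intro e u w h
    simp [Store.view, input, h]
  · intro i hi hi'
    funext j
    simp [Store.view, input, show i ≠ 0 by omega, show i ≠ 1 by omega]
  · intro i
    funext j
    simp [Store.view, input, Store.decode, show 100 + i ≠ 1 by omega]
  · simp [Store.view, input]

theorem Linked.init {s : Store} (h : Linked I L 0 s) (hL : ListsArcs I.graph L) :
    ∃ d : Search n, d.Inv I ∧ d.events = [] ∧ d.fuel ≤ 2 * n + L.length ∧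
      Searching I L d (searchInit.run s) := by
  have ha := searchInit.agree_run s
  refine ⟨⟨[I.s], [], heads L, []⟩, ⟨by simp, by simp, ?_, by simp, ?_, ?_, ?_, ?_, by simp,
    by simp⟩, rfl, ?_, ⟨h.given.agree ha (by decide), (h.fresh.mono (by omega)).agree ha (by decide),
      ?_, ⟨?_, trivial⟩, ?_, ?_, ?_, by simp [Events]⟩⟩
  · intro x hx
    simp at hx
    subst hx
    exact .refl
  · intro x hx hxs
    simp at hx
    exact absurd hx hxs
  · intro u w hw
    exact ⟨(hL.2 (u, w)).1 (mem_heads.1 hw), by simp⟩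
  · intro u w hw
    exact Or.inl (mem_heads.2 ((hL.2 (u, w)).2 hw))
  · exact nodup_heads hL.1
  · have := I.s.pos
    simp [Search.fuel, sum_length_heads]
    omega
  · simp [searchInit, Code.block, Code.run, Op.run]
  · simp [searchInit, Code.block, Code.run, Op.run, h.given.zero, h.given.start]
  · intro x
    have h1 : (searchInit.run s).arr 12 = Function.update (s.arr 12) I.s 1 := by
      simp [searchInit, Code.block, Code.run, Op.run, h.given.start]
    rw [h1, h.fresh.arr 12 (by omega) (by omega)]
    simp [Function.update_apply, Fin.ext_iff]
  · intro u
    rw [ha.2.1 10 (by decide), ha.2.1 11 (by decide)]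
    exact h.links u
  · simp [searchInit, Code.block, Code.run, Op.run]

/-- The first loop runs once per arc, the second at most as often as the initial fuel, which is at
most `2 * n + L.length`. The same number bounds the events. -/
theorem searchProg_triple (hL : ListsArcs I.graph L) :
    Triple searchProg (fun s => s = Store.view (input I L))
      (12 + ((linkArc.time + 1) * L.length + 1 + (searchInit.time +
        ((searchStep.time + 1) * (2 * n + L.length) + 1))))
      (fun s => ∃ (K : Ranking I) (ev : List (Event n)), Schedule I K.rank ev ∧
        ev.length ≤ 2 * n + L.length ∧ Scheduled I L ev s ∧ Fresh 16 s) := by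
  refine .seq (Mid := Linked I L L.length) (Triple.code rfl ?_) (.seq (Mid := Linked I L 0) ?_
    (.seq (Mid := fun s => ∃ m', m' ≤ 2 * n + L.length ∧ ∃ d : Search n, d.Inv I ∧ d.fuel = m' ∧
      d.events.length + d.fuel ≤ 2 * n + L.length ∧ Searching I L d s) (Triple.code rfl ?_) ?_))
  · rintro s rfl
    obtain ⟨h1, h2, h3⟩ := view_input I L
    have ha := Code.agree_run (.op (.copy 5 3)) (Store.view (input I L))
    have h2' := (h2.agree (k := 10) ha (by decide))
    refine ⟨h1.agree ha (by decide), h2'.mono (by omega), ?_, le_rfl, ?_⟩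
    · simp [Code.run, Op.run, h3]
    · intro u
      rw [h2'.arr 11 (by omega) (by omega)]
      simp only [List.drop_length]
      exact .nil _
  · refine (Triple.loop rfl rfl (Inv := Linked I L) (fun m s => Linked.step) _).weaken le_rfl ?_
    rintro s ⟨⟨m, hm⟩, hb⟩
    have : m = 0 := by
      simp only [Test.Passes, hm.given.zero, hm.count] at hb
      omega
    rwa [this] at hm
  · intro s hs
    obtain ⟨d, h1, h2, h3, h4⟩ := hs.init hL
    exact ⟨d.fuel, h3, d, h1, rfl, by simpa [h2] using h3, h4⟩
  · refine Triple.loop_le rfl rfl (fun m s => ∃ d : Search n, d.Inv I ∧ d.fuel = m ∧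
      d.events.length + d.fuel ≤ 2 * n + L.length ∧ Searching I L d s) (fun s hs => hs) ?_ ?_
    · rintro m s ⟨d, h1, h2, h3, h4⟩ hb
      obtain ⟨d', h5, h6⟩ := h4.step hb
      have h7 := h1.step h5
      have h8 := h5.fuel h7.nodup
      exact ⟨d'.fuel, by omega, d', h7, rfl, by omega, h6⟩
    · rintro m s ⟨d, h1, h2, h3, h4⟩ hb
      have hnil : d.stack = [] := by
        simp only [Test.Passes, h4.given.zero, h4.size] at hb
        exact List.eq_nil_of_length_eq_zero (by omega)
      obtain ⟨K, hK⟩ := h1.exists_schedule hnil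
      exact ⟨K, d.events, hK, by omega, ⟨h4.given, h4.count, h4.events⟩, h4.fresh⟩

/-! ### Passes through the schedule -/

/-- Load the current event, and execute `P` when a vertex is finished, `Q` for an arc. -/
def eventCode (P Q : Code) : Code := Code.block [Op.load 6 14 5, Op.load 7 15 5,
  Code.cond (.eq 7 9) P (Code.block [Op.pred 8 7, Op.load 7 1 8, Op.numLoad 0 0 8, Q])]

/-- The registers and arrays which have to be preserved during a pass. -/
def passKeeps : List (ℕ × ℕ) :=
  [(0, 1), (0, 2), (0, 9), (1, 0), (1, 1), (3, 0), (0, 10), (1, 14), (1, 15), (0, 5)]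

/-- Properties of the arrays after the events of the list. -/
abbrev Stage (n : ℕ) :=
  List (Event n) → (ℕ → ℕ → ℕ) → (ℕ → ℕ → ℝ) → (ℕ → ℕ → Entry) → Prop

/-- The code `P` deals with finished vertices and `Q` with arcs. -/
structure Handles (I : Game n) (L : List (Fin n × Fin n)) (ev : List (Event n)) (P Q : Code)
    (J J' : List (Event n) → Event n → Store → Prop) : Prop where
  keeps : ∀ x ∈ passKeeps, x ∉ P.targets ++ Q.targets
  okP : P.ok = true
  okQ : Q.ok = true
  fin : ∀ pre u suf s, ev = pre ++ (u, none) :: suf → Scheduled I L ev s → J pre (u, none) s →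
    s.reg 6 = u → J' pre (u, none) (P.run s)
  arc : ∀ pre u w suf s, ev = pre ++ (u, some w) :: suf → Scheduled I L ev s →
    J pre (u, some w) s → s.reg 6 = u → s.reg 7 = w → s.num 0 = I.cost u w →
    J' pre (u, some w) (Q.run s)

/-- Loading the event changes registers only, so by `hJ` a property of the arrays survives until the
event is handled. -/
theorem Handles.step {ev : List (Event n)} {P Q : Code}
    {J J' : List (Event n) → Event n → Store → Prop} (h : Handles I L ev P Q J J')
    (hJ : ∀ pre e s s', s'.arr = s.arr → s'.numArr = s.numArr → s'.etab = s.etab →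
      J pre e s → J pre e s') {s : Store} (hs : Scheduled I L ev s) {pre suf : List (Event n)}
    {e : Event n} (he : ev = pre ++ e :: suf) (h5 : s.reg 5 = pre.length) (hp : J pre e s) :
    Scheduled I L ev ((eventCode P Q).run s) ∧ ((eventCode P Q).run s).reg 5 = pre.length ∧
      J' pre e ((eventCode P Q).run s) := by
  have ha := (eventCode P Q).agree_run s
  have hk : ∀ x ∈ passKeeps, x ∉ (eventCode P Q).targets := by
    intro x hx hm
    have := h.keeps x hx
    simp only [eventCode, Code.block, Code.targets, Op.target, List.mem_append, List.mem_cons,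
      List.not_mem_nil, or_false] at hm this
    have aux : ∀ x ∈ passKeeps, x ≠ (0, 6) ∧ x ≠ (0, 7) ∧ x ≠ (0, 8) ∧ x ≠ (2, 0) := by decide
    have := aux x hx
    tauto
  refine ⟨hs.agree ha fun x hx => hk x ?_, ?_, ?_⟩
  · have aux : ∀ x ∈ [(0, 1), (0, 2), (0, 9), (1, 0), (1, 1), (3, 0), (0, 10), (1, 14), (1, 15)],
      x ∈ passKeeps := by decide
    exact aux x hx
  · rw [ha.1 5 (hk _ (by decide)), h5]
  · have hev := hs.events pre e suf he
    obtain ⟨u, _ | w⟩ := e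
    · obtain ⟨h1, h2⟩ := hev
      have : (eventCode P Q).run s = P.run ((Code.block [Op.load 6 14 5, Op.load 7 15 5]).run s) := by
        simp [eventCode, Code.block, Code.run, Op.run, Test.Passes, h5, h2, hs.given.zero]
      rw [this]
      have hb := (Code.block [Op.load 6 14 5, Op.load 7 15 5]).agree_run s
      refine h.fin _ _ _ _ he (hs.agree hb (by decide)) (hJ _ _ _ _ ?_ ?_ ?_ hp) ?_
      · rfl
      · rfl
      · rfl
      · simp [Code.block, Code.run, Op.run, h5, h1]
    · obtain ⟨h1, e, h2, h3⟩ := hev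
      have : (eventCode P Q).run s = Q.run ((Code.block [Op.load 6 14 5, Op.load 7 15 5,
          Op.pred 8 7, Op.load 7 1 8, Op.numLoad 0 0 8]).run s) := by
        simp [eventCode, Code.block, Code.run, Op.run, Test.Passes, h5, h2, hs.given.zero]
      rw [this]
      have hb := (Code.block [Op.load 6 14 5, Op.load 7 15 5,
          Op.pred 8 7, Op.load 7 1 8, Op.numLoad 0 0 8]).agree_run s
      refine h.arc _ _ _ _ _ he (hs.agree hb (by decide)) (hJ _ _ _ _ ?_ ?_ ?_ hp) ?_ ?_ ?_
      · rfl
      · rfl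
      · rfl
      · simp [Code.block, Code.run, Op.run, h5, h1]
      · simp [Code.block, Code.run, Op.run, h5, h2, hs.given.head h3]
      · simp [Code.block, Code.run, Op.run, h5, h2, hs.given.cost h3]

/-- A pass through the schedule. -/
def upProg (P Q : Code) : Prog := .seq (Code.op (.copy 5 9)).prog
  (.loop (.lt 5 10) (Code.block [eventCode P Q, Op.succ 5 5]).prog)

/-- A pass through the schedule in reverse order. -/
def downProg (P Q : Code) : Prog := .seq (Code.op (.copy 5 10)).prog
  (.loop (.lt 9 5) (Code.block [Op.pred 5 5, eventCode P Q]).prog)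

theorem eventCode_ok {P Q : Code} (hP : P.ok = true) (hQ : Q.ok = true) :
    (eventCode P Q).ok = true := by
  simp [eventCode, Code.block, Code.ok, Op.ok, Test.ok, hP, hQ]

theorem upProg_triple {ev : List (Event n)} {P Q : Code} {J : Stage n}
    (h : Handles I L ev P Q (fun pre _ s => J pre s.arr s.numArr s.etab)
      (fun pre e s => J (pre ++ [e]) s.arr s.numArr s.etab)) :
    Triple (upProg P Q) (fun s => Scheduled I L ev s ∧ J [] s.arr s.numArr s.etab)
      (12 + (((Code.block [eventCode P Q, Op.succ 5 5]).time + 1) * ev.length + 1))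
      (fun s => Scheduled I L ev s ∧ J ev s.arr s.numArr s.etab) := by
  refine .seq (Triple.code rfl (Post := fun s => Scheduled I L ev s ∧ s.reg 5 = 0 ∧
    J [] s.arr s.numArr s.etab) ?_) ?_
  · rintro s ⟨h1, h2⟩
    refine ⟨h1.agree (Code.agree_run _ s) (by decide), ?_, h2⟩
    simp [Code.run, Op.run, h1.given.zero]
  · refine Triple.loop_le ?_ rfl (fun m s => Scheduled I L ev s ∧ ∃ pre suf,
      ev = pre ++ suf ∧ s.reg 5 = pre.length ∧ suf.length = m ∧ J pre s.arr s.numArr s.etab)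
      (fun s hs => ⟨_, le_rfl, hs.1, [], ev, rfl, hs.2.1, rfl, hs.2.2⟩) ?_ ?_
    · simp [Code.block, Code.ok, Op.ok, eventCode_ok h.okP h.okQ]
    · rintro m s ⟨h1, pre, suf, h2, h3, h4, h5⟩ hb
      simp only [Test.Passes, h1.count, h3, h2, List.length_append] at hb
      cases suf with
      | nil => simp at hb
      | cons e suf =>
        obtain ⟨g1, g2, g3⟩ := h.step (by
          intro pre e s s' e1 e2 e3 hJ
          simpa only [e1, e2, e3] using hJ) h1 h2 h3 h5
        refine ⟨suf.length, by simp at h4; omega, ?_⟩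
        have hrun : (Code.block [eventCode P Q, Op.succ 5 5]).run s =
            Op.run ((eventCode P Q).run s) (.succ 5 5) := rfl
        rw [hrun]
        refine ⟨g1.agree (Code.agree_run (.op (.succ 5 5)) _) (by decide), pre ++ [e], suf,
          by simp [h2], by simp [Op.run, g2], rfl, g3⟩
    · rintro m s ⟨h1, pre, suf, h2, h3, h4, h5⟩ hb
      simp only [Test.Passes, h1.count, h3, h2, List.length_append] at hb
      have : suf = [] := List.eq_nil_of_length_eq_zero (by omega)
      subst this
      rw [List.append_nil] at h2
      subst h2
      exact ⟨h1, h5⟩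

theorem downProg_triple {ev : List (Event n)} {P Q : Code} {J : Stage n}
    (h : Handles I L ev P Q (fun pre e s => J (pre ++ [e]) s.arr s.numArr s.etab)
      (fun pre _ s => J pre s.arr s.numArr s.etab)) :
    Triple (downProg P Q) (fun s => Scheduled I L ev s ∧ J ev s.arr s.numArr s.etab)
      (12 + (((Code.block [Op.pred 5 5, eventCode P Q]).time + 1) * ev.length + 1))
      (fun s => Scheduled I L ev s ∧ J [] s.arr s.numArr s.etab) := by
  refine .seq (Triple.code rfl (Post := fun s => Scheduled I L ev s ∧ s.reg 5 = ev.length ∧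
    J ev s.arr s.numArr s.etab) ?_) ?_
  · rintro s ⟨h1, h2⟩
    refine ⟨h1.agree (Code.agree_run _ s) (by decide), ?_, h2⟩
    simp [Code.run, Op.run, h1.count]
  · refine Triple.loop_le ?_ rfl (fun m s => Scheduled I L ev s ∧ ∃ pre suf,
      ev = pre ++ suf ∧ s.reg 5 = pre.length ∧ pre.length = m ∧ J pre s.arr s.numArr s.etab)
      (fun s hs => ⟨_, le_rfl, hs.1, ev, [], by simp, hs.2.1, rfl, hs.2.2⟩) ?_ ?_
    · simp [Code.block, Code.ok, Op.ok, eventCode_ok h.okP h.okQ]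
    · rintro m s ⟨h1, pre, suf, h2, h3, h4, h5⟩ hb
      simp only [Test.Passes, h1.given.zero, h3] at hb
      rcases List.eq_nil_or_concat pre with rfl | ⟨pre, e, rfl⟩
      · simp at hb
      · rw [List.concat_eq_append] at h2 h3 h4 h5
        have hrun : (Code.block [Op.pred 5 5, eventCode P Q]).run s =
            (eventCode P Q).run (Op.run s (.pred 5 5)) := rfl
        rw [hrun]
        obtain ⟨g1, g2, g3⟩ := h.step (s := Op.run s (.pred 5 5)) (pre := pre) (suf := suf) (e := e)
          (by
            intro pre e s s' e1 e2 e3 hJ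
            simpa only [e1, e2, e3] using hJ)
          (h1.agree (Code.agree_run (.op (.pred 5 5)) _) (by decide)) (by simp [h2])
          (by simp [Op.run, h3]) h5
        exact ⟨pre.length, by simp at h4; omega, g1, pre, e :: suf, by simp [h2], g2, rfl, g3⟩
    · rintro m s ⟨h1, pre, suf, h2, h3, h4, h5⟩ hb
      simp only [Test.Passes, h1.given.zero, h3] at hb
      have : pre = [] := List.eq_nil_of_length_eq_zero (by omega)
      subst this
      exact ⟨h1, h5⟩

end

end ShortestPathGame

/-! ### Computing the tables in three passes -/

namespace ShortestPathGame

/-! ### Further properties of layouts and minima -/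

namespace Layout

variable {n : ℕ} {I : Game n} (F : Layout I)

/-- Only the closing arc of a cycle fails to descend, and it leads to the top. -/
theorem top_of_up {u w : Fin n} (hu : I.Reach u) (ha : I.graph.Adj u w)
    (hr : ¬ F.rank w < F.rank u) : F.top u = some w ∧ F.suc u = w := by
  rcases F.arc hu ha with ⟨h1, h2⟩ | h | h
  · obtain ⟨v, hv⟩ := Option.ne_none_iff_exists'.1 h1
    rcases (F.suc_spec hv).2.2 with h3 | h3
    · rw [hv, ← h3, h2]
      exact ⟨rfl, rfl⟩
    · rw [← h2] at h3
      exact absurd h3.1 hr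
  · exact absurd h.1 hr
  · exact absurd h.1 hr

/-- A descending arc to a vertex below the top of a cycle, whose tail is not this top, runs along
the cycle. -/
theorem top_of_down {u w v : Fin n} (hu : I.Reach u) (ha : I.graph.Adj u w)
    (ht : F.top w = some v) (hv : v ≠ u) (hr : F.rank w < F.rank u) :
    F.top u = some v ∧ F.suc u = w := by
  rcases F.arc hu ha with ⟨h1, h2⟩ | h | h
  · obtain ⟨v', hv'⟩ := Option.ne_none_iff_exists'.1 h1
    rcases F.suc_spec hv' with ⟨h4, h5, h3 | h3⟩
    · rw [← h3, ← h2] at h4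
      omega
    · rw [← h2, ht] at h3
      rw [hv', ← h3.2, h2]
      exact ⟨rfl, rfl⟩
  · rw [ht] at h
    exact absurd (Option.some.inj h.2) hv
  · rw [ht] at h
    exact absurd h.2 (by simp)

/-- The successor of `u` is its top, of larger rank, or has the same top as `u`; `w` is neither. -/
theorem not_suc {u w : Fin n} (hr : F.rank w < F.rank u)
    (ht : F.top w = none ∨ F.top w = some u) : F.top u = none ∨ F.suc u ≠ w := by
  by_contra h
  push Not at h
  obtain ⟨v, hv⟩ := Option.ne_none_iff_exists'.1 h.1
  obtain ⟨h1, -, h2⟩ := F.suc_spec hv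
  rw [h.2] at h2
  rcases h2 with h2 | h2
  · rw [h2] at hr
    omega
  · rw [h2.2] at ht
    rcases ht with ht | ht
    · cases ht
    · rw [Option.some.inj ht] at h1
      omega

theorem side_iff {u w : Fin n} (ha : I.graph.Adj u w) :
    F.Side u w ↔ F.rank w < F.rank u ∧ F.top w = some u ∧ ¬ F.low w := by
  constructor
  · intro h
    exact ⟨(F.suc_spec h.2.1).1, h.2⟩
  · intro h
    exact ⟨ha, h.2⟩

theorem low_iff_route {u : Fin n} (hu : I.Reach u) :
    F.low u ↔ u = I.t ∨ ∃ w, F.Route u w := F.low_iff hu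

/-- The number for the top of the cycle, `0` if there is none. -/
def topCode (u : Fin n) : ℕ := (F.top u).elim 0 fun v => v + 1

theorem topCode_eq_zero {u : Fin n} : F.topCode u = 0 ↔ F.top u = none := by
  unfold topCode
  cases F.top u <;> simp

theorem topCode_eq_succ {u v : Fin n} : F.topCode u = v + 1 ↔ F.top u = some v := by
  unfold topCode
  cases F.top u <;> simp [Fin.ext_iff]

end Layout

theorem IsMin.congr {n : ℕ} {P P' : Fin n → Prop} {c c' : Fin n → Entry} {e : Entry}
    (h : IsMin P c e) (hP : ∀ w, P' w ↔ P w) (hc : ∀ w, P w → c' w = c w) : IsMin P' c' e := by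
  constructor
  · intro w hw
    rw [hc w ((hP w).1 hw)]
    exact h.1 w ((hP w).1 hw)
  · refine h.2.imp_right ?_
    rintro ⟨w, h1, h2⟩
    exact ⟨w, (hP w).2 h1, by rw [hc w h1, h2]⟩

theorem IsMin.insert {n : ℕ} {P P' : Fin n → Prop} {c : Fin n → Entry} {e : Entry} {x : Fin n}
    (h : IsMin P c e) (hP : ∀ w, P' w ↔ P w ∨ w = x) : IsMin P' c (min e (c x)) := by
  constructor
  · intro w hw
    rcases (hP w).1 hw with h' | rfl
    · exact (min_le_left _ _).trans (h.1 w h')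
    · exact min_le_right _ _
  · rcases min_choice e (c x) with h' | h'
    · rw [h']
      exact h.2.imp_right fun ⟨w, h1, h2⟩ => ⟨w, (hP w).2 (Or.inl h1), h2⟩
    · rw [h']
      exact Or.inr ⟨x, (hP x).2 (Or.inr rfl), rfl⟩

theorem IsMin.top {n : ℕ} {P : Fin n → Prop} {c : Fin n → Entry} (h : ∀ w, ¬ P w) :
    IsMin P c ⊤ := ⟨fun w hw => absurd hw (h w), Or.inl rfl⟩

namespace Schedule

variable {n : ℕ} {I : Game n} {rank : Fin n → ℕ} {ev : List (Event n)}

theorem of_fin_mem (h : Schedule I rank ev) {pre suf : List (Event n)} (he : ev = pre ++ suf)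
    {x : Fin n} (hx : (x, none) ∈ pre) :
    I.Reach x ∧ ∀ y, I.graph.Adj x y → (x, some y) ∈ pre := by
  obtain ⟨a, b, rfl⟩ := List.append_of_mem hx
  have := h.fin (pre := a) (u := x) (suf := b ++ suf) (by simp [he])
  exact ⟨this.1, fun y hy => by simp [this.2.2 y hy]⟩

theorem of_arc_mem (h : Schedule I rank ev) {pre suf : List (Event n)} (he : ev = pre ++ suf)
    {x y : Fin n} (hx : (x, some y) ∈ pre) :
    I.Reach x ∧ I.graph.Adj x y ∧ (rank y < rank x → (y, none) ∈ pre) := by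
  obtain ⟨a, b, rfl⟩ := List.append_of_mem hx
  have := h.arc (pre := a) (u := x) (w := y) (suf := b ++ suf) (by simp [he])
  exact ⟨this.1, this.2.1, fun hy => by simp [this.2.2.2.2.2 hy]⟩

theorem mem_arc (h : Schedule I rank ev) {u w : Fin n} (hu : I.Reach u) (ha : I.graph.Adj u w) :
    (u, some w) ∈ ev := (h.of_fin_mem (suf := []) (by simp) (h.mem_fin hu)).2 w ha

end Schedule

/-! ### The first pass -/

section

variable {n : ℕ} {I : Game n} (F : Layout I)

/-- The tables in the store. -/
noncomputable def Tables.ofStore (arr : ℕ → ℕ → ℕ) (numArr : ℕ → ℕ → ℝ) (etab : ℕ → ℕ → Entry) :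
    Tables I F where
  R b u := etab (if b then 2 else 1) u
  det u := etab 0 u
  S u := etab 3 u
  EC u := etab 4 u
  EU u := etab 5 u
  rtC u := etab 6 u
  rtU u := etab 7 u
  loop u := etab 8 u
  par u := arr 20 u ≠ 0
  pa u := numArr 2 u
  pb u := numArr 3 u

/-- The data of the layout which are known after the events `pre`. -/
structure LayoutStage (pre : List (Event n)) (arr : ℕ → ℕ → ℕ) (numArr : ℕ → ℕ → ℝ) : Prop where
  fin : ∀ u : Fin n, arr 16 u ≠ 0 ↔ (u, none) ∈ pre
  route : ∀ u : Fin n, arr 17 u ≠ 0 ↔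
    (u = I.t ∧ (u, none) ∈ pre) ∨ ∃ w, (u, some w) ∈ pre ∧ F.Route u w
  top : ∀ u : Fin n, F.top u ≠ none → (u, some (F.suc u)) ∈ pre →
    arr 18 u = F.topCode u ∧ arr 19 u = F.suc u ∧ numArr 1 u = I.cost u (F.suc u)
  top_none : ∀ u : Fin n, F.top u = none ∨ (u, some (F.suc u)) ∉ pre → arr 18 u = 0

/-- The data of the layout are complete for the vertex `u`. -/
structure Known (u : Fin n) (arr : ℕ → ℕ → ℕ) (numArr : ℕ → ℕ → ℝ) : Prop where
  low : arr 17 u ≠ 0 ↔ F.low u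
  top : arr 18 u = F.topCode u
  suc : F.top u ≠ none → arr 19 u = F.suc u ∧ numArr 1 u = I.cost u (F.suc u)

variable {F} {ev : List (Event n)}

/-- When `u` is finished, all its arcs have been scanned, so its cycle is known and it is decided
whether `u` is low. -/
theorem LayoutStage.known (hS : Schedule I F.rank ev) {pre suf : List (Event n)}
    {arr : ℕ → ℕ → ℕ} {numArr : ℕ → ℕ → ℝ} (h : LayoutStage F pre arr numArr)
    (he : ev = pre ++ suf) {u : Fin n} (hu : (u, none) ∈ pre) : Known F u arr numArr := by
  obtain ⟨hr, hall⟩ := hS.of_fin_mem he hu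
  refine ⟨?_, ?_, ?_⟩
  · rw [h.route, F.low_iff_route hr]
    constructor
    · rintro (h | ⟨w, h1, h2⟩)
      · exact Or.inl h.1
      · exact Or.inr ⟨w, h2⟩
    · rintro (h | ⟨w, h2⟩)
      · exact Or.inl ⟨h, hu⟩
      · exact Or.inr ⟨w, hall w h2.1, h2⟩
  · by_cases ht : F.top u = none
    · rw [h.top_none u (Or.inl ht), F.topCode_eq_zero.2 ht]
    · obtain ⟨v, hv⟩ := Option.ne_none_iff_exists'.1 ht
      exact (h.top u ht (hall _ (F.suc_spec hv).2.1)).1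
  · intro ht
    obtain ⟨v, hv⟩ := Option.ne_none_iff_exists'.1 ht
    exact (h.top u ht (hall _ (F.suc_spec hv).2.1)).2

variable (F)

/-- The equations which are valid after the events `pre` of the first pass. -/
structure FirstStage (pre : List (Event n)) (arr : ℕ → ℕ → ℕ) (numArr : ℕ → ℕ → ℝ)
    (etab : ℕ → ℕ → Entry) : Prop where
  layout : LayoutStage F pre arr numArr
  det : ∀ u : Fin n, IsMin (fun w => (u, some w) ∈ pre ∧ F.Side u w)
    (fun w => Entry.go (I.cost u w) w ((Tables.ofStore F arr numArr etab).R false w).pay) (etab 0 u)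
  R : ∀ (u : Fin n) (b : Bool), (u, none) ∈ pre → F.top u ≠ none →
    (Tables.ofStore F arr numArr etab).R b u = min (Entry.go (I.cost u (F.suc u)) (F.suc u)
        ((Tables.ofStore F arr numArr etab).next (!b) u).pay)
      (Entry.after true (etab 0 u) (Entry.go (I.cost u (F.suc u)) (F.suc u)
        ((Tables.ofStore F arr numArr etab).next b u).pay).pay)

/-- The vertex `w` follows `u` on its cycle. -/
def firstTop (a : ℕ) : Code :=
  Code.block [Op.store 18 6 a, Op.store 19 6 7, Op.numStore 1 6 0]

/-- A detour from `u` begins with the arc to `w`. -/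
def firstDetour : Code :=
  Code.block [Op.eLoad 0 0 6, Op.eLoad 1 1 7, Op.eGo 1 0 7, Op.eMin 0 1, Op.eStore 0 6 0]

/-- The first pass for an arc. -/
def firstArc : Code := Code.block [Op.load 8 16 7,
  Code.cond (.eq 8 9) (Code.block [Op.succ 8 7, firstTop 8])
    (Code.block [Op.load 8 17 7, Op.load 11 18 7, Op.succ 12 6,
      Code.cond (.eq 8 9) (Code.cond (.eq 11 12) firstDetour .skip)
        (Code.block [Op.const 13 1, Op.store 17 6 13]),
      Code.cond (.eq 11 9) .skip (Code.cond (.eq 11 12) .skip (firstTop 11))])]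

/-- The totals for returning to the top of the cycle. -/
def firstReturn : Code := Code.block [Op.load 7 19 6, Op.numLoad 0 1 6, Op.succ 12 7,
  Code.cond (.eq 12 11) (Code.block [Op.eZero 0, Op.eTop 1])
    (Code.block [Op.eLoad 0 1 7, Op.eLoad 1 2 7]),
  Op.eGo 0 0 7, Op.eGo 1 0 7, Op.eLoad 2 0 6, Op.eLoad 3 0 6, Op.eAfter 2 0, Op.eAfter 3 1,
  Op.eMin 1 2, Op.eMin 0 3, Op.eStore 1 6 1, Op.eStore 2 6 0]

/-- Mark a finished vertex. -/
def firstMark : Code := Code.block [Op.const 8 1, Op.store 16 6 8,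
  Code.cond (.eq 6 2) (Op.store 17 6 8) .skip]

/-- The first pass for a finished vertex. -/
def firstFin : Code := Code.seq firstMark (Code.block [Op.load 11 18 6,
  Code.cond (.eq 11 9) .skip firstReturn])

-- The machine does not store ranks; the events replace them. An unfinished head is the top of the
-- cycle of `u`. A finished head with a top other than `u` shares this top with `u` and is its
-- successor. A head with top `u` opens a detour, unless it is low.
open Classical in
theorem firstArc_run {L : List (Fin n × Fin n)} {s : Store} {u w : Fin n} (hg : Given I L s)
    (hu : I.Reach u) (ha : I.graph.Adj u w) (h6 : s.reg 6 = u) (h7 : s.reg 7 = w)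
    (h0 : s.num 0 = I.cost u w) (hfin : s.arr 16 w ≠ 0 ↔ F.rank w < F.rank u)
    (hk : F.rank w < F.rank u → Known F w s.arr s.numArr) :
    (firstArc.run s).arr 17 = (if F.Route u w then Function.update (s.arr 17) u 1 else s.arr 17) ∧
    (firstArc.run s).arr 18 = (if F.top u ≠ none ∧ F.suc u = w then
      Function.update (s.arr 18) u (F.topCode u) else s.arr 18) ∧
    (firstArc.run s).arr 19 = (if F.top u ≠ none ∧ F.suc u = w then
      Function.update (s.arr 19) u w else s.arr 19) ∧
    (firstArc.run s).numArr 1 = (if F.top u ≠ none ∧ F.suc u = w then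
      Function.update (s.numArr 1) u (I.cost u w) else s.numArr 1) ∧
    (firstArc.run s).etab 0 = (if F.Side u w then
      Function.update (s.etab 0) u (min (s.etab 0 u) (Entry.go (I.cost u w) w (s.etab 1 w).pay))
      else s.etab 0) := by
  have h9 := hg.zero
  have hRoute : F.Route u w ↔ F.rank w < F.rank u ∧ F.low w :=
    ⟨fun h => h.2, fun h => ⟨ha, h⟩⟩
  rw [F.side_iff ha, hRoute]
  by_cases hr : F.rank w < F.rank u
  · obtain ⟨k1, k2, k3⟩ := hk hr
    have hf : s.arr 16 w ≠ 0 := hfin.2 hr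
    by_cases hl : F.low w
    · have k1' := k1.2 hl
      cases ht : F.top w with
      | none =>
        have k2' := F.topCode_eq_zero.2 ht
        rw [← k2] at k2'
        have hn := F.not_suc hr (Or.inl ht)
        rw [if_neg (not_and_or.2 (hn.imp not_not.2 id)), if_neg (not_and_or.2 (hn.imp not_not.2 id)),
          if_neg (not_and_or.2 (hn.imp not_not.2 id))]
        simp [firstArc, firstTop, Code.block, Code.run, Op.run, Test.Passes, h9, h6, h7, hf, k1',
          k2', hr, hl]
      | some v =>
        have k2' := F.topCode_eq_succ.2 ht
        rw [← k2] at k2'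
        by_cases hv : v = u
        · subst hv
          have hn := F.not_suc hr (Or.inr ht)
          rw [if_neg (not_and_or.2 (hn.imp not_not.2 id)),
            if_neg (not_and_or.2 (hn.imp not_not.2 id)), if_neg (not_and_or.2 (hn.imp not_not.2 id))]
          simp [firstArc, firstTop, Code.block, Code.run, Op.run, Test.Passes, h9, h6, h7, hf, k1',
            k2', hr, hl]
        · have hv' : (v : ℕ) ≠ u := fun h => hv (Fin.ext h)
          have ht' := F.top_of_down hu ha ht hv hr
          have hc := F.topCode_eq_succ.2 ht'.1
          simp [firstArc, firstTop, Code.block, Code.run, Op.run, Test.Passes, h9, h6, h7, hf, k1',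
            k2', hr, hl, hv', ht', hc, h0]
    · have k1' : s.arr 17 w = 0 := by
        by_contra h
        exact hl (k1.1 h)
      cases ht : F.top w with
      | none =>
        have k2' := F.topCode_eq_zero.2 ht
        rw [← k2] at k2'
        have hn := F.not_suc hr (Or.inl ht)
        rw [if_neg (not_and_or.2 (hn.imp not_not.2 id)), if_neg (not_and_or.2 (hn.imp not_not.2 id)),
          if_neg (not_and_or.2 (hn.imp not_not.2 id))]
        simp [firstArc, firstTop, Code.block, Code.run, Op.run, Test.Passes, h9, h6, h7, hf, k1',
          k2', hr, hl]
      | some v =>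
        have k2' := F.topCode_eq_succ.2 ht
        rw [← k2] at k2'
        by_cases hv : v = u
        · subst hv
          have hn := F.not_suc hr (Or.inr ht)
          rw [if_neg (not_and_or.2 (hn.imp not_not.2 id)),
            if_neg (not_and_or.2 (hn.imp not_not.2 id)), if_neg (not_and_or.2 (hn.imp not_not.2 id))]
          simp [firstArc, firstTop, firstDetour, Code.block, Code.run, Op.run, Test.Passes, h9, h6,
            h7, hf, k1', k2', hr, hl, h0]
        · have hv' : (v : ℕ) ≠ u := fun h => hv (Fin.ext h)
          have ht' := F.top_of_down hu ha ht hv hr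
          have hc := F.topCode_eq_succ.2 ht'.1
          simp [firstArc, firstTop, Code.block, Code.run, Op.run, Test.Passes, h9, h6, h7, hf, k1',
            k2', hr, hl, hv, hv', ht', hc, h0]
  · have hf : s.arr 16 w = 0 := by
      by_contra h
      exact hr (hfin.1 h)
    have ht := F.top_of_up hu ha hr
    have hc := F.topCode_eq_succ.2 ht.1
    simp [firstArc, firstTop, Code.block, Code.run, Op.run, Test.Passes, h9, h6, h7, hf, hr, ht,
      hc, h0]

end

end ShortestPathGame

/-! ### Invariant of the first pass -/

namespace ShortestPathGame

section

variable {n : ℕ} {I : Game n} (F : Layout I)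

theorem firstMark_run {L : List (Fin n × Fin n)} {s : Store} {u : Fin n} (hg : Given I L s)
    (h6 : s.reg 6 = u) :
    (firstMark.run s).arr 16 = Function.update (s.arr 16) u 1 ∧
    (firstMark.run s).arr 17 = (if u = I.t then Function.update (s.arr 17) u 1 else s.arr 17) := by
  have h2 := hg.target
  by_cases h : u = I.t
  · subst h
    simp [firstMark, Code.block, Code.run, Op.run, Test.Passes, h2, h6]
  · have h' : (u : ℕ) ≠ I.t := fun h' => h (Fin.ext h')
    simp [firstMark, Code.block, Code.run, Op.run, Test.Passes, h2, h6, h, h']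

open Classical in
theorem firstFin_run {L : List (Fin n × Fin n)} {s : Store} {u : Fin n} (hg : Given I L s)
    (h6 : s.reg 6 = u) (hk : s.arr 18 u = F.topCode u)
    (hk' : F.top u ≠ none → s.arr 19 u = F.suc u ∧ s.numArr 1 u = I.cost u (F.suc u)) :
    (firstFin.run s).arr 16 = Function.update (s.arr 16) u 1 ∧
    (firstFin.run s).arr 17 = (if u = I.t then Function.update (s.arr 17) u 1 else s.arr 17) ∧
    (firstFin.run s).etab = (if F.top u ≠ none then
      Function.update (Function.update s.etab 1 (Function.update (s.etab 1) u
        (min (Entry.go (I.cost u (F.suc u)) (F.suc u)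
          ((Tables.ofStore F s.arr s.numArr s.etab).next true u).pay)
        (Entry.after true (s.etab 0 u) (Entry.go (I.cost u (F.suc u)) (F.suc u)
          ((Tables.ofStore F s.arr s.numArr s.etab).next false u).pay).pay)))) 2
        (Function.update (s.etab 2) u
        (min (Entry.go (I.cost u (F.suc u)) (F.suc u)
          ((Tables.ofStore F s.arr s.numArr s.etab).next false u).pay)
        (Entry.after true (s.etab 0 u) (Entry.go (I.cost u (F.suc u)) (F.suc u)
          ((Tables.ofStore F s.arr s.numArr s.etab).next true u).pay).pay))) else s.etab) := by
  have ha := firstMark.agree_run s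
  obtain ⟨m1, m2⟩ := firstMark_run hg h6
  obtain ⟨m, hm⟩ : ∃ m, m = firstMark.run s := ⟨_, rfl⟩
  rw [← hm] at ha m1 m2
  have h9 : m.reg 9 = 0 := (ha.1 9 (by decide)).trans hg.zero
  have h6 : m.reg 6 = u := (ha.1 6 (by decide)).trans h6
  rw [← ha.2.1 18 (by decide)] at hk
  rw [← ha.2.1 19 (by decide), ← ha.2.2.2.1 1 (by decide)] at hk'
  have he : m.etab = s.etab := funext fun i => ha.2.2.2.2.2 i (by simp [firstMark, Code.block, Code.targets, Op.target])
  have hrun : firstFin.run s = (Code.block [Op.load 11 18 6,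
    Code.cond (.eq 11 9) .skip firstReturn]).run m := by rw [hm]; rfl
  have hb := (Code.block [Op.load 11 18 6, Code.cond (.eq 11 9) .skip firstReturn]).agree_run m
  rw [hrun]
  refine ⟨by rw [hb.2.1 16 (by decide), m1], by rw [hb.2.1 17 (by decide), m2], ?_⟩
  rw [← he]
  by_cases ht : F.top u = none
  · have hc := F.topCode_eq_zero.2 ht
    simp [Code.block, Code.run, Op.run, Test.Passes, h9, h6, hk, hc, ht]
  · obtain ⟨k1, k2⟩ := hk' ht
    have hc : F.topCode u ≠ 0 := fun h => ht (F.topCode_eq_zero.1 h)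
    have hc' : (F.suc u : ℕ) + 1 = F.topCode u ↔ F.top u = some (F.suc u) := by
      rw [eq_comm, F.topCode_eq_succ]
    by_cases hs : F.top u = some (F.suc u)
    · have hc'' := hc'.2 hs
      simp [firstReturn, Code.block, Code.run, Op.run, Test.Passes, h9, h6, hk, k1, k2, ← hc'',
        Tables.next, hs]
    · have hc'' : (F.suc u : ℕ) + 1 ≠ F.topCode u := fun h => hs (hc'.1 h)
      simp [firstReturn, Code.block, Code.run, Op.run, Test.Passes, h9, h6, hk, k1, k2, hc'', hc,
        Tables.next, hs, ht, Tables.ofStore]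

variable {F} {ev : List (Event n)} {L : List (Fin n × Fin n)}

theorem LayoutStage.succ_mem (hS : Schedule I F.rank ev) {pre suf : List (Event n)}
    (he : ev = pre ++ suf) {u : Fin n} (hu : (u, none) ∈ pre) (ht : F.top u ≠ none)
    (hs : F.top u ≠ some (F.suc u)) : (F.suc u, none) ∈ pre := by
  obtain ⟨hr, hall⟩ := hS.of_fin_mem he hu
  obtain ⟨v, hv⟩ := Option.ne_none_iff_exists'.1 ht
  obtain ⟨-, h1, h2 | h2⟩ := F.suc_spec hv
  · rw [hv, h2] at hs
    exact absurd rfl hs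
  · exact (hS.of_arc_mem he (hall _ h1)).2.2 h2.1

theorem FirstStage.init {s : Store} (h : Fresh 16 s) : FirstStage F [] s.arr s.numArr s.etab := by
  refine ⟨⟨?_, ?_, ?_, ?_⟩, ?_, ?_⟩
  · simp [h.arr 16 (by omega) (by omega)]
  · simp [h.arr 17 (by omega) (by omega)]
  · simp
  · simp [h.arr 18 (by omega) (by omega)]
  · intro u
    rw [h.etab 0]
    exact IsMin.top (by simp)
  · simp

theorem FirstStage.arc (hS : Schedule I F.rank ev) {pre suf : List (Event n)} {u w : Fin n}
    {s : Store} (he : ev = pre ++ (u, some w) :: suf) (hs : Scheduled I L ev s)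
    (h : FirstStage F pre s.arr s.numArr s.etab) (h6 : s.reg 6 = u) (h7 : s.reg 7 = w)
    (h0 : s.num 0 = I.cost u w) :
    FirstStage F (pre ++ [(u, some w)]) (firstArc.run s).arr (firstArc.run s).numArr
      (firstArc.run s).etab := by
  obtain ⟨hu, ha, hn, hn', hr⟩ := hS.arc he
  have hag := firstArc.agree_run s
  have hpre : ∀ x, (x, none) ∈ pre ++ [(u, some w)] ↔ (x, none) ∈ pre := fun x => by simp
  obtain ⟨f17, f18, f19, fc, fdet⟩ := firstArc_run F hs.given hu ha h6 h7 h0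
    ((h.layout.fin w).trans hr) fun hlt => h.layout.known hS he (hr.2 hlt)
  have f16 : (firstArc.run s).arr 16 = s.arr 16 := hag.2.1 16 (by decide)
  have f1 : (firstArc.run s).etab 1 = s.etab 1 := hag.2.2.2.2.2 1 (by decide)
  have f2 : (firstArc.run s).etab 2 = s.etab 2 := hag.2.2.2.2.2 2 (by decide)
  have hval : ∀ {x : Fin n}, x ≠ u → (x : ℕ) ≠ u := fun h h' => h (Fin.ext h')
  have hmem : ∀ x y : Fin n, (x, some y) ∈ pre ++ [(u, some w)] ↔
      (x, some y) ∈ pre ∨ (x = u ∧ y = w) := by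
    intro x y
    simp
  refine ⟨⟨?_, ?_, ?_, ?_⟩, ?_, ?_⟩
  · intro x
    rw [f16, hpre]
    exact h.layout.fin x
  · intro x
    rw [f17, hpre]
    have := h.layout.route x
    simp only [hmem]
    by_cases hR : F.Route u w
    · rw [if_pos hR]
      by_cases hx : x = u
      · subst hx
        simp only [Function.update_self, ne_eq, one_ne_zero, not_false_eq_true, true_iff]
        exact Or.inr ⟨w, Or.inr ⟨trivial, rfl⟩, hR⟩
      · rw [Function.update_of_ne (hval hx), this]
        simp [hx]
    · rw [if_neg hR, this]
      constructor
      · rintro (h | ⟨y, h1, h2⟩)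
        · exact Or.inl h
        · exact Or.inr ⟨y, Or.inl h1, h2⟩
      · rintro (h | ⟨y, h1 | ⟨rfl, rfl⟩, h2⟩)
        · exact Or.inl h
        · exact Or.inr ⟨y, h1, h2⟩
        · exact absurd h2 hR
  · intro x ht hm
    rw [hmem] at hm
    rw [f18, f19, fc]
    by_cases hx : x = u
    · subst hx
      by_cases hw : F.suc x = w
      · simp [ht, hw]
      · rw [if_neg (fun h => hw h.2), if_neg (fun h => hw h.2), if_neg (fun h => hw h.2)]
        exact h.layout.top x ht (hm.resolve_right fun h => hw h.2)
    · have := h.layout.top x ht (hm.resolve_right fun h => hx h.1)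
      split_ifs
      · rw [Function.update_of_ne (hval hx), Function.update_of_ne (hval hx),
          Function.update_of_ne (hval hx)]
        exact this
      · exact this
  · intro x hm
    rw [hmem] at hm
    rw [f18]
    by_cases hx : x = u
    · subst hx
      rw [if_neg]
      · exact h.layout.top_none x (hm.imp_right fun h h' => h (Or.inl h'))
      · rintro ⟨h1, h2⟩
        exact (hm.resolve_left h1) (Or.inr ⟨rfl, h2⟩)
    · have := h.layout.top_none x (hm.imp_right fun h h' => h (Or.inl h'))
      split_ifs
      · rw [Function.update_of_ne (hval hx)]
        exact this
      · exact this
  · intro x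
    have := h.det x
    simp only [Tables.ofStore, Bool.false_eq_true, if_false, f1, fdet, hmem] at this ⊢
    by_cases hR : F.Side u w
    · rw [if_pos hR]
      by_cases hx : x = u
      · subst hx
        rw [Function.update_self]
        refine this.insert (x := w) fun y => ?_
        constructor
        · rintro ⟨h1 | h1, h2⟩
          · exact Or.inl ⟨h1, h2⟩
          · exact Or.inr h1.2
        · rintro (h1 | rfl)
          · exact ⟨Or.inl h1.1, h1.2⟩
          · exact ⟨Or.inr ⟨rfl, rfl⟩, hR⟩
      · rw [Function.update_of_ne (hval hx)]
        exact this.congr (by simp [hx]) (fun _ _ => rfl)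
    · rw [if_neg hR]
      refine this.congr (fun y => ?_) (fun _ _ => rfl)
      constructor
      · rintro ⟨h1 | ⟨rfl, rfl⟩, h2⟩
        · exact ⟨h1, h2⟩
        · exact absurd h2 hR
      · exact fun h => ⟨Or.inl h.1, h.2⟩
  · intro x b hx ht
    rw [hpre] at hx
    have hxu : x ≠ u := by
      rintro rfl
      exact hn hx
    have e0 : (firstArc.run s).etab 0 x = s.etab 0 x := by
      rw [fdet]
      split_ifs
      · rw [Function.update_of_ne (hval hxu)]
      · rfl
    have := h.R x b hx ht
    simp only [Tables.next, Tables.ofStore, e0] at this ⊢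
    cases b
    · simpa [f1, f2] using this
    · simpa [f1, f2] using this

theorem FirstStage.fin (hS : Schedule I F.rank ev) {pre suf : List (Event n)} {u : Fin n}
    {s : Store} (he : ev = pre ++ (u, none) :: suf) (hs : Scheduled I L ev s)
    (h : FirstStage F pre s.arr s.numArr s.etab) (h6 : s.reg 6 = u) :
    FirstStage F (pre ++ [(u, none)]) (firstFin.run s).arr (firstFin.run s).numArr
      (firstFin.run s).etab := by
  obtain ⟨hu, hn, hall⟩ := hS.fin he
  have hag := firstFin.agree_run s
  have hmem : ∀ x y : Fin n, (x, some y) ∈ pre ++ [(u, none)] ↔ (x, some y) ∈ pre :=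
    fun x y => by simp
  have hpre : ∀ x : Fin n, (x, none) ∈ pre ++ [(u, none)] ↔ (x, none) ∈ pre ∨ x = u :=
    fun x => by simp
  have hval : ∀ {x : Fin n}, x ≠ u → (x : ℕ) ≠ u := fun h h' => h (Fin.ext h')
  have hkn : s.arr 18 u = F.topCode u ∧ (F.top u ≠ none →
      s.arr 19 u = F.suc u ∧ s.numArr 1 u = I.cost u (F.suc u)) := by
    by_cases ht : F.top u = none
    · exact ⟨by rw [h.layout.top_none u (Or.inl ht), F.topCode_eq_zero.2 ht], fun h => absurd ht h⟩
    · obtain ⟨v, hv⟩ := Option.ne_none_iff_exists'.1 ht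
      have := h.layout.top u ht (hall _ (F.suc_spec hv).2.1)
      exact ⟨this.1, fun _ => this.2⟩
  obtain ⟨f16, f17, fE⟩ := firstFin_run F hs.given h6 hkn.1 hkn.2
  have f18 : (firstFin.run s).arr 18 = s.arr 18 := hag.2.1 18 (by decide)
  have f19 : (firstFin.run s).arr 19 = s.arr 19 := hag.2.1 19 (by decide)
  have fc : (firstFin.run s).numArr 1 = s.numArr 1 := hag.2.2.2.1 1 (by decide)
  have f0 : (firstFin.run s).etab 0 = s.etab 0 := hag.2.2.2.2.2 0 (by decide)
  have hold : ∀ (i : ℕ) (x : Fin n), x ≠ u → (firstFin.run s).etab i x = s.etab i x := by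
    intro i x hx
    rw [fE]
    split_ifs
    · simp only [Function.update_apply]
      split_ifs with h1 h2 <;> simp_all
    · rfl
  refine ⟨⟨?_, ?_, ?_, ?_⟩, ?_, ?_⟩
  · intro x
    rw [f16, hpre]
    by_cases hx : x = u
    · simp [hx]
    · rw [Function.update_of_ne (hval hx), h.layout.fin x]
      simp [hx]
  · intro x
    rw [f17]
    have := h.layout.route x
    simp only [hmem, hpre]
    by_cases hx : x = u
    · subst hx
      by_cases hxt : x = I.t
      · rw [if_pos hxt]
        simp [hxt]
      · rw [if_neg hxt, this]
        simp [hxt]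
    · have h' : (if u = I.t then Function.update (s.arr 17) u 1 else s.arr 17) x = s.arr 17 x := by
        split_ifs
        · rw [Function.update_of_ne (hval hx)]
        · rfl
      rw [h', this]
      simp [hx]
  · intro x ht hm
    rw [hmem] at hm
    rw [f18, f19, fc]
    exact h.layout.top x ht hm
  · intro x hm
    rw [hmem] at hm
    rw [f18]
    exact h.layout.top_none x hm
  · intro x
    have := h.det x
    simp only [Tables.ofStore, Bool.false_eq_true, if_false, f0, hmem] at this ⊢
    refine this.congr (fun _ => Iff.rfl) fun y hy => ?_
    -- The entry of `y` was read when `y` had been finished already, hence `y ≠ u` and it is not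
    -- overwritten.
    rw [hold 1 y]
    rintro rfl
    exact hn ((hS.of_arc_mem he hy.1).2.2 (F.suc_spec hy.2.2.1).1)
  · intro x b hx ht
    rw [hpre] at hx
    have hnext : ∀ b, (Tables.ofStore F (firstFin.run s).arr (firstFin.run s).numArr
        (firstFin.run s).etab).next b x =
        (Tables.ofStore F s.arr s.numArr s.etab).next b x := by
      intro b
      simp only [Tables.next, Tables.ofStore]
      split_ifs with h1
      · rfl
      · rfl
      all_goals
        refine hold _ _ ?_
        rintro h2
        obtain ⟨v, hv⟩ := Option.ne_none_iff_exists'.1 ht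
        obtain ⟨h3, h4, h5 | h5⟩ := F.suc_spec hv
        · exact h1 (by rw [hv, h5])
        · rcases hx with hx | hx
          · have := LayoutStage.succ_mem hS he hx ht h1
            rw [h2] at this
            exact hn this
          · rw [h2, hx] at h5
            omega
    rw [hnext, hnext, f0]
    by_cases hxu : x = u
    · subst hxu
      simp only [Tables.ofStore, fE, if_pos ht]
      cases b
      · simp
      · simp
    · rw [← h.R x b (hx.resolve_right hxu) ht]
      exact hold _ x hxu

theorem FirstStage.agree {pre : List (Event n)} {s s' : Store} {l : List (ℕ × ℕ)}
    (h : FirstStage F pre s.arr s.numArr s.etab) (ha : Code.Agree l s s')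
    (hl : ∀ x ∈ [(1, 16), (1, 17), (1, 18), (1, 19), (3, 1), (5, 0), (5, 1), (5, 2)], x ∉ l) :
    FirstStage F pre s'.arr s'.numArr s'.etab := by
  simp only [List.mem_cons, List.not_mem_nil, or_false, forall_eq_or_imp, forall_eq] at hl
  obtain ⟨l1, l2, l3, l4, l5, l6, l7, l8⟩ := hl
  have e1 := ha.2.1 _ l1
  have e2 := ha.2.1 _ l2
  have e3 := ha.2.1 _ l3
  have e4 := ha.2.1 _ l4
  have e5 := ha.2.2.2.1 _ l5
  have e6 := ha.2.2.2.2.2 _ l6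
  have e7 := ha.2.2.2.2.2 _ l7
  have e8 := ha.2.2.2.2.2 _ l8
  have hR : ∀ b x, (Tables.ofStore F s'.arr s'.numArr s'.etab).R b x =
      (Tables.ofStore F s.arr s.numArr s.etab).R b x := by
    intro b x
    cases b
    · simp [Tables.ofStore, e7]
    · simp [Tables.ofStore, e8]
  have hnext : ∀ b x, (Tables.ofStore F s'.arr s'.numArr s'.etab).next b x =
      (Tables.ofStore F s.arr s.numArr s.etab).next b x := by
    intro b x
    simp only [Tables.next, hR]
  refine ⟨⟨?_, ?_, ?_, ?_⟩, ?_, ?_⟩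
  · rw [e1]
    exact h.layout.fin
  · rw [e2]
    exact h.layout.route
  · rw [e3, e4, e5]
    exact h.layout.top
  · rw [e3]
    exact h.layout.top_none
  · simp only [hR, e6]
    exact h.det
  · simp only [hR, hnext, e6]
    exact h.R

/-- The arrays which are not used before the third pass. -/
structure Rest (arr : ℕ → ℕ → ℕ) (etab : ℕ → ℕ → Entry) : Prop where
  mode : arr 21 = fun _ => 0
  etab : ∀ i ∈ [3, 6, 7], etab i = fun _ => ⊤

theorem Rest.agree {s s' : Store} {l : List (ℕ × ℕ)} (h : Rest s.arr s.etab)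
    (ha : Code.Agree l s s') (hl : ∀ x ∈ [(1, 21), (5, 3), (5, 6), (5, 7)], x ∉ l) :
    Rest s'.arr s'.etab := by
  refine ⟨?_, ?_⟩
  · rw [ha.2.1 _ (hl _ (by simp)), h.mode]
  · intro i hi
    rw [ha.2.2.2.2.2, h.etab i hi]
    simp only [List.mem_cons, List.not_mem_nil, or_false] at hi
    rcases hi with rfl | rfl | rfl <;> exact hl _ (by simp)

theorem firstHandles (hS : Schedule I F.rank ev) : Handles I L ev firstFin firstArc
    (fun pre _ s => FirstStage F pre s.arr s.numArr s.etab ∧ Rest s.arr s.etab)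
    (fun pre e s => FirstStage F (pre ++ [e]) s.arr s.numArr s.etab ∧ Rest s.arr s.etab) where
  keeps := by decide
  okP := by decide
  okQ := by decide
  fin _ _ _ s he hs h h6 :=
    ⟨h.1.fin hS he hs h6, h.2.agree (firstFin.agree_run s) (by decide)⟩
  arc _ _ _ _ s he hs h h6 h7 h0 :=
    ⟨h.1.arc hS he hs h6 h7 h0, h.2.agree (firstArc.agree_run s) (by decide)⟩

end

end ShortestPathGame

namespace ShortestPathGame

/-! ### The second pass -/

section

variable {n : ℕ} {I : Game n} (F : Layout I)

/-- The equations for the walks from the tops of the cycles, for the arcs after `pre`. -/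
def SecondStage (ev pre : List (Event n)) (arr : ℕ → ℕ → ℕ) (numArr : ℕ → ℕ → ℝ) : Prop :=
  ∀ u w v : Fin n, (u, some w) ∈ ev → (u, some w) ∉ pre → F.rank w < F.rank u → F.top w = some v →
    (v = u → arr 20 w ≠ 0 ∧ numArr 2 w = I.cost u w ∧ numArr 3 w = 0) ∧
    (F.top u = some v → (arr 20 w ≠ 0 ↔ arr 20 u = 0) ∧
      numArr 2 w = (if arr 20 u = 0 then numArr 2 u + I.cost u w else numArr 2 u) ∧
      numArr 3 w = (if arr 20 u = 0 then numArr 3 u else numArr 3 u + I.cost u w))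

/-- The first arc of a cycle. -/
def secondStart : Code := Code.block [Op.const 13 1, Op.store 20 7 13, Op.numStore 2 7 0,
  Op.numZero 1, Op.numStore 3 7 1]

/-- A further arc of a cycle. -/
def secondNext : Code := Code.block [Op.load 13 20 6, Op.numLoad 1 2 6, Op.numLoad 2 3 6,
  Code.cond (.eq 13 9) (Code.block [Op.const 13 1, Op.store 20 7 13, Op.numAdd 1 1 0])
    (Code.block [Op.store 20 7 9, Op.numAdd 2 2 0]),
  Op.numStore 2 7 1, Op.numStore 3 7 2]

/-- The second pass for an arc. -/
def secondArc : Code := Code.block [Op.load 8 18 7, Code.cond (.eq 8 9) .skip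
  (Code.block [Op.load 11 18 6, Op.succ 12 6, Code.cond (.eq 8 12) secondStart
    (Code.cond (.eq 8 11) secondNext .skip)])]

variable {F} {ev : List (Event n)} {L : List (Fin n × Fin n)}

theorem FirstStage.known (hS : Schedule I F.rank ev) {arr : ℕ → ℕ → ℕ} {numArr : ℕ → ℕ → ℝ}
    {etab : ℕ → ℕ → Entry} (h : FirstStage F ev arr numArr etab) {u : Fin n} (hu : I.Reach u) :
    Known F u arr numArr := h.layout.known (suf := []) hS (by simp) (hS.mem_fin hu)

theorem secondArc_run {s : Store} {u w : Fin n} (hg : Given I L s) (hu : I.Reach u)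
    (ha : I.graph.Adj u w) (h6 : s.reg 6 = u) (h7 : s.reg 7 = w) (h0 : s.num 0 = I.cost u w)
    (hku : Known F u s.arr s.numArr) (hkw : Known F w s.arr s.numArr) :
    (∀ v, F.rank w < F.rank u → F.top w = some v → v = u →
      (secondArc.run s).arr 20 = Function.update (s.arr 20) w 1 ∧
      (secondArc.run s).numArr 2 = Function.update (s.numArr 2) w (I.cost u w) ∧
      (secondArc.run s).numArr 3 = Function.update (s.numArr 3) w 0) ∧
    (∀ v, F.rank w < F.rank u → F.top w = some v → v ≠ u →
      (secondArc.run s).arr 20 = Function.update (s.arr 20) w (if s.arr 20 u = 0 then 1 else 0) ∧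
      (secondArc.run s).numArr 2 = Function.update (s.numArr 2) w
        (if s.arr 20 u = 0 then s.numArr 2 u + I.cost u w else s.numArr 2 u) ∧
      (secondArc.run s).numArr 3 = Function.update (s.numArr 3) w
        (if s.arr 20 u = 0 then s.numArr 3 u else s.numArr 3 u + I.cost u w)) ∧
    (¬ F.rank w < F.rank u ∨ F.top w = none →
      (secondArc.run s).arr 20 = s.arr 20 ∧ (secondArc.run s).numArr 2 = s.numArr 2 ∧
      (secondArc.run s).numArr 3 = s.numArr 3) := by
  have h9 := hg.zero
  have ku := hku.top
  have kw := hkw.top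
  refine ⟨?_, ?_, ?_⟩
  · rintro v hr ht rfl
    have hc := F.topCode_eq_succ.2 ht
    rw [← kw] at hc
    simp [secondArc, secondStart, Code.block, Code.run, Op.run, Test.Passes, h9, h6, h7, h0, hc]
  · intro v hr ht hv
    have hc := F.topCode_eq_succ.2 ht
    rw [← kw] at hc
    have hv' : (v : ℕ) ≠ u := fun h => hv (Fin.ext h)
    have hc' := F.topCode_eq_succ.2 (F.top_of_down hu ha ht hv hr).1
    rw [← ku] at hc'
    by_cases hp : s.arr 20 u = 0
    · simp [secondArc, secondNext, Code.block, Code.run, Op.run, Test.Passes, h9, h6, h7, h0, hc,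
        hc', hv', hp]
    · simp [secondArc, secondNext, Code.block, Code.run, Op.run, Test.Passes, h9, h6, h7, h0, hc,
        hc', hv', hp]
  · intro h
    cases ht : F.top w with
    | none =>
      have hc := F.topCode_eq_zero.2 ht
      rw [← kw] at hc
      simp [secondArc, Code.block, Code.run, Op.run, Test.Passes, h9, h7, hc]
    | some v =>
      have hr := h.resolve_right (by simp [ht])
      have hc := F.topCode_eq_succ.2 ht
      rw [← kw] at hc
      have hc' := F.topCode_eq_succ.2 (F.top_of_up hu ha hr).1
      rw [← ku] at hc'
      have h1 := (F.suc_spec ht).1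
      have hv' : (v : ℕ) ≠ u := by
        intro h
        have : v = u := Fin.ext h
        rw [this] at h1
        omega
      have hvw : (v : ℕ) ≠ w := by
        intro h
        have : v = w := Fin.ext h
        rw [this] at h1
        omega
      simp [secondArc, Code.block, Code.run, Op.run, Test.Passes, h9, h6, h7, hc, hc', hv', hvw]

/-- In reverse order the descending arc into `w` comes before all arcs from `w`, so the values of
`w` are set before they are read. By `arc_in` only one descending arc leads to a vertex below the
top of a cycle, so no value is set twice. -/
theorem SecondStage.arc (hS : Schedule I F.rank ev) {pre suf : List (Event n)} {u w : Fin n}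
    {s : Store} (he : ev = pre ++ (u, some w) :: suf) (hs : Scheduled I L ev s)
    (hf : FirstStage F ev s.arr s.numArr s.etab)
    (h : SecondStage F ev (pre ++ [(u, some w)]) s.arr s.numArr) (h6 : s.reg 6 = u)
    (h7 : s.reg 7 = w) (h0 : s.num 0 = I.cost u w) :
    SecondStage F ev pre (secondArc.run s).arr (secondArc.run s).numArr := by
  obtain ⟨hu, ha, hn, hn', hr⟩ := hS.arc he
  obtain ⟨r1, r2, r3⟩ := secondArc_run hs.given hu ha h6 h7 h0 (hf.known hS hu)
    (hf.known hS (hu.tail ha))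
  have hval : ∀ {x y : Fin n}, x ≠ y → (x : ℕ) ≠ y := fun h h' => h (Fin.ext h')
  intro u' w' v hm hm' hr' ht
  obtain ⟨hu', ha', -⟩ := hS.of_arc_mem (suf := []) (by simp) hm
  by_cases hself : u' = u ∧ w' = w
  · obtain ⟨rfl, rfl⟩ := hself
    have hne : u' ≠ w' := by rintro rfl; omega
    by_cases hv : v = u'
    · obtain ⟨f1, f2, f3⟩ := r1 v hr' ht hv
      refine ⟨fun _ => by simp [f1, f2, f3], fun h' => ?_⟩
      rw [hv] at h'
      have := (F.suc_spec h').1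
      omega
    · obtain ⟨f1, f2, f3⟩ := r2 v hr' ht hv
      refine ⟨fun h => absurd h hv, fun _ => ?_⟩
      rw [f1, f2, f3]
      simp only [Function.update_self, Function.update_of_ne (hval hne)]
      by_cases hp : s.arr 20 u' = 0 <;> simp [hp]
  · have hmem : (u', some w') ∉ pre ++ [(u, some w)] := by
      simp only [List.mem_append, List.mem_singleton, Prod.mk.injEq, Option.some.injEq]
      rintro (h | h)
      · exact hm' h
      · exact hself h
    have key := h u' w' v hm hmem hr' ht
    cases htw : F.top w with
    | none =>
      obtain ⟨f1, f2, f3⟩ := r3 (Or.inr htw)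
      rw [f1, f2, f3]
      exact key
    | some v₀ =>
      by_cases hru : F.rank w < F.rank u
      · have hw : w' ≠ w := by
          rintro rfl
          exact hself ⟨F.arc_in (by simp [htw]) hu' hu ha' ha hr' hru, rfl⟩
        have huw : u' ≠ w := by
          rintro rfl
          exact hm' ((hS.of_fin_mem he (hr.2 hru)).2 w' ha')
        have hfr : (secondArc.run s).arr 20 w' = s.arr 20 w' ∧
            (secondArc.run s).numArr 2 w' = s.numArr 2 w' ∧
            (secondArc.run s).numArr 3 w' = s.numArr 3 w' ∧
            (secondArc.run s).arr 20 u' = s.arr 20 u' ∧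
            (secondArc.run s).numArr 2 u' = s.numArr 2 u' ∧
            (secondArc.run s).numArr 3 u' = s.numArr 3 u' := by
          by_cases hv : v₀ = u
          · obtain ⟨f1, f2, f3⟩ := r1 v₀ hru htw hv
            rw [f1, f2, f3]
            simp [Function.update_of_ne (hval hw), Function.update_of_ne (hval huw)]
          · obtain ⟨f1, f2, f3⟩ := r2 v₀ hru htw hv
            rw [f1, f2, f3]
            simp [Function.update_of_ne (hval hw), Function.update_of_ne (hval huw)]
        obtain ⟨e1, e2, e3, e4, e5, e6⟩ := hfr
        rw [e1, e2, e3, e4, e5, e6]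
        exact key
      · obtain ⟨f1, f2, f3⟩ := r3 (Or.inl hru)
        rw [f1, f2, f3]
        exact key

theorem SecondStage.fin {pre : List (Event n)} {u : Fin n} {arr : ℕ → ℕ → ℕ}
    {numArr : ℕ → ℕ → ℝ} (h : SecondStage F ev (pre ++ [(u, none)]) arr numArr) :
    SecondStage F ev pre arr numArr := by
  intro u' w' v hm hm'
  exact h u' w' v hm (by simpa using hm')

theorem SecondStage.init {arr : ℕ → ℕ → ℕ} {numArr : ℕ → ℕ → ℝ} :
    SecondStage F ev ev arr numArr := fun _ _ _ hm hm' => absurd hm hm'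

theorem SecondStage.agree {pre : List (Event n)} {s s' : Store} {l : List (ℕ × ℕ)}
    (h : SecondStage F ev pre s.arr s.numArr) (ha : Code.Agree l s s')
    (hl : ∀ x ∈ [(1, 20), (3, 2), (3, 3)], x ∉ l) :
    SecondStage F ev pre s'.arr s'.numArr := by
  simp only [List.mem_cons, List.not_mem_nil, or_false, forall_eq_or_imp, forall_eq] at hl
  obtain ⟨l1, l2, l3⟩ := hl
  unfold SecondStage
  rw [ha.2.1 _ l1, ha.2.2.2.1 _ l2, ha.2.2.2.1 _ l3]
  exact h

theorem secondHandles (hS : Schedule I F.rank ev) : Handles I L ev .skip secondArc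
    (fun pre e s => FirstStage F ev s.arr s.numArr s.etab ∧ Rest s.arr s.etab ∧
      SecondStage F ev (pre ++ [e]) s.arr s.numArr)
    (fun pre _ s => FirstStage F ev s.arr s.numArr s.etab ∧ Rest s.arr s.etab ∧
      SecondStage F ev pre s.arr s.numArr) where
  keeps := by decide
  okP := by decide
  okQ := by decide
  fin _ _ _ s he hs h h6 := ⟨h.1, h.2.1, h.2.2.fin⟩
  arc _ _ _ _ s he hs h h6 h7 h0 :=
    ⟨h.1.agree (secondArc.agree_run s) (by decide), h.2.1.agree (secondArc.agree_run s) (by decide),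
      h.2.2.arc hS he hs h.1 h6 h7 h0⟩

end

end ShortestPathGame

namespace ShortestPathGame

/-! ### The third pass -/

section

variable {n : ℕ} {I : Game n} (F : Layout I)

/-- Only a closing arc ascends, so comparing `w` with the top of `u` replaces the comparison of
ranks. -/
theorem Layout.route_iff {u w : Fin n} (hu : I.Reach u) (ha : I.graph.Adj u w) :
    F.Route u w ↔ F.low w ∧ F.top u ≠ some w := by
  constructor
  · rintro ⟨-, h1, h2⟩
    refine ⟨h2, fun h => ?_⟩
    have := (F.suc_spec h).1
    omega
  · rintro ⟨h1, h2⟩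
    refine ⟨ha, ?_, h1⟩
    by_contra hr
    exact h2 (F.top_of_up hu ha hr).1

open Classical in
/-- The totals for going round the cycle. -/
noncomputable def Tables.loopValue {F : Layout I} (T : Tables I F) (u : Fin n) : Entry :=
  if F.top u = none ∨ F.Route u (F.suc u) then ⊤ else
    Entry.go (I.cost u (F.suc u)) (F.suc u)
      (Entry.after (T.par u) (T.next (T.par u) u) (some (T.pa u, T.pb u))).pay

open Classical in
/-- The equations which are valid after the events `pre` of the third pass. -/
structure ThirdStage (pre : List (Event n)) (arr : ℕ → ℕ → ℕ) (numArr : ℕ → ℕ → ℝ)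
    (etab : ℕ → ℕ → Entry) : Prop where
  S : ∀ u : Fin n, IsMin (fun w => (u, some w) ∈ pre ∧ F.Route u w)
    (fun w => Entry.go (I.cost u w) w (etab 5 w).pay) (etab 3 u)
  rtC : ∀ u : Fin n, IsMin (fun w => (u, some w) ∈ pre ∧ F.Route u w)
    (fun w => Entry.go (I.cost u w) w (etab 4 w).pay) (etab 6 u)
  rtU : ∀ u : Fin n, IsMin (fun w => (u, some w) ∈ pre ∧ F.Route u w)
    (fun w => Entry.go (I.cost u w) w (if F.top w = some u then etab 4 w else etab 5 w).pay)
    (etab 7 u)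
  loop : ∀ u : Fin n, (u, none) ∈ pre →
    etab 8 u = (Tables.ofStore F arr numArr etab).loopValue u
  EC : ∀ u : Fin n, (u, none) ∈ pre → etab 4 u =
    min (min (etab 6 u) (Entry.after true (etab 0 u) (etab 3 u).pay))
    (min (Entry.after true (etab 8 u) (etab 3 u).pay) (if u = I.t then Entry.mk 0 0 0 else ⊤))
  EU : ∀ u : Fin n, (u, none) ∈ pre → etab 5 u =
    min (min (etab 7 u) (Entry.after true (etab 0 u) (etab 3 u).pay))
    (if u = I.t then Entry.mk 0 0 0 else ⊤)

/-- An arc which leads downwards to the target. -/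
def thirdRoute : Code := Code.block [Op.eLoad 0 4 7, Op.eGo 0 0 7, Op.eLoad 1 6 6, Op.eMin 1 0,
  Op.eStore 6 6 1, Op.eLoad 2 5 7, Op.eGo 2 0 7, Op.eLoad 1 3 6, Op.eMin 1 2, Op.eStore 3 6 1,
  Op.load 13 18 7, Op.succ 12 6, Op.eLoad 1 7 6, Code.cond (.eq 13 12) (Op.eMin 1 0) (Op.eMin 1 2),
  Op.eStore 7 6 1]

/-- The third pass for an arc. -/
def thirdArc : Code := Code.block [Op.load 8 17 7, Code.cond (.eq 8 9) .skip
  (Code.block [Op.load 11 18 6, Op.succ 12 7, Code.cond (.eq 11 12) .skip thirdRoute])]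

/-- The totals if the walk has reached the target. -/
def thirdGoal : Code := Code.cond (.eq 6 2) (Op.eZero 4) (Op.eTop 4)

/-- The totals for going round the cycle. -/
def thirdLoop : Code := Code.block [Op.load 11 18 6, Code.cond (.eq 11 9) (Op.eTop 3)
  (Code.block [Op.load 7 19 6, Op.succ 12 7, Op.load 8 17 7, Op.numLoad 0 1 6, Op.load 13 20 6,
    Op.numLoad 1 2 6, Op.numLoad 2 3 6,
    Code.cond (.eq 11 12) (Code.cond (.eq 13 9) (Op.eZero 3) (Op.eTop 3))
      (Code.cond (.eq 8 9) (Code.cond (.eq 13 9) (Op.eLoad 3 1 7) (Op.eLoad 3 2 7)) (Op.eTop 3)),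
    Code.cond (.eq 13 9) (Op.eAdd 3 1 2) (Op.eAdd 3 2 1), Op.eGo 3 0 7])]

/-- The tables for the first visit. -/
def thirdVisit : Code := Code.block [Op.eStore 8 6 3, Op.eLoad 0 6 6, Op.eLoad 1 0 6,
  Op.eLoad 2 3 6, Op.eAfter 1 2, Op.eAfter 3 2, Op.eMin 0 1, Op.eMin 3 4, Op.eMin 0 3,
  Op.eStore 4 6 0, Op.eLoad 0 7 6, Op.eMin 0 1, Op.eMin 0 4, Op.eStore 5 6 0]

/-- The third pass for a finished vertex. -/
def thirdFin : Code := Code.seq thirdGoal (Code.seq thirdLoop thirdVisit)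

variable {F} {ev : List (Event n)} {L : List (Fin n × Fin n)}

open Classical in
theorem thirdArc_run {s : Store} {u w : Fin n} (hg : Given I L s) (hu : I.Reach u)
    (ha : I.graph.Adj u w) (h6 : s.reg 6 = u) (h7 : s.reg 7 = w) (h0 : s.num 0 = I.cost u w)
    (hku : Known F u s.arr s.numArr) (hkw : Known F w s.arr s.numArr) :
    (thirdArc.run s).etab = if F.Route u w then
      Function.update (Function.update (Function.update s.etab 6 (Function.update (s.etab 6) u
        (min (s.etab 6 u) (Entry.go (I.cost u w) w (s.etab 4 w).pay)))) 3
        (Function.update (s.etab 3) u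
        (min (s.etab 3 u) (Entry.go (I.cost u w) w (s.etab 5 w).pay)))) 7
        (Function.update (s.etab 7) u (min (s.etab 7 u)
          (Entry.go (I.cost u w) w (if F.top w = some u then s.etab 4 w else s.etab 5 w).pay)))
      else s.etab := by
  have h9 := hg.zero
  have ku := hku.top
  have kw := hkw.top
  rw [F.route_iff hu ha]
  by_cases hl : F.low w
  · have hl' := hkw.low.2 hl
    by_cases ht : F.top u = some w
    · have hc := F.topCode_eq_succ.2 ht
      rw [← ku] at hc
      simp [thirdArc, Code.block, Code.run, Op.run, Test.Passes, h9, h6, h7, hl', hc, ht]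
    · have hc : s.arr 18 u ≠ w + 1 := by
        rw [ku]
        exact fun h => ht (F.topCode_eq_succ.1 h)
      by_cases ht' : F.top w = some u
      · have hc' := F.topCode_eq_succ.2 ht'
        rw [← kw] at hc'
        simp [thirdArc, thirdRoute, Code.block, Code.run, Op.run, Test.Passes, h9, h6, h7, hl', hl,
          hc, ht, ht', hc', h0]
      · have hc' : s.arr 18 w ≠ u + 1 := by
          rw [kw]
          exact fun h => ht' (F.topCode_eq_succ.1 h)
        simp [thirdArc, thirdRoute, Code.block, Code.run, Op.run, Test.Passes, h9, h6, h7, hl', hl,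
          hc, ht, ht', hc', h0]
  · have hl' : s.arr 17 w = 0 := by
      by_contra h
      exact hl (hkw.low.1 h)
    simp [thirdArc, Code.block, Code.run, Op.run, Test.Passes, h9, h7, hl', hl]

/-- The instruction `eAdd` never exchanges the players; for odd `par` its two arguments are swapped
instead. -/
theorem after_swap (e : Entry) (a b : ℝ) :
    Entry.after true e (some (a, b)) = Entry.after false e (some (b, a)) := by
  rcases Entry.cases e with rfl | ⟨x, y, v, rfl⟩ <;> simp

theorem thirdGoal_run {s : Store} {u : Fin n} (hg : Given I L s) (h6 : s.reg 6 = u) :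
    (thirdGoal.run s).ereg 4 = if u = I.t then Entry.mk 0 0 0 else ⊤ := by
  have h2 := hg.target
  by_cases h : u = I.t
  · subst h
    simp [thirdGoal, Code.run, Op.run, Test.Passes, h2, h6]
  · have h' : (u : ℕ) ≠ I.t := fun h' => h (Fin.ext h')
    simp [thirdGoal, Code.run, Op.run, Test.Passes, h2, h6, h, h']

theorem thirdLoop_run {s : Store} {u : Fin n} (hg : Given I L s) (hu : I.Reach u)
    (h6 : s.reg 6 = u) (hk : ∀ {x}, I.Reach x → Known F x s.arr s.numArr) :
    (thirdLoop.run s).ereg 3 = (Tables.ofStore F s.arr s.numArr s.etab).loopValue u := by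
  have h9 := hg.zero
  have ku := (hk hu).top
  cases ht : F.top u with
  | none =>
    have hc := F.topCode_eq_zero.2 ht
    rw [← ku] at hc
    simp [thirdLoop, Code.block, Code.run, Op.run, Test.Passes, h9, h6, hc, Tables.loopValue, ht]
  | some v =>
    obtain ⟨-, ha, -⟩ := F.suc_spec ht
    have hr := F.route_iff hu ha
    obtain ⟨k1, k2⟩ := (hk hu).suc (by simp [ht])
    have hc := F.topCode_eq_succ.2 ht
    rw [← ku] at hc
    have hl := (hk (hu.tail ha)).low
    by_cases hv : v = F.suc u
    · have hv' : (v : ℕ) = F.suc u := congrArg _ hv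
      have hnr : ¬ F.Route u (F.suc u) := fun h => (hr.1 h).2 (by rw [ht, hv])
      by_cases hp : s.arr 20 u = 0
      · simp [thirdLoop, Code.block, Code.run, Op.run, Test.Passes, h9, h6, hc, k1, k2, hp,
          Tables.loopValue, ht, hnr, Tables.ofStore, Tables.next, hv]
      · simp [thirdLoop, Code.block, Code.run, Op.run, Test.Passes, h9, h6, hc, k1, k2, hp,
          Tables.loopValue, ht, hnr, Tables.ofStore, Tables.next, hv]
    · have hv' : (v : ℕ) ≠ F.suc u := fun h => hv (Fin.ext h)
      by_cases hlow : F.low (F.suc u)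
      · have hR : F.Route u (F.suc u) := hr.2 ⟨hlow, by simp [ht, hv]⟩
        have hl' := hl.2 hlow
        by_cases hp : s.arr 20 u = 0
        · simp [thirdLoop, Code.block, Code.run, Op.run, Test.Passes, h9, h6, hc, k1, k2, hv', hp,
            Tables.loopValue, ht, hR, hl']
        · simp [thirdLoop, Code.block, Code.run, Op.run, Test.Passes, h9, h6, hc, k1, k2, hv', hp,
            Tables.loopValue, ht, hR, hl']
      · have hnr : ¬ F.Route u (F.suc u) := fun h => hlow (hr.1 h).1
        have hl' : s.arr 17 (F.suc u) = 0 := by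
          by_contra h
          exact hlow (hl.1 h)
        by_cases hp : s.arr 20 u = 0
        · simp [thirdLoop, Code.block, Code.run, Op.run, Test.Passes, h9, h6, hc, k1, k2, hv', hp,
            Tables.loopValue, ht, hnr, Tables.ofStore, Tables.next, hv, hl']
        · simp [thirdLoop, Code.block, Code.run, Op.run, Test.Passes, h9, h6, hc, k1, k2, hv', hp,
            Tables.loopValue, ht, hnr, Tables.ofStore, Tables.next, hv, hl', after_swap]

theorem thirdVisit_run {s : Store} {u : Fin n} (h6 : s.reg 6 = u) :
    (thirdVisit.run s).etab = Function.update (Function.update (Function.update s.etab 8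
      (Function.update (s.etab 8) u (s.ereg 3))) 4 (Function.update (s.etab 4) u
      (min (min (s.etab 6 u) (Entry.after true (s.etab 0 u) (s.etab 3 u).pay))
      (min (Entry.after true (s.ereg 3) (s.etab 3 u).pay) (s.ereg 4))))) 5
      (Function.update (s.etab 5) u (min (min (s.etab 7 u)
        (Entry.after true (s.etab 0 u) (s.etab 3 u).pay)) (s.ereg 4))) := by
  simp [thirdVisit, Code.block, Code.run, Op.run, h6]

theorem thirdFin_run {s : Store} {u : Fin n} (hg : Given I L s) (hu : I.Reach u)
    (h6 : s.reg 6 = u) (hk : ∀ {x}, I.Reach x → Known F x s.arr s.numArr) :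
    (thirdFin.run s).etab = Function.update (Function.update (Function.update s.etab 8
      (Function.update (s.etab 8) u ((Tables.ofStore F s.arr s.numArr s.etab).loopValue u))) 4
      (Function.update (s.etab 4) u
      (min (min (s.etab 6 u) (Entry.after true (s.etab 0 u) (s.etab 3 u).pay))
      (min (Entry.after true ((Tables.ofStore F s.arr s.numArr s.etab).loopValue u)
        (s.etab 3 u).pay) (if u = I.t then Entry.mk 0 0 0 else ⊤))))) 5
      (Function.update (s.etab 5) u (min (min (s.etab 7 u)
        (Entry.after true (s.etab 0 u) (s.etab 3 u).pay))
        (if u = I.t then Entry.mk 0 0 0 else ⊤))) := by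
  have ha := thirdGoal.agree_run s
  have h1 := thirdGoal_run hg h6
  have hrun : thirdFin.run s = thirdVisit.run (thirdLoop.run (thirdGoal.run s)) := by
    rw [thirdFin, Code.run, Code.run]
  obtain ⟨m, hm⟩ : ∃ m, m = thirdGoal.run s := ⟨_, rfl⟩
  rw [← hm] at ha h1 hrun
  have e1 : m.arr = s.arr := funext fun i => ha.2.1 i (by simp [thirdGoal, Code.targets, Op.target])
  have e2 : m.numArr = s.numArr :=
    funext fun i => ha.2.2.2.1 i (by simp [thirdGoal, Code.targets, Op.target])
  have e3 : m.etab = s.etab :=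
    funext fun i => ha.2.2.2.2.2 i (by simp [thirdGoal, Code.targets, Op.target])
  have hb := thirdLoop.agree_run m
  have h2 := thirdLoop_run (F := F) (s := m) (u := u) (hg.agree ha (by decide)) hu
    ((ha.1 6 (by decide)).trans h6) (fun hx => by rw [e1, e2]; exact hk hx)
  obtain ⟨m', hm'⟩ : ∃ m', m' = thirdLoop.run m := ⟨_, rfl⟩
  rw [← hm'] at hb h2 hrun
  have h3 : m'.ereg 4 = m.ereg 4 := hb.2.2.2.2.1 4 (by decide)
  have h4 : m'.etab = s.etab := by
    rw [← e3]
    exact funext fun i => hb.2.2.2.2.2 i (by simp [thirdLoop, Code.block, Code.targets, Op.target])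
  have h5 : m'.reg 6 = u := by
    rw [hb.1 6 (by decide), ha.1 6 (by decide), h6]
  rw [e1, e2, e3] at h2
  rw [hrun, thirdVisit_run h5, h2, h3, h1, h4]

end

end ShortestPathGame

/-! ### Invariant of the third pass, and validity of the computed tables -/

namespace ShortestPathGame

section

variable {n : ℕ} {I : Game n} {F : Layout I} {ev : List (Event n)} {L : List (Fin n × Fin n)}

theorem Tables.loopValue_agree {s s' : Store} {l : List (ℕ × ℕ)} (ha : Code.Agree l s s')
    (hl : ∀ x ∈ [(1, 20), (3, 2), (3, 3), (5, 1), (5, 2)], x ∉ l) (u : Fin n) :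
    (Tables.ofStore F s'.arr s'.numArr s'.etab).loopValue u =
      (Tables.ofStore F s.arr s.numArr s.etab).loopValue u := by
  simp only [List.mem_cons, List.not_mem_nil, or_false, forall_eq_or_imp, forall_eq] at hl
  obtain ⟨l1, l2, l3, l4, l5⟩ := hl
  have e1 := ha.2.1 _ l1
  have e2 := ha.2.2.2.1 _ l2
  have e3 := ha.2.2.2.1 _ l3
  have e4 := ha.2.2.2.2.2 _ l4
  have e5 := ha.2.2.2.2.2 _ l5
  have hR : ∀ b x, (Tables.ofStore F s'.arr s'.numArr s'.etab).R b x =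
      (Tables.ofStore F s.arr s.numArr s.etab).R b x := by
    intro b x
    cases b
    · simp [Tables.ofStore, e4]
    · simp [Tables.ofStore, e5]
  have hpar : (Tables.ofStore F s'.arr s'.numArr s'.etab).par u =
      (Tables.ofStore F s.arr s.numArr s.etab).par u := by
    simp [Tables.ofStore, e1]
  have hpa : (Tables.ofStore F s'.arr s'.numArr s'.etab).pa u =
      (Tables.ofStore F s.arr s.numArr s.etab).pa u := by
    simp [Tables.ofStore, e2]
  have hpb : (Tables.ofStore F s'.arr s'.numArr s'.etab).pb u =
      (Tables.ofStore F s.arr s.numArr s.etab).pb u := by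
    simp [Tables.ofStore, e3]
  simp only [Tables.loopValue, Tables.next, hR, hpar, hpa, hpb]

theorem ThirdStage.init {arr : ℕ → ℕ → ℕ} {numArr : ℕ → ℕ → ℝ} {etab : ℕ → ℕ → Entry}
    (h : Rest arr etab) : ThirdStage F [] arr numArr etab := by
  refine ⟨?_, ?_, ?_, by simp, by simp, by simp⟩
  · intro u
    rw [h.etab 3 (by simp)]
    exact IsMin.top (by simp)
  · intro u
    rw [h.etab 6 (by simp)]
    exact IsMin.top (by simp)
  · intro u
    rw [h.etab 7 (by simp)]
    exact IsMin.top (by simp)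

open Classical in
theorem ThirdStage.arc (hS : Schedule I F.rank ev) {pre suf : List (Event n)} {u w : Fin n}
    {s : Store} (he : ev = pre ++ (u, some w) :: suf) (hs : Scheduled I L ev s)
    (hf : FirstStage F ev s.arr s.numArr s.etab) (h : ThirdStage F pre s.arr s.numArr s.etab)
    (h6 : s.reg 6 = u) (h7 : s.reg 7 = w) (h0 : s.num 0 = I.cost u w) :
    ThirdStage F (pre ++ [(u, some w)]) (thirdArc.run s).arr (thirdArc.run s).numArr
      (thirdArc.run s).etab := by
  obtain ⟨hu, ha, hn, hn', hr⟩ := hS.arc he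
  have hag := thirdArc.agree_run s
  have hloop := Tables.loopValue_agree (F := F) hag (by decide)
  have hE := thirdArc_run hs.given hu ha h6 h7 h0 (hf.known hS hu) (hf.known hS (hu.tail ha))
  obtain ⟨s', hs'⟩ : ∃ s', s' = thirdArc.run s := ⟨_, rfl⟩
  rw [← hs'] at hag hloop hE ⊢
  have f0 : s'.etab 0 = s.etab 0 := hag.2.2.2.2.2 0 (by decide)
  have f4 : s'.etab 4 = s.etab 4 := hag.2.2.2.2.2 4 (by decide)
  have f5 : s'.etab 5 = s.etab 5 := hag.2.2.2.2.2 5 (by decide)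
  have f8 : s'.etab 8 = s.etab 8 := hag.2.2.2.2.2 8 (by decide)
  have hval : ∀ {x : Fin n}, x ≠ u → (x : ℕ) ≠ u := fun h h' => h (Fin.ext h')
  have hfin : ∀ {x : Fin n}, (x, none) ∈ pre ++ [(u, some w)] → (x, none) ∈ pre ∧ x ≠ u := by
    intro x hx
    have hx' : (x, none) ∈ pre := by simpa using hx
    exact ⟨hx', fun h => hn (h ▸ hx')⟩
  have hold : ∀ (i : ℕ) (x : Fin n), x ≠ u → s'.etab i x = s.etab i x := by
    intro i x hx
    rw [hE]
    by_cases hR : F.Route u w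
    · rw [if_pos hR]
      simp only [Function.update_apply]
      split_ifs with h1 h2 <;> simp_all
    · rw [if_neg hR]
  have key : ∀ (c : Fin n → Fin n → Entry) (e e' : ℕ → Entry),
      (∀ x : Fin n, IsMin (fun y => (x, some y) ∈ pre ∧ F.Route x y) (c x) (e x)) →
      e' = (if F.Route u w then Function.update e u (min (e u) (c u w)) else e) →
      ∀ x : Fin n, IsMin (fun y => (x, some y) ∈ pre ++ [(u, some w)] ∧ F.Route x y)
        (c x) (e' x) := by
    intro c e e' hm he' x
    rw [he']
    have hmem : ∀ y : Fin n, (x, some y) ∈ pre ++ [(u, some w)] ↔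
        (x, some y) ∈ pre ∨ (x = u ∧ y = w) := by simp
    simp only [hmem]
    by_cases hR : F.Route u w
    · rw [if_pos hR]
      by_cases hx : x = u
      · subst hx
        rw [Function.update_self]
        refine (hm x).insert (x := w) fun y => ?_
        constructor
        · rintro ⟨h1 | h1, h2⟩
          · exact Or.inl ⟨h1, h2⟩
          · exact Or.inr h1.2
        · rintro (h1 | rfl)
          · exact ⟨Or.inl h1.1, h1.2⟩
          · exact ⟨Or.inr ⟨rfl, rfl⟩, hR⟩
      · rw [Function.update_of_ne (hval hx)]
        exact (hm x).congr (by simp [hx]) (fun _ _ => rfl)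
    · rw [if_neg hR]
      refine (hm x).congr (fun y => ?_) (fun _ _ => rfl)
      constructor
      · rintro ⟨h1 | ⟨rfl, rfl⟩, h2⟩
        · exact ⟨h1, h2⟩
        · exact absurd h2 hR
      · exact fun h => ⟨Or.inl h.1, h.2⟩
  refine ⟨?_, ?_, ?_, ?_, ?_, ?_⟩
  · rw [f5]
    refine key _ (s.etab 3) _ h.S ?_
    rw [hE]
    by_cases hR : F.Route u w
    · simp [hR]
    · simp [hR]
  · rw [f4]
    refine key _ (s.etab 6) _ h.rtC ?_
    rw [hE]
    by_cases hR : F.Route u w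
    · simp [hR]
    · simp [hR]
  · rw [f4, f5]
    refine key _ (s.etab 7) _ h.rtU ?_
    rw [hE]
    by_cases hR : F.Route u w
    · simp [hR]
    · simp [hR]
  · intro x hx
    rw [hloop, f8]
    exact h.loop x (hfin hx).1
  · intro x hx
    rw [f4, f0, f8, hold 6 x (hfin hx).2, hold 3 x (hfin hx).2]
    exact h.EC x (hfin hx).1
  · intro x hx
    rw [f5, f0, hold 7 x (hfin hx).2, hold 3 x (hfin hx).2]
    exact h.EU x (hfin hx).1

theorem ThirdStage.fin (hS : Schedule I F.rank ev) {pre suf : List (Event n)} {u : Fin n}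
    {s : Store} (he : ev = pre ++ (u, none) :: suf) (hs : Scheduled I L ev s)
    (hf : FirstStage F ev s.arr s.numArr s.etab) (h : ThirdStage F pre s.arr s.numArr s.etab)
    (h6 : s.reg 6 = u) :
    ThirdStage F (pre ++ [(u, none)]) (thirdFin.run s).arr (thirdFin.run s).numArr
      (thirdFin.run s).etab := by
  obtain ⟨hu, hn, hall⟩ := hS.fin he
  have hag := thirdFin.agree_run s
  have hloop := Tables.loopValue_agree (F := F) hag (by decide)
  have hE := thirdFin_run hs.given hu h6 fun hx => hf.known hS hx
  obtain ⟨s', hs'⟩ : ∃ s', s' = thirdFin.run s := ⟨_, rfl⟩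
  rw [← hs'] at hag hloop hE ⊢
  have f0 : s'.etab 0 = s.etab 0 := hag.2.2.2.2.2 0 (by decide)
  have f3 : s'.etab 3 = s.etab 3 := hag.2.2.2.2.2 3 (by decide)
  have f6 : s'.etab 6 = s.etab 6 := hag.2.2.2.2.2 6 (by decide)
  have f7 : s'.etab 7 = s.etab 7 := hag.2.2.2.2.2 7 (by decide)
  have hval : ∀ {x : Fin n}, x ≠ u → (x : ℕ) ≠ u := fun h h' => h (Fin.ext h')
  have hfin : ∀ {x : Fin n}, (x, none) ∈ pre ++ [(u, none)] → (x, none) ∈ pre ∨ x = u :=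
    fun hx => by simpa using hx
  have hmem : ∀ x y : Fin n, (x, some y) ∈ pre ++ [(u, none)] ↔ (x, some y) ∈ pre :=
    fun x y => by simp
  have hold : ∀ (i : ℕ) (x : Fin n), x ≠ u → s'.etab i x = s.etab i x := by
    intro i x hx
    rw [hE]
    simp only [Function.update_apply]
    split_ifs with h1 h2 <;> simp_all
  -- The head of a descending arc scanned before was finished even earlier, so the entries used for
  -- that arc do not change now.
  have hne : ∀ {x y : Fin n}, (x, some y) ∈ pre ∧ F.Route x y → y ≠ u := by
    rintro x y ⟨h1, h2⟩ rfl
    exact hn ((hS.of_arc_mem he h1).2.2 h2.2.1)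
  refine ⟨?_, ?_, ?_, ?_, ?_, ?_⟩
  · intro x
    simp only [hmem, f3]
    exact (h.S x).congr (fun _ => Iff.rfl) fun y hy => by rw [hold 5 y (hne hy)]
  · intro x
    simp only [hmem, f6]
    exact (h.rtC x).congr (fun _ => Iff.rfl) fun y hy => by rw [hold 4 y (hne hy)]
  · intro x
    simp only [hmem, f7]
    exact (h.rtU x).congr (fun _ => Iff.rfl) fun y hy => by
      rw [hold 4 y (hne hy), hold 5 y (hne hy)]
  · intro x hx
    rw [hloop]
    by_cases hxu : x = u
    · subst hxu
      simp [hE]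
    · rw [hold 8 x hxu]
      exact h.loop x ((hfin hx).resolve_right hxu)
  · intro x hx
    rw [f0, f3, f6]
    by_cases hxu : x = u
    · subst hxu
      simp [hE]
    · rw [hold 8 x hxu, hold 4 x hxu]
      exact h.EC x ((hfin hx).resolve_right hxu)
  · intro x hx
    rw [f0, f3, f7]
    by_cases hxu : x = u
    · subst hxu
      simp [hE]
    · rw [hold 5 x hxu]
      exact h.EU x ((hfin hx).resolve_right hxu)

theorem thirdHandles (hS : Schedule I F.rank ev) : Handles I L ev thirdFin thirdArc
    (fun pre _ s => FirstStage F ev s.arr s.numArr s.etab ∧ SecondStage F ev [] s.arr s.numArr ∧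
      s.arr 21 = (fun _ => 0) ∧ ThirdStage F pre s.arr s.numArr s.etab)
    (fun pre e s => FirstStage F ev s.arr s.numArr s.etab ∧ SecondStage F ev [] s.arr s.numArr ∧
      s.arr 21 = (fun _ => 0) ∧ ThirdStage F (pre ++ [e]) s.arr s.numArr s.etab) where
  keeps := by decide
  okP := by decide
  okQ := by decide
  fin _ _ _ s he hs h h6 :=
    ⟨h.1.agree (thirdFin.agree_run s) (by decide), h.2.1.agree (thirdFin.agree_run s) (by decide),
      ((thirdFin.agree_run s).2.1 21 (by decide)).trans h.2.2.1, h.2.2.2.fin hS he hs h.1 h6⟩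
  arc _ _ _ _ s he hs h h6 h7 h0 :=
    ⟨h.1.agree (thirdArc.agree_run s) (by decide), h.2.1.agree (thirdArc.agree_run s) (by decide),
      ((thirdArc.agree_run s).2.1 21 (by decide)).trans h.2.2.1,
      h.2.2.2.arc hS he hs h.1 h6 h7 h0⟩

/-- At the end of the passes all arcs from reachable vertices have been scanned, so the restrictions
of the invariants to scanned arcs disappear. -/
theorem Tables.valid_ofStore (hS : Schedule I F.rank ev) {arr : ℕ → ℕ → ℕ} {numArr : ℕ → ℕ → ℝ}
    {etab : ℕ → ℕ → Entry} (h1 : FirstStage F ev arr numArr etab)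
    (h2 : SecondStage F ev [] arr numArr) (h3 : ThirdStage F ev arr numArr etab) :
    (Tables.ofStore F arr numArr etab).Valid := by
  have hmem : ∀ {u w : Fin n}, I.Reach u → I.graph.Adj u w → (u, some w) ∈ ev :=
    fun hu ha => hS.mem_arc hu ha
  refine ⟨?_, ?_, ?_, ?_, ?_, ?_, ?_, ?_, ?_, ?_, ?_⟩
  · exact fun u hu => (h1.det u).congr (fun w => ⟨fun h => ⟨hmem hu h.1, h⟩, fun h => h.2⟩)
      fun _ _ => rfl
  · exact fun u b hu ht => h1.R u b (hS.mem_fin hu) ht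
  · exact fun u hu => (h3.S u).congr (fun w => ⟨fun h => ⟨hmem hu h.1, h⟩, fun h => h.2⟩)
      fun _ _ => rfl
  · exact fun u hu => (h3.rtC u).congr (fun w => ⟨fun h => ⟨hmem hu h.1, h⟩, fun h => h.2⟩)
      fun _ _ => rfl
  · refine fun u hu => (h3.rtU u).congr (fun w => ⟨fun h => ⟨hmem hu h.1, h⟩, fun h => h.2⟩)
      fun w _ => ?_
    simp only [Tables.ofStore]
  · intro u hu ht hr
    rw [show (Tables.ofStore F arr numArr etab).loop u = etab 8 u from rfl,
      h3.loop u (hS.mem_fin hu), Tables.loopValue, if_neg (not_or.2 ⟨ht, hr⟩)]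
  · intro u hu ht
    rw [show (Tables.ofStore F arr numArr etab).loop u = etab 8 u from rfl,
      h3.loop u (hS.mem_fin hu), Tables.loopValue, if_pos ht]
  · intro u hu
    exact h3.EC u (hS.mem_fin hu)
  · intro u hu
    exact h3.EU u (hS.mem_fin hu)
  · intro u w hu ha hr ht
    obtain ⟨g1, g2, g3⟩ := (h2 u w u (hmem hu ha) (by simp) hr ht).1 rfl
    simp [Tables.ofStore, g1, g2, g3]
  · intro u w v hu ha hr ht ht'
    obtain ⟨g1, g2, g3⟩ := (h2 u w v (hmem hu ha) (by simp) hr ht).2 ht'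
    by_cases hp : arr 20 u = 0
    · simp [Tables.ofStore, g1.2 hp, g2, g3, hp]
    · have : arr 20 w = 0 := by
        by_contra h
        exact hp (g1.1 h)
      simp [Tables.ofStore, this, g2, g3, hp]

end

end ShortestPathGame

namespace ShortestPathGame

/-! ### The simulation of the players -/

section

variable {n : ℕ} {I : Game n} {F : Layout I} {L : List (Fin n × Fin n)}

/-- Set a flag unless the target is reached. -/
def simFlag : Code := Code.cond (.eq 6 2) (Op.copy 5 9) (Op.const 5 1)

/-- Visit the start. -/
def simBegin : Code := Code.block [Op.const 5 1, Op.store 21 1 5, Op.copy 6 1, Op.copy 7 9,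
  Op.copy 4 9, Op.store 2 4 6, Op.succ 4 4]

/-- Start the simulation. -/
def simStart : Code := Code.seq simBegin simFlag

/-- The next vertex. -/
def simChoice : Code := Code.block [Op.const 12 1, Op.const 13 2, Op.const 15 3, Op.load 8 21 6,
  Code.cond (.eq 7 9) (Code.cond (.eq 8 12) (Op.eLoad 0 4 6) (Code.cond (.eq 8 13) (Op.eLoad 0 5 6)
    (Code.cond (.eq 8 15) (Op.eLoad 0 1 6) (Op.eLoad 0 2 6)))) (Op.eLoad 0 3 6),
  Op.eVert 11 0, Code.cond (.eq 7 9) .skip (Code.cond (.lt 8 15) .skip (Op.load 11 19 6))]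

/-- The mode for a first visit of the next vertex. -/
def simMode : Code := Code.block [Op.const 17 4, Op.load 18 17 11, Op.load 19 18 11, Op.succ 20 6,
  Op.load 22 20 6, Code.cond (.eq 7 9) (Code.cond (.eq 8 12) (Code.cond (.eq 18 9)
    (Code.cond (.eq 19 20) (Op.copy 16 15) (Code.cond (.eq 22 9) (Op.copy 16 15) (Op.copy 16 17)))
    (Op.copy 16 12))
    (Code.cond (.eq 8 13) (Code.cond (.eq 18 9) (Op.copy 16 15)
      (Code.cond (.eq 19 20) (Op.copy 16 12) (Op.copy 16 13)))
    (Code.cond (.eq 8 15) (Code.cond (.eq 19 20) (Op.copy 16 15) (Op.copy 16 17))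
      (Op.copy 16 15)))) (Code.cond (.lt 8 15) (Op.copy 16 13) (Op.copy 16 8))]

/-- Visit the next vertex. -/
def simVisit : Code := Code.block [Op.load 8 21 11, Code.cond (.eq 8 9)
  (Code.block [Op.store 21 11 16, Op.copy 7 9]) (Op.copy 7 12),
  Op.copy 6 11, Op.store 2 4 6, Op.succ 4 4]

/-- Go to the next vertex. -/
def simMove : Code := Code.seq simVisit simFlag

/-- One step of the simulation. -/
def simStep : Code := Code.seq simChoice (Code.seq simMode simMove)

/-- The simulation of the players. -/
def simProg : Prog := .seq simStart.prog (.loop (.lt 9 5) simStep.prog)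

variable (L) in
/-- The store represents the state `σ` of the simulation after the vertices `out`. -/
structure Simulates (T : Tables I F) (σ : Tables.State n) (out : List (Fin n)) (s : Store) :
    Prop where
  given : Given I L s
  known : ∀ u, I.Reach u → Known F u s.arr s.numArr
  tables : Tables.ofStore F s.arr s.numArr s.etab = T
  mode : ∀ u : Fin n, s.arr 21 u = σ.mode u
  cur : s.reg 6 = σ.cur
  sat : s.reg 7 = 0 ↔ σ.sat = false
  flag : s.reg 5 = 0 ↔ σ.cur = I.t
  count : s.reg 4 = out.length
  out : ∀ i (h : i < out.length), s.arr 2 i = out[i]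

theorem Known.agree {s s' : Store} {l : List (ℕ × ℕ)} {u : Fin n} (h : Known F u s.arr s.numArr)
    (ha : Code.Agree l s s') (hl : ∀ x ∈ [(1, 17), (1, 18), (1, 19), (3, 1)], x ∉ l) :
    Known F u s'.arr s'.numArr := by
  simp only [List.mem_cons, List.not_mem_nil, or_false, forall_eq_or_imp, forall_eq] at hl
  obtain ⟨l1, l2, l3, l4⟩ := hl
  refine ⟨?_, ?_, ?_⟩
  · rw [ha.2.1 _ l1]
    exact h.low
  · rw [ha.2.1 _ l2]
    exact h.top
  · rw [ha.2.1 _ l3, ha.2.2.2.1 _ l4]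
    exact h.suc

theorem Tables.ofStore_agree {s s' : Store} {l : List (ℕ × ℕ)} (ha : Code.Agree l s s')
    (hl : ∀ i < 9, (5, i) ∉ l) (hl' : ∀ x ∈ [(1, 20), (3, 2), (3, 3)], x ∉ l) :
    Tables.ofStore F s'.arr s'.numArr s'.etab = Tables.ofStore F s.arr s.numArr s.etab := by
  simp only [List.mem_cons, List.not_mem_nil, or_false, forall_eq_or_imp, forall_eq] at hl'
  obtain ⟨l1, l2, l3⟩ := hl'
  have e : ∀ i < 9, s'.etab i = s.etab i := fun i hi => ha.2.2.2.2.2 i (hl i hi)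
  have hR : ∀ b : Bool, s'.etab (if b then 2 else 1) = s.etab (if b then 2 else 1) := by
    intro b
    cases b <;> simp [e]
  simp only [Tables.ofStore, ha.2.1 _ l1, ha.2.2.2.1 _ l2, ha.2.2.2.1 _ l3, hR]
  simp [e]

theorem simFlag_run {s : Store} {u : Fin n} (h2 : s.reg 2 = I.t) (h9 : s.reg 9 = 0)
    (h6 : s.reg 6 = u) : (simFlag.run s).reg 5 = 0 ↔ u = I.t := by
  by_cases h : u = I.t
  · simp [simFlag, Code.run, Op.run, Test.Passes, h2, h6, h9, h]
  · have h' : (u : ℕ) ≠ I.t := fun h' => h (Fin.ext h')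
    simp [simFlag, Code.run, Op.run, Test.Passes, h2, h6, h', h]

/-- Array 19 is meaningful only for vertices below the top of a cycle; `hs` excludes that it is
consulted elsewhere. -/
theorem simChoice_run {s : Store} {T : Tables I F} {σ : Tables.State n} {out : List (Fin n)}
    (h : Simulates L T σ out s) (hs : s.arr 19 σ.cur = F.suc σ.cur ∨ T.decision σ ≠ F.suc σ.cur) :
    (simChoice.run s).reg 8 = σ.mode σ.cur ∧ (simChoice.run s).reg 12 = 1 ∧
      (simChoice.run s).reg 13 = 2 ∧ (simChoice.run s).reg 15 = 3 ∧
      (simChoice.run s).reg 11 = T.decision σ := by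
  have h9 := h.given.zero
  have h6 := h.cur
  have hm := h.mode σ.cur
  have hT := h.tables
  have h7 := h.sat
  cases hsat : σ.sat
  · have h7' := h7.2 hsat
    have hd : T.decision σ = if σ.mode σ.cur = 1 then (s.etab 4 σ.cur).vert else
        if σ.mode σ.cur = 2 then (s.etab 5 σ.cur).vert else
        if σ.mode σ.cur = 3 then (s.etab 1 σ.cur).vert else (s.etab 2 σ.cur).vert := by
      rw [← hT]
      simp [Tables.decision, hsat, Tables.ofStore]
    by_cases m1 : σ.mode σ.cur = 1
    · simp [simChoice, Code.block, Code.run, Op.run, Test.Passes, h9, h6, hm, h7', m1, hd]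
    · by_cases m2 : σ.mode σ.cur = 2
      · simp [simChoice, Code.block, Code.run, Op.run, Test.Passes, h9, h6, hm, h7', m2, hd]
      · by_cases m3 : σ.mode σ.cur = 3
        · simp [simChoice, Code.block, Code.run, Op.run, Test.Passes, h9, h6, hm, h7', m3, hd]
        · simp [simChoice, Code.block, Code.run, Op.run, Test.Passes, h9, h6, hm, h7', m1, m2, m3,
            hd]
  · have h7' : s.reg 7 ≠ 0 := fun h' => by simp [h7.1 h'] at hsat
    have hd : T.decision σ = if σ.mode σ.cur ≤ 2 then (s.etab 3 σ.cur).vert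
        else F.suc σ.cur := by
      rw [← hT]
      simp [Tables.decision, hsat, Tables.ofStore]
    by_cases hm2 : σ.mode σ.cur ≤ 2
    · have hm3 : σ.mode σ.cur < 3 := by omega
      rw [if_pos hm2] at hd
      simp [simChoice, Code.block, Code.run, Op.run, Test.Passes, h9, h6, hm, h7', hm3, hd]
    · have hm3 : ¬ σ.mode σ.cur < 3 := by omega
      rw [if_neg hm2] at hd
      have hs' := hs.resolve_right (fun h => h hd)
      simp [simChoice, Code.block, Code.run, Op.run, Test.Passes, h9, h6, hm, h7', hm3, hs', hd]

theorem simMode_run {s : Store} {T : Tables I F} {σ : Tables.State n} {out : List (Fin n)}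
    {x : Fin n} (h : Simulates L T σ out s) (hx : I.Reach x) (h8 : s.reg 8 = σ.mode σ.cur)
    (h12 : s.reg 12 = 1) (h13 : s.reg 13 = 2) (h15 : s.reg 15 = 3) (h11 : s.reg 11 = x) :
    (simMode.run s).reg 16 = T.newMode σ x := by
  have h9 := h.given.zero
  have h6 := h.cur
  have hT := h.tables
  have h7 := h.sat
  have hk := h.known x hx
  have hpar : T.par σ.cur = true ↔ s.arr 20 σ.cur ≠ 0 := by
    rw [← hT]
    simp [Tables.ofStore]
  have htop : s.arr 18 x = σ.cur + 1 ↔ F.top x = some σ.cur := by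
    rw [hk.top, F.topCode_eq_succ]
  have hlow := hk.low
  cases hsat : σ.sat
  · have h7' := h7.2 hsat
    by_cases m1 : σ.mode σ.cur = 1
    · by_cases hl : F.low x
      · have hl' := hlow.2 hl
        simp [simMode, Code.block, Code.run, Op.run, Test.Passes, Tables.newMode, h9, h6, h7', h8,
          h12, h11, hsat, m1, hl, hl']
      · have hl' : s.arr 17 x = 0 := by
          by_contra h'
          exact hl (hlow.1 h')
        by_cases ht : F.top x = some σ.cur
        · have ht' := htop.2 ht
          simp [simMode, Code.block, Code.run, Op.run, Test.Passes, Tables.newMode, h9, h6, h7', h8,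
            h12, h15, h11, hsat, m1, hl, hl', ht, ht']
        · have ht' : s.arr 18 x ≠ σ.cur + 1 := fun h => ht (htop.1 h)
          by_cases hp : T.par σ.cur = true
          · have hp' := hpar.1 hp
            simp [simMode, Code.block, Code.run, Op.run, Test.Passes, Tables.newMode, h9, h6, h7',
              h8, h12, h11, hsat, m1, hl, hl', ht, ht', hp, hp']
          · have hp' : s.arr 20 σ.cur = 0 := by
              by_contra h'
              exact hp (hpar.2 h')
            simp [simMode, Code.block, Code.run, Op.run, Test.Passes, Tables.newMode, h9, h6, h7',
              h8, h12, h15, h11, hsat, m1, hl, hl', ht, ht', hp, hp']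
    · by_cases m2 : σ.mode σ.cur = 2
      · by_cases hl : F.low x
        · have hl' := hlow.2 hl
          by_cases ht : F.top x = some σ.cur
          · have ht' := htop.2 ht
            simp [simMode, Code.block, Code.run, Op.run, Test.Passes, Tables.newMode, h9, h6, h7',
              h8, h12, h13, h11, hsat, m2, hl, hl', ht, ht']
          · have ht' : s.arr 18 x ≠ σ.cur + 1 := fun h => ht (htop.1 h)
            simp [simMode, Code.block, Code.run, Op.run, Test.Passes, Tables.newMode, h9, h6, h7',
              h8, h12, h13, h11, hsat, m2, hl, hl', ht, ht']
        · have hl' : s.arr 17 x = 0 := by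
            by_contra h'
            exact hl (hlow.1 h')
          simp [simMode, Code.block, Code.run, Op.run, Test.Passes, Tables.newMode, h9, h6, h7',
            h8, h12, h13, h15, h11, hsat, m2, hl, hl']
      · by_cases m3 : σ.mode σ.cur = 3
        · by_cases ht : F.top x = some σ.cur
          · have ht' := htop.2 ht
            simp [simMode, Code.block, Code.run, Op.run, Test.Passes, Tables.newMode, h9, h6, h7',
              h8, h12, h13, h15, h11, hsat, m3, ht, ht']
          · have ht' : s.arr 18 x ≠ σ.cur + 1 := fun h => ht (htop.1 h)
            simp [simMode, Code.block, Code.run, Op.run, Test.Passes, Tables.newMode, h9, h6, h7',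
              h8, h12, h13, h15, h11, hsat, m3, ht, ht']
        · simp [simMode, Code.block, Code.run, Op.run, Test.Passes, Tables.newMode, h9, h6, h7',
            h8, h12, h13, h15, hsat, m1, m2, m3]
  · have h7' : s.reg 7 ≠ 0 := fun h' => by simp [h7.1 h'] at hsat
    by_cases hm2 : σ.mode σ.cur ≤ 2
    · have hm3 : σ.mode σ.cur < 3 := by omega
      simp [simMode, Code.block, Code.run, Op.run, Test.Passes, Tables.newMode, h9, h7', h8, h13,
        h15, hsat, hm2, hm3]
    · have hm3 : ¬ σ.mode σ.cur < 3 := by omega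
      simp [simMode, Code.block, Code.run, Op.run, Test.Passes, Tables.newMode, h9, h7', h8,
        h15, hsat, hm2, hm3]

theorem simMove_run {s : Store} {T : Tables I F} {σ : Tables.State n} {out : List (Fin n)}
    {x : Fin n} (h : Simulates L T σ out s) (h12 : s.reg 12 = 1) (h11 : s.reg 11 = x)
    (h16 : s.reg 16 = T.newMode σ x) :
    Simulates L T (T.step σ x) (out ++ [x]) (simMove.run s) := by
  have h9 := h.given.zero
  have hm := h.mode x
  have h4 := h.count
  have hv : (simVisit.run s).reg 4 = out.length + 1 ∧ (simVisit.run s).reg 6 = x ∧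
      (simVisit.run s).reg 7 = (if σ.mode x = 0 then 0 else 1) ∧
      (simVisit.run s).arr 2 = Function.update (s.arr 2) out.length x ∧
      (simVisit.run s).arr 21 = if σ.mode x = 0 then
        Function.update (s.arr 21) x (T.newMode σ x) else s.arr 21 := by
    by_cases h0 : σ.mode x = 0
    · simp [simVisit, Code.block, Code.run, Op.run, Test.Passes, h9, h11, hm, h0, h16, h4]
    · simp [simVisit, Code.block, Code.run, Op.run, Test.Passes, h9, h11, hm, h0, h12, h4]
  have ha := simVisit.agree_run s
  have hrun : simMove.run s = simFlag.run (simVisit.run s) := by rw [simMove, Code.run]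
  have hag := simMove.agree_run s
  obtain ⟨m, hm'⟩ : ∃ m, m = simVisit.run s := ⟨_, rfl⟩
  rw [← hm'] at ha hrun hv
  obtain ⟨v1, v2, v3, v4, v5⟩ := hv
  have hb := simFlag.agree_run m
  have hflag := simFlag_run (((ha.1 2 (by decide)).trans h.given.target))
    ((ha.1 9 (by decide)).trans h9) v2
  rw [← hrun] at hb hflag
  refine ⟨h.given.agree hag (by decide), fun u hu => (h.known u hu).agree hag (by decide),
    (Tables.ofStore_agree hag (by decide) (by decide)).trans h.tables, ?_, ?_, ?_, hflag, ?_, ?_⟩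
  · intro u
    rw [hb.2.1 21 (by decide), v5]
    simp only [Tables.step]
    split_ifs
    · simp only [Function.update_apply, Fin.ext_iff, h.mode]
    · exact h.mode u
  · rw [hb.1 6 (by decide), v2]
    rfl
  · rw [hb.1 7 (by decide), v3]
    simp [Tables.step]
  · rw [hb.1 4 (by decide), v1]
    simp
  · intro i hi
    rw [hb.2.1 2 (by decide), v4, Function.update_apply]
    split_ifs with hi'
    · subst hi'
      simp
    · have : i < out.length := by
        simp at hi
        omega
      rw [List.getElem_append_left this]
      exact h.out i this

theorem Simulates.agree {s s' : Store} {T : Tables I F} {σ : Tables.State n} {out : List (Fin n)}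
    {l : List (ℕ × ℕ)} (h : Simulates L T σ out s) (ha : Code.Agree l s s')
    (hl : ∀ i < 9, (5, i) ∉ l) (hl' : ∀ x ∈ [(0, 1), (0, 2), (0, 4), (0, 5), (0, 6), (0, 7), (0, 9),
      (1, 0), (1, 1), (1, 2), (1, 17), (1, 18), (1, 19), (1, 20), (1, 21), (3, 0), (3, 1), (3, 2),
      (3, 3)], x ∉ l) : Simulates L T σ out s' := by
  refine ⟨h.given.agree ha ?_, fun u hu => (h.known u hu).agree ha ?_,
    (Tables.ofStore_agree ha hl ?_).trans h.tables, ?_, ?_, ?_, ?_, ?_, ?_⟩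
  · exact fun x hx => hl' x (by simp at hx ⊢; tauto)
  · exact fun x hx => hl' x (by simp at hx ⊢; tauto)
  · exact fun x hx => hl' x (by simp at hx ⊢; tauto)
  · rw [ha.2.1 21 (hl' _ (by simp))]
    exact h.mode
  · rw [ha.1 6 (hl' _ (by simp))]
    exact h.cur
  · rw [ha.1 7 (hl' _ (by simp))]
    exact h.sat
  · rw [ha.1 5 (hl' _ (by simp))]
    exact h.flag
  · rw [ha.1 4 (hl' _ (by simp))]
    exact h.count
  · rw [ha.2.1 2 (hl' _ (by simp))]
    exact h.out

theorem simStep_run {s : Store} {T : Tables I F} {σ : Tables.State n} {out : List (Fin n)}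
    {x : Fin n} (h : Simulates L T σ out s)
    (hs : s.arr 19 σ.cur = F.suc σ.cur ∨ T.decision σ ≠ F.suc σ.cur) (hx : I.Reach x)
    (hd : T.decision σ = x) : Simulates L T (T.step σ x) (out ++ [x]) (simStep.run s) := by
  obtain ⟨g8, g12, g13, g15, g11⟩ := simChoice_run h hs
  have ha := simChoice.agree_run s
  have hrun : simStep.run s = simMove.run (simMode.run (simChoice.run s)) := by
    rw [simStep, Code.run, Code.run]
  obtain ⟨m, hm⟩ : ∃ m, m = simChoice.run s := ⟨_, rfl⟩
  rw [← hm] at g8 g12 g13 g15 g11 ha hrun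
  have h' := h.agree ha (by decide) (by decide)
  have g16 := simMode_run h' hx g8 g12 g13 g15 (g11.trans hd)
  have hb := simMode.agree_run m
  obtain ⟨m', hm'⟩ : ∃ m', m' = simMode.run m := ⟨_, rfl⟩
  rw [← hm'] at g16 hb hrun
  rw [hrun]
  exact simMove_run (h'.agree hb (by decide) (by decide)) ((hb.1 12 (by decide)).trans g12)
    ((hb.1 11 (by decide)).trans (g11.trans hd)) g16

theorem simStart_run {s : Store} {T : Tables I F} (hg : Given I L s)
    (hk : ∀ u, I.Reach u → Known F u s.arr s.numArr)
    (hT : Tables.ofStore F s.arr s.numArr s.etab = T) (hm : s.arr 21 = fun _ => 0) :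
    Simulates L T (Tables.start I) [I.s] (simStart.run s) := by
  have h9 := hg.zero
  have h1 := hg.start
  have hv : (simBegin.run s).reg 4 = 1 ∧ (simBegin.run s).reg 6 = I.s ∧
      (simBegin.run s).reg 7 = 0 ∧ (simBegin.run s).arr 2 = Function.update (s.arr 2) 0 I.s ∧
      (simBegin.run s).arr 21 = Function.update (s.arr 21) I.s 1 := by
    simp [simBegin, Code.block, Code.run, Op.run, h9, h1]
  have ha := simBegin.agree_run s
  have hrun : simStart.run s = simFlag.run (simBegin.run s) := by rw [simStart, Code.run]
  have hag := simStart.agree_run s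
  obtain ⟨m, hm'⟩ : ∃ m, m = simBegin.run s := ⟨_, rfl⟩
  rw [← hm'] at ha hrun hv
  obtain ⟨v1, v2, v3, v4, v5⟩ := hv
  have hb := simFlag.agree_run m
  have hflag := simFlag_run (((ha.1 2 (by decide)).trans hg.target))
    ((ha.1 9 (by decide)).trans h9) v2
  rw [← hrun] at hb hflag
  refine ⟨hg.agree hag (by decide), fun u hu => (hk u hu).agree hag (by decide),
    (Tables.ofStore_agree hag (by decide) (by decide)).trans hT, ?_, ?_, ?_, hflag, ?_, ?_⟩
  · intro u
    rw [hb.2.1 21 (by decide), v5, hm]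
    simp [Tables.start, Function.update_apply, Fin.ext_iff]
  · rw [hb.1 6 (by decide), v2]
    rfl
  · rw [hb.1 7 (by decide), v3]
    simp [Tables.start]
  · rw [hb.1 4 (by decide), v1]
    simp
  · intro i hi
    have hi' : i = 0 := by simpa using hi
    subst hi'
    simp [hb.2.1 2 (by decide), v4]

/-- The loop follows the play `q`, and the rest `r` of it counts the remaining rounds; there are at
most `2 * n` by `NoEven.length_le`. -/
theorem simProg_triple {T : Tables I F} {q : List (Fin n)} (hq : I.IsPlay (I.s :: q))
    (hsim : T.Sim (Tables.start I) q) (hself : ∀ u, F.top u = none → F.suc u = u)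
    (hloop : ∀ u, ¬ I.graph.Adj u u) :
    Triple simProg (fun s => Given I L s ∧ (∀ u, I.Reach u → Known F u s.arr s.numArr) ∧
      Tables.ofStore F s.arr s.numArr s.etab = T ∧ s.arr 21 = fun _ => 0)
      (simStart.time + ((simStep.time + 1) * (2 * n) + 1))
      (fun s => (List.range (s.reg 4)).map (s.arr 2) = (I.s :: q).map Fin.val) := by
  refine .seq (Mid := fun s => ∃ m ≤ 2 * n, ∃ σ r out, Simulates L T σ out s ∧ T.Sim σ r ∧
    I.s :: q = out ++ r ∧ r.length = m ∧ I.Reach σ.cur ∧ (σ.cur :: r).IsChain I.graph.Adj)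
    (Triple.code rfl ?_) (Triple.loop_le rfl rfl (fun m s => ∃ σ r out, Simulates L T σ out s ∧
      T.Sim σ r ∧ I.s :: q = out ++ r ∧ r.length = m ∧ I.Reach σ.cur ∧
      (σ.cur :: r).IsChain I.graph.Adj) (fun s hs => hs) ?_ ?_)
  · rintro s ⟨h1, h2, h3, h4⟩
    have := NoEven.length_le (p := I.s :: q) hq.noEvenCycle
    simp only [List.length_cons, Fintype.card_fin] at this
    exact ⟨q.length, by omega, Tables.start I, q, [I.s], simStart_run h1 h2 h3 h4, hsim, rfl, rfl,
      .refl, hq.arcs⟩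
  · rintro m s ⟨σ, r, out, h1, h2, h3, h4, h5, h6⟩ hb
    have hflag : s.reg 5 ≠ 0 := by
      simp only [Test.Passes, h1.given.zero] at hb
      omega
    have hcur : σ.cur ≠ I.t := fun h => hflag (h1.flag.2 h)
    cases r with
    | nil => exact absurd h2 hcur
    | cons x r =>
      obtain ⟨-, hd, hr⟩ := h2
      rw [List.isChain_cons_cons] at h6
      have hx : I.Reach x := h5.tail h6.1
      refine ⟨r.length, by simp at h4; omega, T.step σ x, r, out ++ [x], simStep_run h1 ?_ hx hd, hr,
        by simp [h3], rfl, hx, h6.2⟩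
      by_cases ht : F.top σ.cur = none
      -- Off the cycles `F.suc` is the vertex itself, to which no arc leads as there are no loops.
      · right
        rw [hd, hself _ ht]
        intro h
        rw [Fin.ext h] at h6
        exact hloop _ h6.1
      · exact Or.inl ((h1.known _ h5).suc ht).1
  · rintro m s ⟨σ, r, out, h1, h2, h3, h4, h5, h6⟩ hb
    have hflag : s.reg 5 = 0 := by
      simp only [Test.Passes, h1.given.zero] at hb
      omega
    have hcur : σ.cur = I.t := h1.flag.1 hflag
    cases r with
    | cons x r => exact absurd hcur h2.1
    | nil =>
      rw [List.append_nil] at h3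
      rw [h3]
      apply List.ext_getElem
      · simp [h1.count]
      · intro i hi hi'
        simp at hi'
        simp [h1.out i hi']

end

end ShortestPathGame

namespace ShortestPathGame

/-! ### The algorithm -/

section

variable {n : ℕ} {I : Game n} {F : Layout I} {ev : List (Event n)} {L : List (Fin n × Fin n)}

/-- The three passes and the simulation. -/
def solveProg : Prog := .seq (upProg firstFin firstArc) (.seq (downProg .skip secondArc)
  (.seq (upProg thirdFin thirdArc) simProg))

/-- The time for an event in the passes. -/
def passTime : ℕ := (Code.block [eventCode firstFin firstArc, Op.succ 5 5]).time + 1 +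
  ((Code.block [Op.pred 5 5, eventCode .skip secondArc]).time + 1) +
  ((Code.block [eventCode thirdFin thirdArc, Op.succ 5 5]).time + 1)

/-- Each of the three passes contributes 13 steps besides its rounds, 12 for the initial instruction
and 1 for the last test. -/
theorem solveProg_triple (hS : Schedule I F.rank ev) (ht : I.Reach I.t)
    (hself : ∀ u, F.top u = none → F.suc u = u) (hloop : ∀ u, ¬ I.graph.Adj u u) :
    Triple solveProg (fun s => Scheduled I L ev s ∧ Fresh 16 s)
      (39 + passTime * ev.length + (simStart.time + ((simStep.time + 1) * (2 * n) + 1)))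
      (fun s => ∃ q, I.Outcome [I.s] q ∧
        (List.range (s.reg 4)).map (s.arr 2) = (I.s :: q).map Fin.val) := by
  have h1 := upProg_triple (L := L) (J := fun pre arr numArr etab =>
    FirstStage F pre arr numArr etab ∧ Rest arr etab) (firstHandles hS)
  have h2 := downProg_triple (L := L) (J := fun pre arr numArr etab =>
    FirstStage F ev arr numArr etab ∧ Rest arr etab ∧ SecondStage F ev pre arr numArr)
    (secondHandles hS)
  have h3 := upProg_triple (L := L) (J := fun pre arr numArr etab =>
    FirstStage F ev arr numArr etab ∧ SecondStage F ev [] arr numArr ∧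
      arr 21 = (fun _ => 0) ∧ ThirdStage F pre arr numArr etab) (thirdHandles hS)
  have h4 : Triple simProg (fun s => Scheduled I L ev s ∧ FirstStage F ev s.arr s.numArr s.etab ∧
      SecondStage F ev [] s.arr s.numArr ∧ s.arr 21 = (fun _ => 0) ∧
      ThirdStage F ev s.arr s.numArr s.etab)
      (simStart.time + ((simStep.time + 1) * (2 * n) + 1))
      (fun s => ∃ q, I.Outcome [I.s] q ∧
        (List.range (s.reg 4)).map (s.arr 2) = (I.s :: q).map Fin.val) := by
    rintro σ ⟨g1, g2, g3, g4, g5⟩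
    obtain ⟨q, hq, ho, hsim⟩ := Tables.exists_outcome _ (Tables.valid_ofStore hS g2 g3 g5) ht
    obtain ⟨τ, k, e1, e2, e3⟩ := simProg_triple (L := L) hq hsim hself hloop σ
      ⟨g1.given, fun u hu => g2.known hS hu, rfl, g4⟩
    exact ⟨τ, k, e1, e2, q, ho, e3⟩
  intro σ hσ
  have hR : Rest (Store.view σ).arr (Store.view σ).etab :=
    ⟨hσ.2.arr 21 (by omega) (by omega), fun i _ => hσ.2.etab i⟩
  refine ((h1.weaken le_rfl fun s hs => ?_).seq ((h2.weaken le_rfl fun s hs => ?_).seq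
    (h3.seq h4))).weaken ?_ (fun s hs => hs) σ ⟨hσ.1, FirstStage.init hσ.2, hR⟩
  · exact ⟨hs.1, hs.2.1, hs.2.2, SecondStage.init⟩
  · exact ⟨hs.1, hs.2.1, hs.2.2.2, hs.2.2.1.mode, ThirdStage.init hs.2.2.1⟩
  · simp only [passTime, Nat.add_mul]
    omega

end

theorem Ranking.suc_of_top_none {n : ℕ} {I : Game n} {K : Ranking I} {H : SimpleGraph (Fin n)}
    {u : Fin n} (h : K.top H u = none) : K.suc H u = u := by
  unfold Ranking.top at h
  unfold Ranking.suc
  split_ifs at h ⊢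
  rfl

/-- A single program finds the path in linear time. -/
theorem exists_program :
    ∃ (P : ShortestPathGame.Prog) (C : ℕ),
      ∀ (n : ℕ) (I : ShortestPathGame.Game n) (L : List (Fin n × Fin n)),
        ShortestPathGame.IsDirectedCactus I.graph →
        (∀ u v, I.graph.Adj u v → 0 ≤ I.cost u v) →
        Relation.ReflTransGen I.graph.Adj I.s I.t →
        ShortestPathGame.ListsArcs I.graph L →
        ∃ (p : List (Fin n)) (τ : ShortestPathGame.Memory) (k : ℕ),
          I.IsSPEPath p ∧
          ShortestPathGame.Exec P (ShortestPathGame.input I L) τ k ∧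
          k ≤ C * n ∧
          ShortestPathGame.output τ = p.map Fin.val := by
  obtain ⟨a, ha⟩ : ∃ a, a = linkArc.time + 1 := ⟨_, rfl⟩
  obtain ⟨b, hb⟩ : ∃ b, b = searchStep.time + 1 := ⟨_, rfl⟩
  obtain ⟨c, hc⟩ : ∃ c, c = passTime := ⟨_, rfl⟩
  obtain ⟨d, hd⟩ : ∃ d, d = simStep.time + 1 := ⟨_, rfl⟩
  obtain ⟨e, he⟩ : ∃ e, e = searchInit.time + simStart.time + 54 := ⟨_, rfl⟩
  -- At most `2 * n` arcs, `4 * n` steps of the search, `4 * n` events and `2 * n` moves; `e`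
  -- gathers all additive constants, and `e ≤ e * n` because the vertex `s` exists.
  refine ⟨.seq searchProg solveProg, 2 * a + 4 * b + 4 * c + 2 * d + e, ?_⟩
  intro n I L hG _ ht hL
  obtain ⟨σ, k, h1, h2, K, ev, hS, hev, h3, h4⟩ := searchProg_triple hL (input I L) rfl
  have hl := hL.length_le hG I.s.pos
  obtain ⟨H, hH, hO⟩ := hG
  obtain ⟨τ, l, g1, g2, q, g3, g4⟩ := solveProg_triple (F := K.layout hH hO) (L := L) hS ht
    (fun u hu => Ranking.suc_of_top_none hu)
    (fun u hu => hO.2 u u hu hu) σ ⟨h3, h4⟩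
  refine ⟨I.s :: q, τ, k + l, ⟨q, g3, rfl⟩, .seq h1 g1, ?_, g4⟩
  rw [← ha, ← hb] at h2
  rw [← hc, ← hd] at g2
  have e1 : a * L.length ≤ a * (2 * n) := Nat.mul_le_mul_left _ hl
  have e2 : b * (2 * n + L.length) ≤ b * (4 * n) := Nat.mul_le_mul_left _ (by omega)
  have e3 : c * ev.length ≤ c * (4 * n) := Nat.mul_le_mul_left _ (by omega)
  have e4 : e ≤ e * n := Nat.le_mul_of_pos_right _ I.s.pos
  have e5 : (2 * a + 4 * b + 4 * c + 2 * d + e) * n =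
      a * (2 * n) + b * (4 * n) + c * (4 * n) + d * (2 * n) + e * n := by ring
  rw [e5]
  omega

end ShortestPathGame

theorem corollary6 :
    ∃ (P : ShortestPathGame.Prog) (C : ℕ),
      ∀ (n : ℕ) (I : ShortestPathGame.Game n) (L : List (Fin n × Fin n)),
        ShortestPathGame.IsDirectedCactus I.graph →
        (∀ u v, I.graph.Adj u v → 0 ≤ I.cost u v) →
        Relation.ReflTransGen I.graph.Adj I.s I.t →
        ShortestPathGame.ListsArcs I.graph L →
        ∃ (p : List (Fin n)) (τ : ShortestPathGame.Memory) (k : ℕ),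
          I.IsSPEPath p ∧
          ShortestPathGame.Exec P (ShortestPathGame.input I L) τ k ∧
          k ≤ C * n ∧
          ShortestPathGame.output τ = p.map Fin.val :=
  ShortestPathGame.exists_program
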